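/- For $a\ge 0$ let $d\omega_a(x)=x^a\,dx$ on $\mathbb R^+=(0,\infty)$, $L^2_a=L^2(\mathbb R^+,d\omega_a)$ and $\mathcal B_a=\partial_{xx}+\frac ax\partial_x$. Let $\mathscr S^+$ be the space of all $\varphi\in C^\infty(\mathbb R^+;\mathbb C)$ with $\sup_{x>0}\left|x^m\left(\frac1x\partial_x\right)^k\varphi(x)\right|<\infty$ for all $m,k\in\mathbb N_0$, and let $\mathbb S^+$ be the space of all $F\in C^\infty(\mathbb R^+\times\mathbb R;\mathbb C)$ with $$\sup_{k+\ell\le p}\ \sup_{(x,t)\in\mathbb R^+\times\mathbb R}(1+x^2+t^2)^{p/2}\left|\left(\tfrac1x\partial_x\right)^k\partial_t^\ell F(x,t)\right|<\infty\qquad\text{for all }p\in\mathbb N_0 .$$ Consider the Cauchy problem with Neumann condition $$\begin{cases}\partial_tu-i\,\mathcal B_au=F(x,t), & x>0,\ t\in\mathbb R,\\ \lim_{x\to0^+}x^a\,\partial_xu(x,t)=0, & t\in\mathbb R,\\ u(x,0)=\varphi(x), & x>0.\end{cases}\tag{1}$$ A solution of (1) is a function $u:\mathbb R^+\times\mathbb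 R\to\mathbb C$ that is $C^2$ in $x$ and differentiable in $t$, satisfies (1) pointwise, and is such that $t\mapsto u(\cdot,t)$ is a differentiable curve in $L^2_a$ with derivative $\partial_tu(\cdot,t)$. Corollary. Given $a\ge0$, there exists a constant $C(a)>0$ such that, for every $\varphi\in\mathscr S^+$ and $F\in\mathbb S^+$, problem (1) has a unique solution $u$, and $u$ satisfies the a priori inequality $$\left(\int_{\mathbb R}\int_0^\infty|u(x,t)|^{\frac{2(a+3)}{a+1}}d\omega_a(x)\,dt\right)^{\frac{a+1}{2(a+3)}}\le C(a)\left\{\|\varphi\|_{L^2_a}+\left(\int_{\mathbb R}\int_0^\infty|F(x,t)|^{\frac{2(a+3)}{a+5}}d\omega_a(x)\,dt\right)^{\frac{a+5}{2(a+3)}}\right\}.$$ -/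

import Mathlib

open MeasureTheory Set Filter Topology
open scoped ENNReal ContDiff

noncomputable section

namespace BesselSchrodinger

/-- The measure `dω_a(x) = x^a dx` on the half-line `(0, ∞)`, as a measure on `ℝ`. -/
def omega (a : ℝ) : Measure ℝ :=
  (volume.restrict (Ioi (0 : ℝ))).withDensity fun x => ENNReal.ofReal (x ^ a)

/-- The operator `f ↦ (1/x) ∂_x f`. Only its values at `x > 0` are ever used. -/
def invXDeriv (f : ℝ → ℂ) : ℝ → ℂ := fun x => ((x⁻¹ : ℝ) : ℂ) * deriv f x

/-- The Bessel operator `B_a f = f'' + (a/x) f'`, used at `x > 0`. -/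
def besselOp (a : ℝ) (f : ℝ → ℂ) : ℝ → ℂ :=
  fun x => deriv (deriv f) x + ((a / x : ℝ) : ℂ) * deriv f x

/-- The space `𝒮⁺`: smooth functions on `(0, ∞)` such that
`sup_{x > 0} |x^m ((1/x) ∂_x)^k φ(x)| < ∞` for all `m, k`. -/
structure IsSchwartzHalfLine (φ : ℝ → ℂ) : Prop where
  smooth : ContDiffOn ℝ ∞ φ (Ioi 0)
  bounded : ∀ m k : ℕ, ∃ M : ℝ, ∀ x : ℝ, 0 < x → x ^ m * ‖invXDeriv^[k] φ x‖ ≤ M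

/-- The space `𝕊⁺`: smooth functions `F(x, t)` on `(0, ∞) × ℝ` such that, for all `p` and all
`k + ℓ ≤ p`, `sup (1 + x² + t²)^{p/2} |((1/x) ∂_x)^k ∂_t^ℓ F(x, t)| < ∞`. -/
structure IsSchwartzHalfPlane (F : ℝ → ℝ → ℂ) : Prop where
  smooth : ContDiffOn ℝ ∞ (fun z : ℝ × ℝ => F z.1 z.2) (Ioi 0 ×ˢ univ)
  bounded : ∀ p k l : ℕ, k + l ≤ p → ∃ M : ℝ, ∀ x t : ℝ, 0 < x →
    (1 + x ^ 2 + t ^ 2) ^ ((p : ℝ) / 2) *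
      ‖invXDeriv^[k] (fun y => iteratedDeriv l (fun s => F y s) t) x‖ ≤ M

/-- `u = u(x, t)` is a solution of the Cauchy problem with Neumann condition
`∂_t u - i B_a u = F` on `(0, ∞) × ℝ`, `lim_{x → 0⁺} x^a ∂_x u(x, t) = 0`, `u(x, 0) = φ(x)`.
The equation, the boundary condition and the initial condition hold pointwise, and `t ↦ u(·, t)`
is a differentiable curve in `L²_a = L²((0, ∞), dω_a)` with derivative `∂_t u(·, t)`. This makes
`u(·, t)` stay in the domain of the self-adjoint realization of `B_a` in `L²_a`. -/
structure IsSolution (a : ℝ) (φ : ℝ → ℂ) (F : ℝ → ℝ → ℂ) (u : ℝ → ℝ → ℂ) : Prop where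
  contDiff_space : ∀ t : ℝ, ContDiffOn ℝ 2 (fun x => u x t) (Ioi 0)
  differentiable_time : ∀ x : ℝ, 0 < x → Differentiable ℝ (fun t => u x t)
  equation : ∀ x t : ℝ, 0 < x →
    deriv (fun s => u x s) t - Complex.I * besselOp a (fun y => u y t) x = F x t
  neumann : ∀ t : ℝ,
    Tendsto (fun x : ℝ => ((x ^ a : ℝ) : ℂ) * deriv (fun y => u y t) x) (𝓝[>] 0) (𝓝 0)
  initial : ∀ x : ℝ, 0 < x → u x 0 = φ x
  memLp : ∀ t : ℝ, MemLp (fun x => u x t) 2 (omega a)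
  deriv_memLp : ∀ t : ℝ, Tendsto
    (fun h : ℝ => eLpNorm
      (fun x => ((h⁻¹ : ℝ) : ℂ) * (u x (t + h) - u x t) - deriv (fun s => u x s) t) 2 (omega a))
    (𝓝[≠] 0) (𝓝 0)

/-- The space-time norm `(∫_ℝ ∫_0^∞ |u(x, t)|^p dω_a(x) dt)^{1/p}`, with values in `[0, ∞]`. -/
def spaceTimeNorm (a p : ℝ) (u : ℝ → ℝ → ℂ) : ℝ≥0∞ :=
  (∫⁻ t : ℝ, ∫⁻ x : ℝ, ‖u x t‖ₑ ^ p ∂(omega a)) ^ (1 / p)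

end BesselSchrodinger

end

open MeasureTheory Set Filter Topology
open scoped ENNReal ContDiff

noncomputable section

namespace BesselSchrodinger

/-! ### The measure `x ^ a dx` -/

/-! The Hankel transform `hank a`, with kernel the normalized Bessel function `bes a (ξ y)`, turns
the Bessel operator into multiplication by `-ξ²`. On the frequency side the equation is therefore a
linear ODE in `t` for each `ξ`, solved by Duhamel's formula with the unimodular multiplier `chirp t
ξ = exp (-i t ξ²)`. Transforming back gives the solution `sol`. Even smooth behaviour of the kernel
at `0` supplies the Neumann condition.

All facts about the transform come from one formula, `hank_gau`: a Gaussian of complex parameter `z`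
is sent to `z ^ (-(a+1)/2)` times the Gaussian of parameter `z⁻¹`. Inversion and Plancherel are
immediate on the span of Gaussians. This span is dense in the weighted space `InX`, which embeds in
both `L¹` and `L²`, so a single approximating sequence serves both norms (`exists_gauSpan_close`,
`exists_seq_gauSpan`). The same formula shows that transform, chirp, transform equals chirp, dilated
transform, chirp (`hank_chirp_hank`). This is the explicit Schrödinger kernel, and it yields the
dispersive bound `L¹ → L^∞` with decay `|τ| ^ (-(a+1)/2)`.

The Strichartz estimate is proved for the bilinear form `pairQ a τ f g`, that is, for the propagator
paired with `g`. Its `L¹ × L¹` and `L² × L²` bounds are interpolated by cutting both functions along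
dyadic level sets and summing a Schur-type double series. At the exponent `strP a` the decay becomes
`|τ| ^ (-strG a)` with `0 < strG a < 1`. The diagonal Hardy–Littlewood–Sobolev inequality with this
kernel has exponent `2 / (2 - strG a)`, which is again `strP a`; this coincidence is what allows the
same exponent in space and time. The result is `exists_bilinear_strichartz`, with the modulus inside
both time integrals. It gives the homogeneous part by the `T T*` argument (`exists_freqAvg_bound`)
and the Duhamel part directly, since restricting `s` to the interval between `0` and `t` only
decreases the integral. Testing `sol` against truncations of `ū |u| ^ (q - 2)` converts these into
the norm estimate.

Uniqueness is conservation of the `L²` norm. If `f` and its Bessel image lie in `L²` and the Neumann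
condition holds, the flux `x ^ a f'` is `O(x ^ ((a+1)/2))`. The boundary term in the integration by
parts then has no nonzero limit at either end, so the imaginary part of the quadratic form vanishes
(`InDomain.integral_im_eq_zero`). -/

lemma measurable_density (a : ℝ) : Measurable fun x : ℝ => ENNReal.ofReal (x ^ a) := by fun_prop

instance sigmaFinite_omega (a : ℝ) : SigmaFinite (omega a) := by
  unfold omega
  exact SigmaFinite.withDensity_of_ne_top' (fun x => ENNReal.ofReal_ne_top)

lemma ae_omega_iff {a : ℝ} {P : ℝ → Prop} :
    (∀ᵐ x ∂(omega a), P x) ↔ ∀ᵐ x ∂(volume.restrict (Ioi (0 : ℝ))), P x := by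
  unfold omega
  rw [ae_withDensity_iff (measurable_density a)]
  have h : ∀ᵐ x ∂(volume.restrict (Ioi (0 : ℝ))), ENNReal.ofReal (x ^ a) ≠ 0 := by
    filter_upwards [ae_restrict_mem measurableSet_Ioi] with x hx
    have : 0 < x ^ a := Real.rpow_pos_of_pos hx a
    simpa using this
  constructor
  · intro H
    filter_upwards [H, h] with x h1 h2 using h1 h2
  · intro H
    filter_upwards [H] with x h1 _ using h1

lemma ae_omega_pos (a : ℝ) : ∀ᵐ x ∂(omega a), 0 < x :=
  ae_omega_iff.2 (ae_restrict_mem measurableSet_Ioi)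

lemma omega_absolutelyContinuous (a : ℝ) : omega a ≪ volume.restrict (Ioi (0 : ℝ)) :=
  withDensity_absolutelyContinuous _ _

lemma integral_omega {E : Type*} [NormedAddCommGroup E] [NormedSpace ℝ E] (a : ℝ) (f : ℝ → E) :
    ∫ x, f x ∂(omega a) = ∫ x in Ioi (0 : ℝ), (x ^ a) • f x := by
  unfold omega
  rw [integral_withDensity_eq_integral_toReal_smul (measurable_density a)
    (Eventually.of_forall fun x => ENNReal.ofReal_lt_top)]
  refine setIntegral_congr_fun measurableSet_Ioi fun x hx => ?_
  rw [ENNReal.toReal_ofReal (Real.rpow_nonneg (le_of_lt hx) a)]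

lemma integrable_omega_iff {E : Type*} [NormedAddCommGroup E] [NormedSpace ℝ E] {a : ℝ}
    {f : ℝ → E} :
    Integrable f (omega a) ↔ IntegrableOn (fun x => (x ^ a) • f x) (Ioi 0) := by
  unfold omega
  rw [integrable_withDensity_iff_integrable_smul' (measurable_density a)
    (Eventually.of_forall fun x => ENNReal.ofReal_lt_top)]
  refine integrableOn_congr_fun (fun x hx => ?_) measurableSet_Ioi
  rw [ENNReal.toReal_ofReal (Real.rpow_nonneg (le_of_lt hx) a)]

lemma aestronglyMeasurable_omega_of_continuousOn {E : Type*} [NormedAddCommGroup E]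
    {a : ℝ} {f : ℝ → E} (hf : ContinuousOn f (Ioi 0)) : AEStronglyMeasurable f (omega a) := by
  refine AEStronglyMeasurable.mono_ac (omega_absolutelyContinuous a) ?_
  exact hf.aestronglyMeasurable measurableSet_Ioi

/-- The exponent of the polynomial weight that makes weighted `L²` functions integrable. -/
def wexp (a : ℝ) : ℕ := ⌈a⌉₊ + 1

/-- The polynomial weight `(1 + x²)^M`. -/
def rho (a x : ℝ) : ℝ := (1 + x ^ 2) ^ wexp a

lemma rho_pos (a x : ℝ) : 0 < rho a x := by unfold rho; positivity

lemma one_le_rho (a x : ℝ) : 1 ≤ rho a x :=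
  one_le_pow₀ (by nlinarith [sq_nonneg x])

lemma continuous_rho (a : ℝ) : Continuous (rho a) := by unfold rho; fun_prop

lemma rpow_le_one_add_sq_pow {a : ℝ} {x : ℝ} (hx : 0 < x) (n : ℕ) (hn : a ≤ 2 * n)
    (ha : 0 ≤ a) : x ^ a ≤ (1 + x ^ 2) ^ n := by
  have h1 : x ^ a ≤ (1 + x ^ 2) ^ (a / 2) := by
    have : x ^ a = (x ^ 2) ^ (a / 2) := by
      rw [← Real.rpow_natCast, ← Real.rpow_mul hx.le]; congr 1; push_cast; ring
    rw [this]
    exact Real.rpow_le_rpow (by positivity) (by linarith) (by positivity)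
  refine h1.trans ?_
  rw [← Real.rpow_natCast (1 + x ^ 2) n]
  have h2 : (1 : ℝ) ≤ 1 + x ^ 2 := by nlinarith [sq_nonneg x]
  exact Real.rpow_le_rpow_of_exponent_le h2 (by linarith)

lemma integrable_inv_one_add_sq_pow {a : ℝ} (ha : 0 ≤ a) {n : ℕ} (hn : a + 2 ≤ 2 * n) :
    Integrable (fun x : ℝ => ((1 + x ^ 2) ^ n)⁻¹) (omega a) := by
  rw [integrable_omega_iff]
  refine Integrable.mono' (g := fun x : ℝ => (1 + x ^ 2)⁻¹) integrable_inv_one_add_sq.integrableOn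
    (Measurable.aestronglyMeasurable (by fun_prop)) ?_
  filter_upwards [ae_restrict_mem measurableSet_Ioi] with x hx
  have hx : 0 < x := hx
  have hn1 : 1 ≤ n := by
    by_contra h
    have : n = 0 := by omega
    subst this
    norm_num at hn
    linarith
  -- One factor `1 + x²` is kept as the integrable majorant; the remaining `m` factors absorb `x ^
  -- a` because `a ≤ 2 m`.
  obtain ⟨m, rfl⟩ := Nat.exists_eq_add_of_le' hn1
  have h1 := rpow_le_one_add_sq_pow hx m (by push_cast at hn; linarith) ha
  have h2 : (0 : ℝ) < 1 + x ^ 2 := by positivity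
  rw [smul_eq_mul, Real.norm_of_nonneg (by positivity), pow_succ, mul_inv, ← mul_assoc]
  refine mul_le_of_le_one_left (by positivity) ?_
  rw [← div_eq_mul_inv]
  exact div_le_one_of_le₀ h1 (by positivity)

lemma memLp_inv_rho {a : ℝ} (ha : 0 ≤ a) :
    MemLp (fun x => (((rho a x)⁻¹ : ℝ) : ℂ)) 2 (omega a) := by
  have hm : AEStronglyMeasurable (fun x => (((rho a x)⁻¹ : ℝ) : ℂ)) (omega a) :=
    ((Complex.continuous_ofReal.comp
      ((continuous_rho a).inv₀ fun x => (rho_pos a x).ne')).aestronglyMeasurable)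
  rw [memLp_two_iff_integrable_sq_norm hm]
  have : (fun x => ‖(((rho a x)⁻¹ : ℝ) : ℂ)‖ ^ 2)
      = fun x : ℝ => ((1 + x ^ 2) ^ (2 * wexp a))⁻¹ := by
    ext x
    rw [Complex.norm_real, Real.norm_of_nonneg (inv_nonneg.2 (rho_pos a x).le), inv_pow, rho,
      ← pow_mul, mul_comm]
  rw [this]
  refine integrable_inv_one_add_sq_pow ha ?_
  have := Nat.le_ceil a
  unfold wexp
  push_cast
  linarith

/-! ### The weighted space `L²(rho² dω)` -/

/-- `f` is square integrable against `rho² dω`. -/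
abbrev InX (a : ℝ) (f : ℝ → ℂ) : Prop := MemLp (fun x => ((rho a x : ℝ) : ℂ) * f x) 2 (omega a)

lemma InX.aestronglyMeasurable {a : ℝ} {f : ℝ → ℂ} (hf : InX a f) :
    AEStronglyMeasurable f (omega a) := by
  have h1 : AEStronglyMeasurable (fun x => (((rho a x)⁻¹ : ℝ) : ℂ)) (omega a) :=
    ((Complex.continuous_ofReal.comp
      ((continuous_rho a).inv₀ fun x => (rho_pos a x).ne')).aestronglyMeasurable)
  refine (h1.mul hf.1).congr (Eventually.of_forall fun x => ?_)
  have : ((rho a x : ℝ) : ℂ) ≠ 0 := by exact_mod_cast (rho_pos a x).ne'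
  simp only [Pi.mul_apply]
  push_cast
  field_simp

lemma eLpNorm_two_le_weighted (a : ℝ) (f : ℝ → ℂ) :
    eLpNorm f 2 (omega a) ≤ eLpNorm (fun x => ((rho a x : ℝ) : ℂ) * f x) 2 (omega a) := by
  refine eLpNorm_mono fun x => ?_
  rw [norm_mul, Complex.norm_real, Real.norm_of_nonneg (rho_pos a x).le]
  exact le_mul_of_one_le_left (norm_nonneg _) (one_le_rho a x)

/-- Cauchy–Schwarz for `f = rho⁻¹ · (rho f)`. Since `rho⁻¹` is in `L²`, approximation in the
weighted norm is approximation in `L¹` and in `L²` at once. -/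
lemma eLpNorm_one_le_weighted (a : ℝ) {f : ℝ → ℂ} (hf : AEStronglyMeasurable f (omega a)) :
    eLpNorm f 1 (omega a) ≤ eLpNorm (fun x => (((rho a x)⁻¹ : ℝ) : ℂ)) 2 (omega a) *
      eLpNorm (fun x => ((rho a x : ℝ) : ℂ) * f x) 2 (omega a) := by
  have h1 : AEStronglyMeasurable (fun x => (((rho a x)⁻¹ : ℝ) : ℂ)) (omega a) :=
    ((Complex.continuous_ofReal.comp
      ((continuous_rho a).inv₀ fun x => (rho_pos a x).ne')).aestronglyMeasurable)
  have h2 : AEStronglyMeasurable (fun x => ((rho a x : ℝ) : ℂ) * f x) (omega a) :=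
    (Complex.continuous_ofReal.comp (continuous_rho a)).aestronglyMeasurable.mul hf
  have h3 := eLpNorm_smul_le_mul_eLpNorm (p := 2) (q := 2) (r := 1) h2 h1
  refine le_trans (le_of_eq ?_) h3
  congr 1
  ext x
  have : ((rho a x : ℝ) : ℂ) ≠ 0 := by exact_mod_cast (rho_pos a x).ne'
  simp only [Pi.smul_apply', smul_eq_mul]
  push_cast
  field_simp

lemma InX.memLp_two {a : ℝ} {f : ℝ → ℂ} (hf : InX a f) : MemLp f 2 (omega a) :=
  ⟨hf.aestronglyMeasurable, (eLpNorm_two_le_weighted a f).trans_lt hf.2⟩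

lemma InX.integrable {a : ℝ} (ha : 0 ≤ a) {f : ℝ → ℂ} (hf : InX a f) :
    Integrable f (omega a) := by
  rw [← memLp_one_iff_integrable]
  exact ⟨hf.aestronglyMeasurable, (eLpNorm_one_le_weighted a hf.aestronglyMeasurable).trans_lt
    (ENNReal.mul_lt_top (memLp_inv_rho ha).2 hf.2)⟩

lemma InX.mono {a : ℝ} {f g : ℝ → ℂ} (hf : InX a f) (hg : AEStronglyMeasurable g (omega a))
    (h : ∀ᵐ x ∂(omega a), ‖g x‖ ≤ ‖f x‖) : InX a g := by
  refine MemLp.of_le hf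
    ((Complex.continuous_ofReal.comp (continuous_rho a)).aestronglyMeasurable.mul hg) ?_
  filter_upwards [h] with x hx
  simp only [norm_mul]
  gcongr

lemma InX.add {a : ℝ} {f g : ℝ → ℂ} (hf : InX a f) (hg : InX a g) :
    InX a (fun x => f x + g x) := by
  refine (MemLp.add hf hg).congr_norm ?_ ?_
  · exact ((Complex.continuous_ofReal.comp (continuous_rho a)).aestronglyMeasurable.mul
      (hf.aestronglyMeasurable.add hg.aestronglyMeasurable))
  · exact Eventually.of_forall fun x => by simp [mul_add]

lemma InX.const_mul {a : ℝ} {f : ℝ → ℂ} (hf : InX a f) (c : ℂ) : InX a (fun x => c * f x) := by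
  have := MemLp.const_mul hf c
  refine this.congr_norm ?_ (Eventually.of_forall fun x => by simp only [norm_mul]; ring)
  exact ((Complex.continuous_ofReal.comp (continuous_rho a)).aestronglyMeasurable.mul
      (hf.aestronglyMeasurable.const_mul c))

lemma InX.sub {a : ℝ} {f g : ℝ → ℂ} (hf : InX a f) (hg : InX a g) :
    InX a (fun x => f x - g x) := by
  have := hf.add (hg.const_mul (-1))
  simpa [sub_eq_add_neg] using this

/-- Sufficient decay for membership in the weighted space. -/
lemma InX.of_decay {a : ℝ} (ha : 0 ≤ a) {f : ℝ → ℂ} (hf : AEStronglyMeasurable f (omega a))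
    {K : ℝ} (h : ∀ x : ℝ, 0 < x → ‖f x‖ ≤ K * ((1 + x ^ 2) ^ (2 * wexp a))⁻¹) : InX a f := by
  refine MemLp.of_le_mul (c := K) (memLp_inv_rho ha)
    ((Complex.continuous_ofReal.comp (continuous_rho a)).aestronglyMeasurable.mul hf) ?_
  filter_upwards [ae_omega_pos a] with x hx
  have hr := rho_pos a x
  rw [norm_mul, Complex.norm_real, Complex.norm_real, Real.norm_of_nonneg hr.le,
    Real.norm_of_nonneg (inv_nonneg.2 hr.le)]
  have h1 := h x hx
  have h2 : (1 + x ^ 2) ^ (2 * wexp a) = rho a x * rho a x := by unfold rho; ring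
  rw [h2] at h1
  calc rho a x * ‖f x‖ ≤ rho a x * (K * (rho a x * rho a x)⁻¹) := by gcongr
    _ = K * (rho a x)⁻¹ := by field_simp

/-! ### The normalized Bessel function -/

/-- The rising factorial `b (b + 1) ⋯ (b + k - 1)`. -/
def poch (b : ℝ) (k : ℕ) : ℝ := ∏ i ∈ Finset.range k, (b + i)

lemma poch_pos {b : ℝ} (hb : 0 < b) (k : ℕ) : 0 < poch b k :=
  Finset.prod_pos fun i _ => by positivity

lemma poch_succ (b : ℝ) (k : ℕ) : poch b (k + 1) = poch b k * (b + k) :=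
  Finset.prod_range_succ _ _

lemma poch_succ' (b : ℝ) (k : ℕ) : poch b (k + 1) = b * poch (b + 1) k := by
  unfold poch
  rw [Finset.prod_range_succ', mul_comm]
  congr 1
  · simp
  · refine Finset.prod_congr rfl fun i _ => ?_
    push_cast
    ring

lemma pow_le_poch {b : ℝ} (hb : 0 < b) (k : ℕ) : (min b 1) ^ k ≤ poch b k := by
  unfold poch
  rw [← Finset.card_range k, ← Finset.prod_const, Finset.card_range]
  refine Finset.prod_le_prod (fun i _ => by positivity) fun i _ => ?_
  have : (0 : ℝ) ≤ i := by positivity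
  linarith [min_le_left b 1]

/-- The confluent hypergeometric limit function `₀F₁(b; z)`. -/
def hyp (b z : ℝ) : ℝ := ∑' k : ℕ, z ^ k / (k.factorial * poch b k)

lemma abs_hyp_term_le {b : ℝ} (hb : 0 < b) (z : ℝ) (k : ℕ) :
    ‖z ^ k / (k.factorial * poch b k)‖ ≤ (|z| / min b 1) ^ k / k.factorial := by
  have h0 : 0 < min b 1 := by positivity
  have h1 := pow_le_poch hb k
  have h2 := poch_pos hb k
  rw [norm_div, norm_pow, Real.norm_eq_abs, Real.norm_of_nonneg (by positivity), div_pow, div_div,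
    mul_comm (k.factorial : ℝ)]
  gcongr

lemma summable_hyp {b : ℝ} (hb : 0 < b) (z : ℝ) :
    Summable fun k : ℕ => z ^ k / (k.factorial * poch b k) :=
  Summable.of_norm_bounded (Real.summable_pow_div_factorial _) (abs_hyp_term_le hb z)

lemma hyp_deriv_term {b : ℝ} (hb : 0 < b) (z : ℝ) (k : ℕ) :
    ((k + 1 : ℕ) : ℝ) * z ^ k / ((k + 1).factorial * poch b (k + 1)) =
      (z ^ k / (k.factorial * poch (b + 1) k)) / b := by
  have h1 := poch_pos (b := b + 1) (by linarith) k
  rw [poch_succ', Nat.factorial_succ]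
  push_cast
  field_simp

lemma hasDerivAt_hyp {b : ℝ} (hb : 0 < b) (z : ℝ) : HasDerivAt (hyp b) (hyp (b + 1) z / b) z := by
  -- Termwise differentiation takes place on a ball around `0` that contains `z`; there the
  -- differentiated series is dominated by its value at `R`, which is the series with parameter `b +
  -- 1` at `R`, divided by `b`.
  set R : ℝ := |z| + 1
  have hb1 : 0 < b + 1 := by linarith
  have hterm : ∀ (n : ℕ) (y : ℝ),
      HasDerivAt (fun y : ℝ => y ^ n / (n.factorial * poch b n))
        ((n : ℝ) * y ^ (n - 1) / (n.factorial * poch b n)) y := fun n y =>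
    (hasDerivAt_pow n y).div_const _
  let u : ℕ → ℝ := fun n => (n : ℝ) * R ^ (n - 1) / (n.factorial * poch b n)
  have hu : Summable u := by
    rw [← summable_nat_add_iff 1]
    have : (fun n => u (n + 1)) = fun k : ℕ => (R ^ k / (k.factorial * poch (b + 1) k)) / b := by
      ext k
      exact hyp_deriv_term hb R k
    rw [this]
    exact (summable_hyp hb1 R).div_const b
  have hball : ∀ y ∈ Metric.ball (0 : ℝ) R, ∀ n : ℕ,
      ‖(n : ℝ) * y ^ (n - 1) / (n.factorial * poch b n)‖ ≤ u n := by
    intro y hy n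
    have h2 := poch_pos hb n
    rw [mem_ball_zero_iff, Real.norm_eq_abs] at hy
    simp only [u]
    rw [norm_div, norm_mul, norm_pow, Real.norm_of_nonneg (n.cast_nonneg),
      Real.norm_of_nonneg (by positivity : (0 : ℝ) ≤ n.factorial * poch b n), Real.norm_eq_abs]
    gcongr
  have hz : z ∈ Metric.ball (0 : ℝ) R := by simp [R]
  have key := hasDerivAt_tsum_of_isPreconnected (t := Metric.ball (0 : ℝ) R) hu
    Metric.isOpen_ball (convex_ball (0 : ℝ) R).isPreconnected
    (fun n y _ => hterm n y) (fun n y hy => hball y hy n) (y₀ := z) hz (summable_hyp hb z) hz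
  convert! key using 1
  have hs : Summable fun n : ℕ => (n : ℝ) * z ^ (n - 1) / (n.factorial * poch b n) :=
    Summable.of_norm_bounded hu (hball z hz)
  rw [hs.tsum_eq_zero_add]
  simp only [CharP.cast_eq_zero, zero_mul, zero_div, zero_add]
  unfold hyp
  rw [← tsum_div_const]
  exact tsum_congr fun k => (hyp_deriv_term hb z k).symm

/-- Comparison of coefficients: the constant terms of the first two series cancel, and their
difference is a shift of the third. This relation plays the role of the Bessel differential
equation. -/
lemma hyp_contiguous {b : ℝ} (hb : 0 < b) (z : ℝ) :
    hyp b z = hyp (b + 1) z + z / (b * (b + 1)) * hyp (b + 2) z := by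
  have h1 : Summable fun k : ℕ => z ^ k / (k.factorial * poch b k) := summable_hyp hb z
  have h2 := summable_hyp (b := b + 1) (by linarith) z
  have h3 := summable_hyp (b := b + 2) (by linarith) z
  have : hyp b z - hyp (b + 1) z = z / (b * (b + 1)) * hyp (b + 2) z := by
    unfold hyp
    rw [← h1.tsum_sub h2, (h1.sub h2).tsum_eq_zero_add, ← tsum_mul_left]
    have h0 : z ^ 0 / ((Nat.factorial 0 : ℕ) * poch b 0) -
        z ^ 0 / ((Nat.factorial 0 : ℕ) * poch (b + 1) 0) = 0 := by simp [poch]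
    rw [h0, zero_add]
    refine tsum_congr fun k => ?_
    have e1 : poch b (k + 1) = b * poch (b + 1) k := poch_succ' b k
    have e2 : poch (b + 1) (k + 1) = (b + 1) * poch (b + 2) k := by
      rw [poch_succ', show b + 1 + 1 = b + 2 by ring]
    have e3 : poch (b + 1) (k + 1) = poch (b + 1) k * (b + 1 + k) := poch_succ _ k
    have p1 := poch_pos (b := b + 1) (by linarith) k
    have p2 := poch_pos (b := b + 2) (by linarith) k
    have e4 : poch (b + 2) k = poch (b + 1) k * (b + 1 + k) / (b + 1) := by
      rw [← e3, e2]; field_simp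
    have : (0 : ℝ) < b + 1 + k := by positivity
    rw [e1, e3, e4, Nat.factorial_succ, pow_succ]
    push_cast
    field_simp
    ring
  linarith

/-- The normalized Bessel function: the even solution of the Bessel equation with parameter `a`
that takes the value `1` at `0`. -/
def bes (a x : ℝ) : ℝ := hyp ((a + 1) / 2) (-(x ^ 2) / 4)

lemma bes_zero (a : ℝ) : bes a 0 = 1 := by
  unfold bes hyp
  rw [tsum_eq_single 0]
  · simp [poch]
  · intro k hk
    simp [hk]

lemma bes_neg (a x : ℝ) : bes a (-x) = bes a x := by simp [bes]

lemma hasDerivAt_bes {a : ℝ} (ha : 0 ≤ a) (x : ℝ) :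
    HasDerivAt (bes a) (-(x / (a + 1)) * bes (a + 2) x) x := by
  have h1 := hasDerivAt_hyp (b := (a + 1) / 2) (by linarith) (-(x ^ 2) / 4)
  have h2 : HasDerivAt (fun x : ℝ => -(x ^ 2) / 4) (-(x / 2)) x := by
    have := ((hasDerivAt_pow 2 x).neg).div_const 4
    convert! this using 1
    push_cast
    ring
  have h3 := h1.comp x h2
  convert! h3 using 1
  unfold bes
  rw [show (a + 2 + 1) / 2 = (a + 1) / 2 + 1 by ring]
  have : a + 1 ≠ 0 := by linarith
  field_simp

lemma continuous_bes {a : ℝ} (ha : 0 ≤ a) : Continuous (bes a) :=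
  continuous_iff_continuousAt.2 fun x => (hasDerivAt_bes ha x).continuousAt

lemma bes_contiguous {a : ℝ} (ha : 0 ≤ a) (x : ℝ) :
    bes a x = bes (a + 2) x - x ^ 2 / ((a + 1) * (a + 3)) * bes (a + 4) x := by
  unfold bes
  rw [hyp_contiguous (by linarith : 0 < (a + 1) / 2), show (a + 2 + 1) / 2 = (a + 1) / 2 + 1 by ring,
    show (a + 4 + 1) / 2 = (a + 1) / 2 + 2 by ring]
  have h1 : a + 1 ≠ 0 := by linarith
  have h2 : a + 3 ≠ 0 := by linarith
  have h3 : a + 1 + 2 ≠ 0 := by linarith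
  have : -x ^ 2 / 4 / ((a + 1) / 2 * ((a + 1) / 2 + 1)) = - (x ^ 2 / ((a + 1) * (a + 3))) := by
    rw [show (a + 1) / 2 * ((a + 1) / 2 + 1) = (a + 1) * (a + 3) / 4 by ring]
    field_simp
  rw [this]
  ring

/-- The derivative of `bes a`. -/
def besD (a x : ℝ) : ℝ := -(x / (a + 1)) * bes (a + 2) x

/-- This is the Bessel equation: `a / (a + 1) * bes (a + 2) x` stands for `-(a / x) * besD a x`,
written so that it makes sense at `x = 0` as well. -/
lemma hasDerivAt_besD {a : ℝ} (ha : 0 ≤ a) (x : ℝ) :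
    HasDerivAt (besD a) (a / (a + 1) * bes (a + 2) x - bes a x) x := by
  have h1 : HasDerivAt (fun x : ℝ => -(x / (a + 1))) (-(1 / (a + 1))) x :=
    ((hasDerivAt_id x).div_const (a + 1)).neg
  have h2 := h1.mul (hasDerivAt_bes (a := a + 2) (by linarith) x)
  convert! h2 using 1
  rw [bes_contiguous ha x, show a + 2 + 2 = a + 4 by ring]
  have h1 : a + 1 ≠ 0 := by linarith
  have h2 : a + 3 ≠ 0 := by linarith
  have h3 : a + 2 + 1 ≠ 0 := by linarith
  rw [show a + 2 + 1 = a + 3 by ring]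
  field_simp
  ring

/-- By the Bessel equation this energy has derivative `-(2 a / x) * besD a x ^ 2 ≤ 0` for `x > 0`,
and it equals `1` at `0`. Evenness handles negative `x`. It gives the uniform bound on the kernel
without any integral representation or asymptotics. -/
lemma bes_energy {a : ℝ} (ha : 0 ≤ a) (x : ℝ) : bes a x ^ 2 + besD a x ^ 2 ≤ 1 := by
  wlog hx : 0 ≤ x with H
  · have := H ha (-x) (by linarith)
    have e : besD a (-x) = - besD a x := by
      simp only [besD, bes_neg]; ring
    rw [bes_neg, e] at this
    linarith [neg_sq (besD a x)]
  have hd : ∀ y : ℝ, HasDerivAt (fun y => bes a y ^ 2 + besD a y ^ 2)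
      (2 * besD a y * (a / (a + 1) * bes (a + 2) y)) y := by
    intro y
    have := ((hasDerivAt_bes ha y).pow 2).add ((hasDerivAt_besD ha y).pow 2)
    convert! this using 1
    simp only [besD]
    push_cast
    ring
  have hanti : AntitoneOn (fun y => bes a y ^ 2 + besD a y ^ 2) (Ici 0) := by
    refine antitoneOn_of_deriv_nonpos (convex_Ici 0)
      (fun y _ => (hd y).continuousAt.continuousWithinAt)
      (fun y _ => (hd y).differentiableAt.differentiableWithinAt) ?_
    intro y hy
    rw [interior_Ici] at hy
    rw [(hd y).deriv]
    have : 2 * besD a y * (a / (a + 1) * bes (a + 2) y) =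
        - (2 * (y / (a + 1)) * (a / (a + 1)) * bes (a + 2) y ^ 2) := by
      simp only [besD]; ring
    rw [this, neg_nonpos]
    have hy : 0 < y := hy
    positivity
  have h0 := hanti (mem_Ici.2 le_rfl) (mem_Ici.2 hx) hx
  simpa [bes_zero, besD] using h0

lemma abs_bes_le {a : ℝ} (ha : 0 ≤ a) (x : ℝ) : |bes a x| ≤ 1 := by
  rw [← sq_le_one_iff_abs_le_one]
  nlinarith [bes_energy ha x, sq_nonneg (besD a x)]

lemma abs_besD_le {a : ℝ} (ha : 0 ≤ a) (x : ℝ) : |besD a x| ≤ |x| := by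
  unfold besD
  rw [abs_mul, abs_neg, abs_div, abs_of_pos (by linarith : 0 < a + 1)]
  have h1 := abs_bes_le (a := a + 2) (by linarith) x
  have h2 : |x| / (a + 1) ≤ |x| := div_le_self (abs_nonneg x) (by linarith)
  calc |x| / (a + 1) * |bes (a + 2) x| ≤ |x| * 1 := by gcongr
    _ = |x| := mul_one _

lemma abs_besD_deriv_le {a : ℝ} (ha : 0 ≤ a) (x : ℝ) :
    |a / (a + 1) * bes (a + 2) x - bes a x| ≤ 2 := by
  have h1 := abs_bes_le (a := a + 2) (by linarith) x
  have h2 := abs_bes_le ha x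
  have h3 : |a / (a + 1)| ≤ 1 := by
    rw [abs_of_nonneg (by positivity)]
    exact div_le_one_of_le₀ (by linarith) (by linarith)
  calc |a / (a + 1) * bes (a + 2) x - bes a x| ≤ |a / (a + 1)| * |bes (a + 2) x| + |bes a x| := by
        rw [← abs_mul]; exact abs_sub _ _
    _ ≤ 1 * 1 + 1 := by gcongr
    _ = 2 := by norm_num

/-! ### Gaussians and their moments -/

/-- The Gaussian `exp (-z x² / 2)` with complex parameter. -/
def gau (z : ℂ) (x : ℝ) : ℂ := Complex.exp (z * ((-(x ^ 2) / 2 : ℝ) : ℂ))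

lemma continuous_gau (z : ℂ) : Continuous (gau z) := by unfold gau; fun_prop

lemma norm_gau (z : ℂ) (x : ℝ) : ‖gau z x‖ = Real.exp (z.re * (-(x ^ 2) / 2)) := by
  unfold gau
  rw [Complex.norm_exp, Complex.re_mul_ofReal]

/-- The moment `2^((a-1)/2) Γ((a+1)/2)` of the standard Gaussian against `x^a dx`. -/
def gaussMoment (a : ℝ) : ℝ := 2 ^ ((a + 1) / 2 - 1) * Real.Gamma ((a + 1) / 2)

lemma gaussMoment_pos {a : ℝ} (ha : 0 ≤ a) : 0 < gaussMoment a := by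
  unfold gaussMoment
  have : 0 < Real.Gamma ((a + 1) / 2) := Real.Gamma_pos_of_pos (by linarith)
  positivity

/-- The functional equation of `Γ`, iterated. The Pochhammer factor produced here is exactly the one
in the denominator of the Bessel series. -/
lemma gaussMoment_add {a : ℝ} (ha : 0 ≤ a) (k : ℕ) :
    gaussMoment (a + 2 * k) = gaussMoment a * 2 ^ k * poch ((a + 1) / 2) k := by
  induction k with
  | zero => simp [poch]
  | succ k ih =>
    have hb : (a + 1) / 2 + k ≠ 0 := by positivity
    have e : gaussMoment (a + 2 * ((k + 1 : ℕ) : ℝ)) =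
        gaussMoment (a + 2 * k) * 2 * ((a + 1) / 2 + k) := by
      unfold gaussMoment
      rw [show (a + 2 * ((k + 1 : ℕ) : ℝ) + 1) / 2 = ((a + 1) / 2 + k) + 1 by push_cast; ring,
        show (a + 2 * (k : ℝ) + 1) / 2 = (a + 1) / 2 + k by ring, Real.Gamma_add_one hb,
        show (a + 1) / 2 + (k : ℝ) + 1 - 1 = ((a + 1) / 2 + k - 1) + 1 by ring,
        Real.rpow_add_one (by norm_num)]
      ring
    rw [e, ih, poch_succ, pow_succ]
    ring

lemma integrable_exp_sq {a : ℝ} (ha : 0 ≤ a) {s : ℝ} (hs : 0 < s) :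
    Integrable (fun x : ℝ => Real.exp (s * (-(x ^ 2) / 2))) (omega a) := by
  rw [integrable_omega_iff]
  refine (integrableOn_rpow_mul_exp_neg_mul_sq (b := s / 2) (by positivity)
    (s := a) (by linarith)).congr_fun (fun x _ => ?_) measurableSet_Ioi
  simp only [smul_eq_mul]
  congr 2
  ring

lemma integral_exp_sq {a : ℝ} (ha : 0 ≤ a) {s : ℝ} (hs : 0 < s) :
    ∫ x, Real.exp (s * (-(x ^ 2) / 2)) ∂(omega a) = gaussMoment a * s ^ (-((a + 1) / 2)) := by
  rw [integral_omega]
  have h := integral_rpow_mul_exp_neg_mul_rpow (p := 2) (q := a) (b := s / 2) (by norm_num)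
    (by linarith) (by positivity)
  have e : ∫ x in Ioi (0 : ℝ), (x ^ a) • Real.exp (s * (-(x ^ 2) / 2)) =
      ∫ x in Ioi (0 : ℝ), x ^ a * Real.exp (-(s / 2) * x ^ (2 : ℝ)) := by
    refine setIntegral_congr_fun measurableSet_Ioi fun x _ => ?_
    simp only [smul_eq_mul, Real.rpow_two]
    congr 2
    ring
  rw [e, h, Real.div_rpow hs.le (by norm_num), neg_div]
  unfold gaussMoment
  rw [Real.rpow_sub_one (by norm_num), Real.rpow_neg (by norm_num : (0 : ℝ) ≤ 2)]
  field_simp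

lemma integrable_gau {a : ℝ} (ha : 0 ≤ a) {z : ℂ} (hz : 0 < z.re) :
    Integrable (gau z) (omega a) := by
  rw [← integrable_norm_iff (continuous_gau z).aestronglyMeasurable]
  simp_rw [norm_gau]
  exact integrable_exp_sq ha hz

/-- Analytic continuation: the left side is the complex moment generating function of `-x²/2`,
holomorphic on the right half-plane, as is the right side for the principal branch. They agree for
real positive parameters, which accumulate at `1`. -/
lemma integral_gau {a : ℝ} (ha : 0 ≤ a) {z : ℂ} (hz : 0 < z.re) :
    ∫ x, gau z x ∂(omega a) = gaussMoment a * z ^ (-(((a + 1) / 2 : ℝ) : ℂ)) := by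
  let X : ℝ → ℝ := fun x => -(x ^ 2) / 2
  let U : Set ℂ := {z : ℂ | 0 < z.re}
  have hsub : U ⊆ {z : ℂ | z.re ∈ interior (ProbabilityTheory.integrableExpSet X (omega a))} := by
    intro w hw
    have : Ioi (0 : ℝ) ⊆ ProbabilityTheory.integrableExpSet X (omega a) := fun s hs =>
      integrable_exp_sq ha hs
    exact (isOpen_Ioi.subset_interior_iff.2 this) hw
  have h1 : AnalyticOnNhd ℂ (ProbabilityTheory.complexMGF X (omega a)) U :=
    ProbabilityTheory.analyticOnNhd_complexMGF.mono hsub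
  have hUo : IsOpen U := isOpen_lt continuous_const Complex.continuous_re
  have h2 : AnalyticOnNhd ℂ
      (fun z : ℂ => (gaussMoment a : ℂ) * z ^ (-(((a + 1) / 2 : ℝ) : ℂ))) U := by
    refine DifferentiableOn.analyticOnNhd (fun w hw => ?_) hUo
    refine DifferentiableAt.differentiableWithinAt ?_
    refine (DifferentiableAt.cpow_const differentiableAt_id ?_).const_mul _
    exact Or.inl hw
  have hconv : IsPreconnected U := (convex_halfSpace_re_gt 0).isPreconnected
  have hreal : ∀ s : ℝ, 0 < s → ProbabilityTheory.complexMGF X (omega a) s =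
      (gaussMoment a : ℂ) * (s : ℂ) ^ (-(((a + 1) / 2 : ℝ) : ℂ)) := by
    intro s hs
    rw [ProbabilityTheory.complexMGF_ofReal, ProbabilityTheory.mgf, integral_exp_sq ha hs]
    push_cast
    rw [Complex.ofReal_cpow hs.le]
    push_cast
    rfl
  have hfreq : ∃ᶠ w in 𝓝[≠] (1 : ℂ), ProbabilityTheory.complexMGF X (omega a) w =
      (gaussMoment a : ℂ) * w ^ (-(((a + 1) / 2 : ℝ) : ℂ)) := by
    have ht : Tendsto (fun s : ℝ => (s : ℂ)) (𝓝[≠] 1) (𝓝[≠] (1 : ℂ)) := by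
      refine tendsto_nhdsWithin_iff.2 ⟨?_, ?_⟩
      · have := Complex.continuous_ofReal.tendsto 1
        rw [Complex.ofReal_one] at this
        exact this.mono_left nhdsWithin_le_nhds
      · filter_upwards [self_mem_nhdsWithin] with s hs
        simpa using hs
    refine ht.frequently (Eventually.frequently ?_)
    filter_upwards [nhdsWithin_le_nhds (lt_mem_nhds (zero_lt_one))] with s hs using hreal s hs
  exact h1.eqOn_of_preconnected_of_frequently_eq h2 hconv (by simp [U]) hfreq hz

/-! ### The Hankel transform of a Gaussian -/

/-- The Hankel transform associated with the Bessel operator. -/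
def hank (a : ℝ) (f : ℝ → ℂ) (ξ : ℝ) : ℂ :=
  ((gaussMoment a)⁻¹ : ℝ) * ∫ y, f y * (bes a (ξ * y) : ℂ) ∂(omega a)

/-- Even powers only shift the exponent of the measure, so every even moment of a Gaussian is again
a Gaussian integral, with parameter `a + 2 k`. -/
lemma integral_mul_pow_omega {a : ℝ} (f : ℝ → ℂ) (k : ℕ) :
    ∫ y, f y * ((y ^ (2 * k) : ℝ) : ℂ) ∂(omega a) = ∫ y, f y ∂(omega (a + 2 * k)) := by
  rw [integral_omega, integral_omega]
  refine setIntegral_congr_fun measurableSet_Ioi fun y hy => ?_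
  have hy : 0 < y := hy
  simp only [Complex.real_smul]
  rw [Real.rpow_add hy, show (2 * (k : ℝ)) = ((2 * k : ℕ) : ℝ) by push_cast; ring,
    Real.rpow_natCast]
  push_cast
  ring

lemma integrable_mul_pow_omega {a : ℝ} {f : ℝ → ℂ} (k : ℕ)
    (hf : Integrable f (omega (a + 2 * k))) :
    Integrable (fun y => f y * ((y ^ (2 * k) : ℝ) : ℂ)) (omega a) := by
  rw [integrable_omega_iff] at hf ⊢
  refine hf.congr_fun (fun y hy => ?_) measurableSet_Ioi
  have hy : 0 < y := hy
  simp only [Complex.real_smul]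
  rw [Real.rpow_add hy, show (2 * (k : ℝ)) = ((2 * k : ℕ) : ℝ) by push_cast; ring,
    Real.rpow_natCast]
  push_cast
  ring

/-- Expand the Bessel kernel and integrate term by term. The Pochhammer factors of the moments
cancel those of the series, and the exponential series in `-ξ² / (2 z)` remains. -/
lemma hank_gau {a : ℝ} (ha : 0 ≤ a) {z : ℂ} (hz : 0 < z.re) (ξ : ℝ) :
    hank a (gau z) ξ = z ^ (-(((a + 1) / 2 : ℝ) : ℂ)) * gau z⁻¹ ξ := by
  set b : ℝ := (a + 1) / 2 with hb
  have hb0 : 0 < b := by rw [hb]; linarith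
  have hz0 : z ≠ 0 := by rintro rfl; simp at hz
  have hM := gaussMoment_pos ha
  let c : ℕ → ℝ := fun k => (-(ξ ^ 2) / 4) ^ k / (k.factorial * poch b k)
  let T : ℕ → ℝ → ℂ := fun k y => (c k : ℂ) * (gau z y * ((y ^ (2 * k) : ℝ) : ℂ))
  have hak : ∀ k : ℕ, 0 ≤ a + 2 * (k : ℝ) := fun k => by positivity
  have hTint : ∀ k, Integrable (T k) (omega a) := fun k =>
    (integrable_mul_pow_omega k (integrable_gau (hak k) hz)).const_mul _
  have hpow : ∀ (k : ℕ), (a + 2 * (k : ℝ) + 1) / 2 = b + k := fun k => by rw [hb]; ring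
  have hTnorm : ∀ k, ∫ y, ‖T k y‖ ∂(omega a) =
      gaussMoment a * z.re ^ (-b) * ((ξ ^ 2 / (2 * z.re)) ^ k / k.factorial) := by
    intro k
    have e1 : ∀ y, ‖T k y‖ = |c k| * (Real.exp (z.re * (-(y ^ 2) / 2)) * y ^ (2 * k)) := by
      intro y
      have h2 : 0 ≤ y ^ (2 * k) := by rw [pow_mul]; positivity
      simp only [T, norm_mul, norm_gau, Complex.norm_real, Real.norm_eq_abs, abs_of_nonneg h2]
    simp_rw [e1]
    rw [integral_const_mul]
    have e2 : ∫ y, Real.exp (z.re * (-(y ^ 2) / 2)) * y ^ (2 * k) ∂(omega a) =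
        ∫ y, Real.exp (z.re * (-(y ^ 2) / 2)) ∂(omega (a + 2 * k)) := by
      have := integral_mul_pow_omega (a := a)
        (fun y => ((Real.exp (z.re * (-(y ^ 2) / 2)) : ℝ) : ℂ)) k
      simp_rw [← Complex.ofReal_mul] at this
      rw [integral_complex_ofReal, integral_complex_ofReal] at this
      exact_mod_cast this
    rw [e2, integral_exp_sq (hak k) hz, gaussMoment_add ha k, ← hb, hpow, neg_add,
      Real.rpow_add hz, Real.rpow_neg hz.le (k : ℝ), Real.rpow_natCast]
    have hp := poch_pos hb0 k
    simp only [c]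
    rw [abs_div, abs_pow, abs_div, abs_neg, abs_of_nonneg (sq_nonneg ξ),
      abs_of_pos (by norm_num : (0 : ℝ) < 4),
      abs_of_pos (by positivity : (0 : ℝ) < k.factorial * poch b k)]
    rw [div_pow, div_pow, mul_pow, show (4 : ℝ) ^ k = 2 ^ k * 2 ^ k by
      rw [← mul_pow]; norm_num]
    field_simp
  -- The absolute integrals form the exponential series at `ξ² / (2 Re z)`, which justifies
  -- exchanging sum and integral.
  have hsum : Summable fun k => ∫ y, ‖T k y‖ ∂(omega a) := by
    simp_rw [hTnorm]
    exact (Real.summable_pow_div_factorial _).mul_left _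
  have key := hasSum_integral_of_summable_integral_norm hTint hsum
  have hL : ∀ y, ∑' k, T k y = gau z y * (bes a (ξ * y) : ℂ) := by
    intro y
    unfold bes hyp
    rw [Complex.ofReal_tsum, ← tsum_mul_left]
    refine tsum_congr fun k => ?_
    simp only [T, c, ← hb]
    rw [show -(ξ * y) ^ 2 / 4 = -(ξ ^ 2) / 4 * y ^ 2 by ring, mul_pow, ← pow_mul]
    push_cast
    ring
  have hR : ∀ k, ∫ y, T k y ∂(omega a) =
      gaussMoment a * z ^ (-(b : ℂ)) * ((-(ξ ^ 2 : ℝ) / (2 * z)) ^ k / k.factorial) := by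
    intro k
    simp only [T]
    rw [integral_const_mul, integral_mul_pow_omega, integral_gau (hak k) hz, gaussMoment_add ha k,
      ← hb, hpow]
    push_cast
    rw [neg_add, Complex.cpow_add _ _ hz0, Complex.cpow_neg z (k : ℂ), Complex.cpow_natCast]
    have hp : ((poch b k : ℝ) : ℂ) ≠ 0 := by exact_mod_cast (poch_pos hb0 k).ne'
    have hf : ((k.factorial : ℕ) : ℂ) ≠ 0 := by exact_mod_cast k.factorial_ne_zero
    simp only [c]
    push_cast
    rw [div_pow, div_pow, mul_pow, show (4 : ℂ) ^ k = 2 ^ k * 2 ^ k by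
      rw [← mul_pow]; norm_num]
    field_simp
  simp_rw [hL, hR] at key
  have h3 := key.unique ((NormedSpace.expSeries_div_hasSum_exp
    (-((ξ ^ 2 : ℝ) : ℂ) / (2 * z))).mul_left ((gaussMoment a : ℂ) * z ^ (-(b : ℂ))))
  unfold hank
  rw [h3, ← Complex.exp_eq_exp_ℂ]
  have hM' : (gaussMoment a : ℂ) ≠ 0 := by exact_mod_cast hM.ne'
  unfold gau
  push_cast
  rw [show z⁻¹ * (-(ξ : ℂ) ^ 2 / 2) = -(ξ : ℂ) ^ 2 / (2 * z) by field_simp]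
  field_simp

/-! ### Gaussians determine functions on the half-line -/

/-- Take the positive and negative parts of `k` as densities of two finite measures. The hypothesis
says that their images under `x ↦ x²` have the same characteristic function, hence coincide. -/
lemma ae_eq_zero_of_integral_exp_sq_real {a : ℝ} {k : ℝ → ℝ} (hk : Integrable k (omega a))
    (h0 : ∀ t : ℝ, ∫ x, (k x : ℂ) * Complex.exp (t * (x ^ 2 : ℝ) * Complex.I) ∂(omega a) = 0) :
    k =ᵐ[omega a] 0 := by
  have hp : Integrable (fun x => (ENNReal.ofReal (k x)).toReal) (omega a) := by
    simp_rw [ENNReal.toReal_ofReal']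
    exact hk.pos_part
  have hn : Integrable (fun x => (ENNReal.ofReal (-k x)).toReal) (omega a) := by
    simp_rw [ENNReal.toReal_ofReal']
    exact hk.neg_part
  have hmp : AEMeasurable (fun x => ENNReal.ofReal (k x)) (omega a) := hk.aemeasurable.ennreal_ofReal
  have hmn : AEMeasurable (fun x => ENNReal.ofReal (-k x)) (omega a) :=
    hk.aemeasurable.neg.ennreal_ofReal
  have hfp : ∫⁻ x, ENNReal.ofReal (k x) ∂(omega a) ≠ ⊤ := hk.lintegral_lt_top.ne
  have hfn : ∫⁻ x, ENNReal.ofReal (-k x) ∂(omega a) ≠ ⊤ := hk.neg.lintegral_lt_top.ne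
  set νp := (omega a).withDensity fun x => ENNReal.ofReal (k x) with hνp
  set νn := (omega a).withDensity fun x => ENNReal.ofReal (-k x) with hνn
  have : IsFiniteMeasure νp := isFiniteMeasure_withDensity hfp
  have : IsFiniteMeasure νn := isFiniteMeasure_withDensity hfn
  have hsq : Measurable fun x : ℝ => x ^ 2 := by fun_prop
  have hE : ∀ t : ℝ, Continuous fun x : ℝ => Complex.exp (t * (x ^ 2 : ℝ) * Complex.I) := by
    intro t; fun_prop
  have hE1 : ∀ t x : ℝ, ‖Complex.exp (t * (x ^ 2 : ℝ) * Complex.I)‖ ≤ 1 := by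
    intro t x
    rw [← Complex.ofReal_mul, Complex.norm_exp_ofReal_mul_I]
  have hmap : νp.map (fun x => x ^ 2) = νn.map (fun x => x ^ 2) := by
    refine Measure.ext_of_charFun (funext fun t => ?_)
    rw [charFun_apply_real, charFun_apply_real, integral_map hsq.aemeasurable (by fun_prop),
      integral_map hsq.aemeasurable (by fun_prop), hνp, hνn,
      integral_withDensity_eq_integral_toReal_smul₀ hmp
        (Eventually.of_forall fun x => ENNReal.ofReal_lt_top),
      integral_withDensity_eq_integral_toReal_smul₀ hmn
        (Eventually.of_forall fun x => ENNReal.ofReal_lt_top), ← sub_eq_zero, ← integral_sub]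
    · rw [← h0 t]
      refine integral_congr_ae (Eventually.of_forall fun x => ?_)
      simp only [Complex.real_smul]
      rw [← sub_mul]
      congr 1
      rcases le_total 0 (k x) with h | h
      · rw [ENNReal.toReal_ofReal h, ENNReal.ofReal_of_nonpos (by linarith)]; simp
      · rw [ENNReal.toReal_ofReal (by linarith : 0 ≤ -k x), ENNReal.ofReal_of_nonpos h]; simp
    · exact hp.smul_bdd 1 (hE t).aestronglyMeasurable (Eventually.of_forall (hE1 t))
    · exact hn.smul_bdd 1 (hE t).aestronglyMeasurable (Eventually.of_forall (hE1 t))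
  -- Both measures live on `x > 0`, where the square root inverts squaring, so the push-forward
  -- loses no information.
  have hback : ∀ ν : Measure ℝ, ν ≪ omega a →
      (ν.map (fun x => x ^ 2)).map Real.sqrt = ν := by
    intro ν hν
    rw [Measure.map_map Real.continuous_sqrt.measurable hsq]
    have : (Real.sqrt ∘ fun x : ℝ => x ^ 2) =ᵐ[ν] id := by
      filter_upwards [hν.ae_le (ae_omega_pos a)] with x hx
      simp [Real.sqrt_sq hx.le]
    rw [Measure.map_congr this, Measure.map_id]
  have hν : νp = νn := by
    rw [← hback νp (withDensity_absolutelyContinuous _ _),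
      ← hback νn (withDensity_absolutelyContinuous _ _), hmap]
  have := (withDensity_eq_iff hmp hmn hfp).1 hν
  filter_upwards [this] with x hx
  show k x = 0
  rcases le_total 0 (k x) with h | h
  · rw [ENNReal.ofReal_of_nonpos (by linarith : -k x ≤ 0), ENNReal.ofReal_eq_zero] at hx
    exact le_antisymm hx h
  · rw [ENNReal.ofReal_of_nonpos h, eq_comm, ENNReal.ofReal_eq_zero] at hx
    exact le_antisymm h (by linarith)

/-- The hypothesis holds for all real `t`, so conjugation and `t ↦ -t` transfer it to the conjugate
of `k`, and then to the real part as an average. -/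
lemma ae_re_eq_zero_of_integral_exp_sq {a : ℝ} {k : ℝ → ℂ} (hk : Integrable k (omega a))
    (h0 : ∀ t : ℝ, ∫ x, k x * Complex.exp (t * (x ^ 2 : ℝ) * Complex.I) ∂(omega a) = 0) :
    (fun x => (k x).re) =ᵐ[omega a] 0 := by
  refine ae_eq_zero_of_integral_exp_sq_real hk.re fun t => ?_
  have hE : ∀ t : ℝ, Continuous fun x : ℝ => Complex.exp (t * (x ^ 2 : ℝ) * Complex.I) := by
    intro t; fun_prop
  have hE1 : ∀ t x : ℝ, ‖Complex.exp (t * (x ^ 2 : ℝ) * Complex.I)‖ ≤ 1 := by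
    intro t x
    rw [← Complex.ofReal_mul, Complex.norm_exp_ofReal_mul_I]
  have hk' : Integrable (fun x => (starRingEnd ℂ) (k x)) (omega a) := by
    refine hk.congr' (Complex.continuous_conj.comp_aestronglyMeasurable hk.1) ?_
    exact Eventually.of_forall fun x => (RCLike.norm_conj _).symm
  have h1 : ∫ x, (starRingEnd ℂ) (k x) * Complex.exp (t * (x ^ 2 : ℝ) * Complex.I) ∂(omega a)
      = 0 := by
    have h2 := congrArg (starRingEnd ℂ) (h0 (-t))
    rw [← integral_conj, map_zero] at h2
    rw [← h2]
    refine integral_congr_ae (Eventually.of_forall fun x => ?_)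
    simp only [map_mul, ← Complex.exp_conj, Complex.conj_ofReal, Complex.conj_I]
    push_cast
    congr 2
    ring
  have h3 : ∀ x, (((k x).re : ℝ) : ℂ) * Complex.exp (t * (x ^ 2 : ℝ) * Complex.I) =
      (1 / 2) * (k x * Complex.exp (t * (x ^ 2 : ℝ) * Complex.I) +
        (starRingEnd ℂ) (k x) * Complex.exp (t * (x ^ 2 : ℝ) * Complex.I)) := by
    intro x
    rw [Complex.re_eq_add_conj]
    ring
  rw [integral_congr_ae (Eventually.of_forall h3), integral_const_mul, integral_add, h0 t, h1]
  · simp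
  · exact hk.mul_bdd (c := 1) (hE t).aestronglyMeasurable (Eventually.of_forall (hE1 t))
  · exact hk'.mul_bdd (c := 1) (hE t).aestronglyMeasurable (Eventually.of_forall (hE1 t))

lemma gau_one_sub (t x : ℝ) :
    gau (1 - 2 * t * Complex.I) x = gau 1 x * Complex.exp (t * (x ^ 2 : ℝ) * Complex.I) := by
  unfold gau
  rw [← Complex.exp_add]
  congr 1
  push_cast
  ring

/-- On the vertical line `Re z = 1` the Gaussians are `gau 1` times the characters `exp (i t x²)`,
so only Fourier uniqueness in the variable `x²` is needed. The imaginary part is obtained as the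
real part of `-i` times the function. -/
lemma ae_eq_zero_of_integral_gau {a : ℝ} {h : ℝ → ℂ}
    (hi : Integrable (fun x => h x * gau 1 x) (omega a))
    (h0 : ∀ z : ℂ, 0 < z.re → ∫ x, h x * gau z x ∂(omega a) = 0) : h =ᵐ[omega a] 0 := by
  have h1 : ∀ t : ℝ, ∫ x, (h x * gau 1 x) * Complex.exp (t * (x ^ 2 : ℝ) * Complex.I) ∂(omega a)
      = 0 := by
    intro t
    rw [← h0 (1 - 2 * t * Complex.I) (by simp)]
    simp_rw [gau_one_sub, mul_assoc]
  have h2 := ae_re_eq_zero_of_integral_exp_sq hi h1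
  have h3 := ae_re_eq_zero_of_integral_exp_sq (hi.const_mul (-Complex.I)) (fun t => by
    simp_rw [mul_assoc (-Complex.I)]
    rw [integral_const_mul, h1, mul_zero])
  filter_upwards [h2, h3] with x hx2 hx3
  have e : h x * gau 1 x = 0 := by
    apply Complex.ext
    · exact hx2
    · simpa using hx3
  rcases mul_eq_zero.1 e with h | h
  · exact h
  · exact absurd h (Complex.exp_ne_zero _)

/-! ### Density of Gaussians -/

lemma one_add_sq_pow_mul_exp_le {s : ℝ} (hs : 0 < s) (n : ℕ) :
    ∃ K : ℝ, 0 ≤ K ∧ ∀ x : ℝ, Real.exp (s * (-(x ^ 2) / 2)) ≤ K * ((1 + x ^ 2) ^ n)⁻¹ := by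
  -- From `y ^ n / n! ≤ exp y` at `y = (s / 2) (1 + x²)`; the factor `exp (s / 2)` compensates for
  -- the added `1`.
  refine ⟨Real.exp (s / 2) * (n.factorial / (s / 2) ^ n), by positivity, fun x => ?_⟩
  have h1 := Real.pow_div_factorial_le_exp (s / 2 * (1 + x ^ 2)) (by positivity) n
  have h2 : (0 : ℝ) < (1 + x ^ 2) ^ n := by positivity
  have h3 : Real.exp (s * (-(x ^ 2) / 2)) = Real.exp (s / 2) * (Real.exp (s / 2 * (1 + x ^ 2)))⁻¹ := by
    rw [← Real.exp_neg, ← Real.exp_add]; congr 1; ring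
  rw [h3, mul_assoc]
  refine mul_le_mul_of_nonneg_left ?_ (Real.exp_pos _).le
  rw [inv_le_iff_one_le_mul₀ (Real.exp_pos _)]
  rw [mul_pow] at h1
  calc (1 : ℝ) = (n.factorial / (s / 2) ^ n) * ((1 + x ^ 2) ^ n)⁻¹ *
        ((s / 2) ^ n * (1 + x ^ 2) ^ n / n.factorial) := by
        have : (n.factorial : ℝ) ≠ 0 := by positivity
        field_simp
    _ ≤ _ := by gcongr

lemma inX_gau {a : ℝ} (ha : 0 ≤ a) {z : ℂ} (hz : 0 < z.re) : InX a (gau z) := by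
  obtain ⟨K, -, hK⟩ := one_add_sq_pow_mul_exp_le hz (2 * wexp a)
  exact InX.of_decay ha (continuous_gau z).aestronglyMeasurable fun x _ => by
    rw [norm_gau]; exact hK x

/-- Finite linear combinations of Gaussians. -/
def gauSpan : Submodule ℂ (ℝ → ℂ) := Submodule.span ℂ {f | ∃ z : ℂ, 0 < z.re ∧ f = gau z}

lemma gau_mem_gauSpan {z : ℂ} (hz : 0 < z.re) : gau z ∈ gauSpan :=
  Submodule.subset_span ⟨z, hz, rfl⟩

lemma inX_of_mem_gauSpan {a : ℝ} (ha : 0 ≤ a) {g : ℝ → ℂ} (hg : g ∈ gauSpan) : InX a g := by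
  induction hg using Submodule.span_induction with
  | mem f hf =>
    obtain ⟨z, hz, rfl⟩ := hf
    exact inX_gau ha hz
  | zero => simp [InX]
  | add f g _ _ hf hg => exact hf.add hg
  | smul c f _ hf => exact hf.const_mul c

lemma conj_gau (z : ℂ) (x : ℝ) : (starRingEnd ℂ) (gau z x) = gau ((starRingEnd ℂ) z) x := by
  unfold gau
  rw [← Complex.exp_conj, map_mul, Complex.conj_ofReal]

/-- Density by orthogonality in `L²` for the functions `rho * gau z`: if `h` is orthogonal to all of
them, then `rho * h` integrates to zero against every Gaussian and must vanish. Applying this to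
`rho * f` makes the approximation a weighted one. -/
lemma exists_gauSpan_close {a : ℝ} (ha : 0 ≤ a) {f : ℝ → ℂ} (hf : InX a f) {ε : ℝ≥0∞}
    (hε : ε ≠ 0) :
    ∃ g ∈ gauSpan, eLpNorm (fun x => ((rho a x : ℝ) : ℂ) * (f x - g x)) 2 (omega a) < ε := by
  let S : Submodule ℂ (Lp ℂ 2 (omega a)) :=
    Submodule.span ℂ {F | ∃ (z : ℂ) (hz : 0 < z.re), F = MemLp.toLp _ (inX_gau ha hz)}
  have hS : S.topologicalClosure = ⊤ := by
    rw [Submodule.topologicalClosure_eq_top_iff, Submodule.eq_bot_iff]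
    intro h hh
    have hz : (fun x => ((rho a x : ℝ) : ℂ) * h x) =ᵐ[omega a] 0 := by
      refine ae_eq_zero_of_integral_gau ?_ fun z hz => ?_
      · have h1 := inX_gau ha (z := 1) (by simp)
        have h2 := MemLp.integrable_mul (Lp.memLp h) h1
        refine h2.congr (Eventually.of_forall fun x => ?_)
        simp only [Pi.mul_apply]
        ring
      -- The inner product conjugates its first argument, so integration against `gau z` is
      -- orthogonality to the Gaussian with conjugate parameter.
      · have hz' : 0 < ((starRingEnd ℂ) z).re := by simpa using hz
        have h1 := (Submodule.mem_orthogonal S h).1 hh _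
          (Submodule.subset_span ⟨(starRingEnd ℂ) z, hz', rfl⟩)
        rw [L2.inner_def] at h1
        rw [← h1]
        refine integral_congr_ae ?_
        filter_upwards [MemLp.coeFn_toLp (inX_gau ha hz')] with x hx
        rw [hx, RCLike.inner_apply, map_mul, Complex.conj_ofReal, conj_gau, Complex.conj_conj]
        ring
    rw [Lp.eq_zero_iff_ae_eq_zero]
    filter_upwards [hz] with x hx
    rcases mul_eq_zero.1 hx with h | h
    · exact absurd h (by exact_mod_cast (rho_pos a x).ne')
    · exact h
  have hmem : MemLp.toLp _ hf ∈ closure (S : Set (Lp ℂ 2 (omega a))) := by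
    rw [← Submodule.topologicalClosure_coe, hS]; trivial
  obtain ⟨s, hs, hd⟩ := EMetric.mem_closure_iff.1 hmem ε (pos_iff_ne_zero.2 hε)
  have hrep : ∃ g ∈ gauSpan, s =ᵐ[omega a] fun x => ((rho a x : ℝ) : ℂ) * g x := by
    clear hd
    induction hs using Submodule.span_induction with
    | mem s hs =>
      obtain ⟨z, hz, rfl⟩ := hs
      exact ⟨gau z, gau_mem_gauSpan hz, MemLp.coeFn_toLp _⟩
    | zero =>
      refine ⟨0, Submodule.zero_mem _, ?_⟩
      filter_upwards [Lp.coeFn_zero ℂ 2 (omega a)] with x hx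
      rw [hx]; simp
    | add s t _ _ hs ht =>
      obtain ⟨g, hg, hs⟩ := hs
      obtain ⟨g', hg', ht⟩ := ht
      refine ⟨g + g', Submodule.add_mem _ hg hg', ?_⟩
      filter_upwards [Lp.coeFn_add s t, hs, ht] with x hx h1 h2
      rw [hx, Pi.add_apply, Pi.add_apply, h1, h2, mul_add]
    | smul c s _ hs =>
      obtain ⟨g, hg, hs⟩ := hs
      refine ⟨c • g, Submodule.smul_mem _ c hg, ?_⟩
      filter_upwards [Lp.coeFn_smul c s, hs] with x hx h1
      rw [hx, Pi.smul_apply, Pi.smul_apply, h1, smul_eq_mul, smul_eq_mul]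
      ring
  obtain ⟨g, hg, hs⟩ := hrep
  refine ⟨g, hg, ?_⟩
  rw [Lp.edist_def] at hd
  refine lt_of_eq_of_lt (eLpNorm_congr_ae ?_) hd
  filter_upwards [MemLp.coeFn_toLp hf, hs] with x h1 h2
  rw [Pi.sub_apply, h1, h2, mul_sub]

/-! ### The Hankel transform on the weighted space -/

lemma continuous_bes_mul {a : ℝ} (ha : 0 ≤ a) :
    Continuous fun p : ℝ × ℝ => ((bes a (p.1 * p.2) : ℝ) : ℂ) :=
  Complex.continuous_ofReal.comp ((continuous_bes ha).comp (continuous_fst.mul continuous_snd))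

lemma norm_bes_le {a : ℝ} (ha : 0 ≤ a) (x : ℝ) : ‖((bes a x : ℝ) : ℂ)‖ ≤ 1 := by
  rw [Complex.norm_real]; exact abs_bes_le ha x

lemma integrable_mul_bes {a : ℝ} (ha : 0 ≤ a) {f : ℝ → ℂ} (hf : Integrable f (omega a)) (ξ : ℝ) :
    Integrable (fun y => f y * (bes a (ξ * y) : ℂ)) (omega a) :=
  hf.mul_bdd (c := 1) ((continuous_bes_mul ha).comp
    (continuous_const.prodMk continuous_id)).aestronglyMeasurable
    (Eventually.of_forall fun _ => norm_bes_le ha _)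

lemma hank_add {a : ℝ} (ha : 0 ≤ a) {f g : ℝ → ℂ} (hf : Integrable f (omega a))
    (hg : Integrable g (omega a)) (ξ : ℝ) :
    hank a (fun x => f x + g x) ξ = hank a f ξ + hank a g ξ := by
  unfold hank
  rw [← mul_add, ← integral_add (integrable_mul_bes ha hf ξ) (integrable_mul_bes ha hg ξ)]
  simp_rw [add_mul]

lemma hank_const_mul (a : ℝ) (c : ℂ) (f : ℝ → ℂ) (ξ : ℝ) :
    hank a (fun x => c * f x) ξ = c * hank a f ξ := by
  unfold hank
  simp_rw [mul_assoc]
  rw [integral_const_mul]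
  ring

lemma hank_sub {a : ℝ} (ha : 0 ≤ a) {f g : ℝ → ℂ} (hf : Integrable f (omega a))
    (hg : Integrable g (omega a)) (ξ : ℝ) :
    hank a (fun x => f x - g x) ξ = hank a f ξ - hank a g ξ := by
  unfold hank
  rw [← mul_sub, ← integral_sub (integrable_mul_bes ha hf ξ) (integrable_mul_bes ha hg ξ)]
  simp_rw [sub_mul]

lemma hank_congr {a : ℝ} {f g : ℝ → ℂ} (h : f =ᵐ[omega a] g) (ξ : ℝ) :
    hank a f ξ = hank a g ξ := by
  unfold hank
  congr 1
  refine integral_congr_ae ?_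
  filter_upwards [h] with x hx
  rw [hx]

lemma hank_conj (a : ℝ) (f : ℝ → ℂ) (ξ : ℝ) :
    hank a (fun x => (starRingEnd ℂ) (f x)) ξ = (starRingEnd ℂ) (hank a f ξ) := by
  unfold hank
  rw [map_mul, Complex.conj_ofReal, ← integral_conj]
  simp_rw [map_mul, Complex.conj_ofReal]

lemma norm_hank_le {a : ℝ} (ha : 0 ≤ a) {f : ℝ → ℂ} (hf : Integrable f (omega a)) (ξ : ℝ) :
    ‖hank a f ξ‖ ≤ (gaussMoment a)⁻¹ * ∫ y, ‖f y‖ ∂(omega a) := by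
  unfold hank
  have hM := gaussMoment_pos ha
  rw [norm_mul, Complex.norm_real, Real.norm_of_nonneg (inv_nonneg.2 hM.le)]
  gcongr
  refine norm_integral_le_of_norm_le hf.norm (Eventually.of_forall fun y => ?_)
  rw [norm_mul]
  exact mul_le_of_le_one_right (norm_nonneg _) (norm_bes_le ha _)

lemma enorm_hank_le {a : ℝ} (ha : 0 ≤ a) (f : ℝ → ℂ) (ξ : ℝ) :
    ‖hank a f ξ‖ₑ ≤ ENNReal.ofReal (gaussMoment a)⁻¹ * eLpNorm f 1 (omega a) := by
  unfold hank
  have hM := gaussMoment_pos ha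
  rw [enorm_mul, eLpNorm_one_eq_lintegral_enorm]
  gcongr
  · rw [← ofReal_norm, Complex.norm_real, Real.norm_of_nonneg (inv_nonneg.2 hM.le)]
  · refine (enorm_integral_le_lintegral_enorm _).trans (lintegral_mono fun y => ?_)
    rw [enorm_mul]
    refine mul_le_of_le_one_right' ?_
    rw [← ofReal_norm, ← ENNReal.ofReal_one]
    exact ENNReal.ofReal_le_ofReal (norm_bes_le ha _)

lemma continuous_hank {a : ℝ} (ha : 0 ≤ a) {f : ℝ → ℂ} (hf : Integrable f (omega a)) :
    Continuous (hank a f) := by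
  unfold hank
  refine continuous_const.mul (continuous_of_dominated (bound := fun y => ‖f y‖) ?_ ?_ hf.norm ?_)
  · exact fun ξ => (integrable_mul_bes ha hf ξ).1
  · refine fun ξ => Eventually.of_forall fun y => ?_
    rw [norm_mul]
    exact mul_le_of_le_one_right (norm_nonneg _) (norm_bes_le ha _)
  · exact Eventually.of_forall fun y => continuous_const.mul ((continuous_bes_mul ha).comp
      (continuous_id.prodMk continuous_const))

/-- The kernel depends only on the product of its variables and is bounded by `1`, so Fubini on `L¹
× L¹` applies. -/
lemma integral_hank_mul {a : ℝ} (ha : 0 ≤ a) {f g : ℝ → ℂ} (hf : Integrable f (omega a))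
    (hg : Integrable g (omega a)) :
    ∫ x, hank a f x * g x ∂(omega a) = ∫ x, f x * hank a g x ∂(omega a) := by
  unfold hank
  have h1 : ∀ x, ((gaussMoment a)⁻¹ : ℝ) * (∫ y, f y * (bes a (x * y) : ℂ) ∂(omega a)) * g x =
      ((gaussMoment a)⁻¹ : ℝ) * ∫ y, f y * (bes a (x * y) : ℂ) * g x ∂(omega a) := by
    intro x; rw [integral_mul_const, mul_assoc]
  have h2 : ∀ y, f y * (((gaussMoment a)⁻¹ : ℝ) * ∫ x, g x * (bes a (y * x) : ℂ) ∂(omega a)) =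
      ((gaussMoment a)⁻¹ : ℝ) * ∫ x, f y * (bes a (x * y) : ℂ) * g x ∂(omega a) := by
    intro y
    rw [mul_left_comm, ← integral_const_mul]
    congr 2
    ext x
    rw [mul_comm y x]
    ring
  simp_rw [h1, h2]
  rw [integral_const_mul, integral_const_mul, integral_integral_swap]
  have h3 : Integrable (fun p : ℝ × ℝ => g p.1 * f p.2) ((omega a).prod (omega a)) :=
    hg.mul_prod hf
  refine (h3.mul_bdd (c := 1) (continuous_bes_mul ha).aestronglyMeasurable
    (Eventually.of_forall fun _ => norm_bes_le ha _)).congr (Eventually.of_forall fun p => ?_)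
  simp only [Function.uncurry]
  ring

/-! ### Gaussian combinations -/

lemma gau_mul (z w : ℂ) (x : ℝ) : gau z x * gau w x = gau (z + w) x := by
  unfold gau
  rw [← Complex.exp_add, add_mul]

lemma inv_re_pos {z : ℂ} (hz : 0 < z.re) : 0 < z⁻¹.re := by
  rw [Complex.inv_re]
  have : z ≠ 0 := by rintro rfl; simp at hz
  exact div_pos hz (Complex.normSq_pos.2 this)

lemma gauSpan_integrable {a : ℝ} (ha : 0 ≤ a) {g : ℝ → ℂ} (hg : g ∈ gauSpan) :
    Integrable g (omega a) := (inX_of_mem_gauSpan ha hg).integrable ha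

lemma conj_mem_gauSpan {g : ℝ → ℂ} (hg : g ∈ gauSpan) :
    (fun x => (starRingEnd ℂ) (g x)) ∈ gauSpan := by
  induction hg using Submodule.span_induction with
  | mem f hf =>
    obtain ⟨z, hz, rfl⟩ := hf
    simp_rw [conj_gau]
    exact gau_mem_gauSpan (by simpa using hz)
  | zero =>
    convert! Submodule.zero_mem gauSpan using 1
    ext x
    simp
  | add f g _ _ hf hg =>
    convert! Submodule.add_mem _ hf hg using 1
    ext x
    simp
  | smul c f _ hf =>
    convert! Submodule.smul_mem _ ((starRingEnd ℂ) c) hf using 1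
    ext x
    simp

lemma gau_mul_mem_gauSpan {w : ℂ} (hw : 0 ≤ w.re) {g : ℝ → ℂ} (hg : g ∈ gauSpan) :
    (fun x => gau w x * g x) ∈ gauSpan := by
  induction hg using Submodule.span_induction with
  | mem f hf =>
    obtain ⟨z, hz, rfl⟩ := hf
    simp_rw [gau_mul]
    exact gau_mem_gauSpan (by simpa using by linarith)
  | zero =>
    convert! Submodule.zero_mem gauSpan using 1
    ext x
    simp
  | add f g _ _ hf hg =>
    have := Submodule.add_mem _ hf hg
    convert! this using 1
    ext x
    simp [mul_add]
  | smul c f _ hf =>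
    have := Submodule.smul_mem _ c hf
    convert! this using 1
    ext x
    simp only [Pi.smul_apply, smul_eq_mul]
    ring

lemma hank_gau_fun {a : ℝ} (ha : 0 ≤ a) {z : ℂ} (hz : 0 < z.re) :
    hank a (gau z) = z ^ (-(((a + 1) / 2 : ℝ) : ℂ)) • gau z⁻¹ :=
  funext fun ξ => hank_gau ha hz ξ

lemma hank_zero_fun (a : ℝ) : hank a 0 = 0 := by
  ext ξ; simp [hank]

lemma hank_add_fun {a : ℝ} (ha : 0 ≤ a) {f g : ℝ → ℂ} (hf : Integrable f (omega a))
    (hg : Integrable g (omega a)) : hank a (f + g) = hank a f + hank a g :=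
  funext fun ξ => hank_add ha hf hg ξ

lemma hank_smul_fun (a : ℝ) (c : ℂ) (f : ℝ → ℂ) : hank a (c • f) = c • hank a f :=
  funext fun ξ => hank_const_mul a c f ξ

lemma hank_mem_gauSpan {a : ℝ} (ha : 0 ≤ a) {g : ℝ → ℂ} (hg : g ∈ gauSpan) :
    hank a g ∈ gauSpan := by
  induction hg using Submodule.span_induction with
  | mem f hf =>
    obtain ⟨z, hz, rfl⟩ := hf
    rw [hank_gau_fun ha hz]
    exact Submodule.smul_mem _ _ (gau_mem_gauSpan (inv_re_pos hz))
  | zero => rw [hank_zero_fun]; exact Submodule.zero_mem _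
  | add f g hf' hg' hf hg =>
    rw [hank_add_fun ha (gauSpan_integrable ha hf') (gauSpan_integrable ha hg')]
    exact Submodule.add_mem _ hf hg
  | smul c f _ hf =>
    rw [hank_smul_fun]
    exact Submodule.smul_mem _ _ hf

lemma arg_ne_pi_of_re_pos {z : ℂ} (hz : 0 < z.re) : z.arg ≠ Real.pi := by
  intro h
  have := (Complex.arg_eq_pi_iff.1 h).1
  linarith

/-- On one Gaussian the parameter goes `z`, `z⁻¹`, `z`, and the two complex powers cancel because
the principal branch respects inverses off the negative axis. -/
lemma hank_hank_gauSpan {a : ℝ} (ha : 0 ≤ a) {g : ℝ → ℂ} (hg : g ∈ gauSpan) :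
    hank a (hank a g) = g := by
  induction hg using Submodule.span_induction with
  | mem f hf =>
    obtain ⟨z, hz, rfl⟩ := hf
    have hz0 : z ≠ 0 := by rintro rfl; simp at hz
    rw [hank_gau_fun ha hz, hank_smul_fun, hank_gau_fun ha (inv_re_pos hz), inv_inv, smul_smul,
      Complex.inv_cpow _ _ (arg_ne_pi_of_re_pos hz), mul_inv_cancel₀, one_smul]
    rw [Complex.cpow_def_of_ne_zero hz0]
    exact Complex.exp_ne_zero _
  | zero => rw [hank_zero_fun, hank_zero_fun]
  | add f g hf' hg' hf hg =>
    rw [hank_add_fun ha (gauSpan_integrable ha hf') (gauSpan_integrable ha hg'),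
      hank_add_fun ha (gauSpan_integrable ha (hank_mem_gauSpan ha hf'))
        (gauSpan_integrable ha (hank_mem_gauSpan ha hg')), hf, hg]
  | smul c f _ hf => rw [hank_smul_fun, hank_smul_fun, hf]

/-! ### Plancherel -/

lemma eLpNorm_two_eq {a : ℝ} {f : ℝ → ℂ} (hf : MemLp f 2 (omega a)) :
    eLpNorm f 2 (omega a) =
      ENNReal.ofReal ((∫ x, ‖f x‖ ^ 2 ∂(omega a)) ^ (1 / 2 : ℝ)) := by
  rw [hf.eLpNorm_eq_integral_rpow_norm (by norm_num) (by norm_num)]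
  simp

/-- The kernel is real, so the transform commutes with conjugation. Symmetry moves one transform
onto the conjugate of the other factor, where inversion removes it. -/
lemma eLpNorm_hank_gauSpan {a : ℝ} (ha : 0 ≤ a) {g : ℝ → ℂ} (hg : g ∈ gauSpan) :
    eLpNorm (hank a g) 2 (omega a) = eLpNorm g 2 (omega a) := by
  have hHg := hank_mem_gauSpan ha hg
  rw [eLpNorm_two_eq (inX_of_mem_gauSpan ha hg).memLp_two,
    eLpNorm_two_eq (inX_of_mem_gauSpan ha hHg).memLp_two]
  congr 2
  have hc := conj_mem_gauSpan hg
  have h1 : ∫ x, hank a g x * hank a (fun y => (starRingEnd ℂ) (g y)) x ∂(omega a) =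
      ∫ x, g x * (starRingEnd ℂ) (g x) ∂(omega a) := by
    rw [integral_hank_mul ha (gauSpan_integrable ha hg)
      (gauSpan_integrable ha (hank_mem_gauSpan ha hc)), hank_hank_gauSpan ha hc]
  simp_rw [hank_conj, Complex.mul_conj, Complex.normSq_eq_norm_sq] at h1
  rw [integral_complex_ofReal, integral_complex_ofReal] at h1
  exact_mod_cast h1

/-- A sequence of Gaussian combinations approximating `f` in the weighted space. -/
lemma exists_seq_gauSpan {a : ℝ} (ha : 0 ≤ a) {f : ℝ → ℂ} (hf : InX a f) :
    ∃ g : ℕ → ℝ → ℂ, (∀ n, g n ∈ gauSpan) ∧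
      Tendsto (fun n => eLpNorm (fun x => f x - g n x) 2 (omega a)) atTop (𝓝 0) ∧
      Tendsto (fun n => eLpNorm (fun x => f x - g n x) 1 (omega a)) atTop (𝓝 0) := by
  have h : ∀ n : ℕ, ∃ g ∈ gauSpan,
      eLpNorm (fun x => ((rho a x : ℝ) : ℂ) * (f x - g x)) 2 (omega a) < (n + 1 : ℝ≥0∞)⁻¹ :=
    fun n => exists_gauSpan_close ha hf (by simp)
  choose g hg hlt using h
  have h0 : Tendsto (fun n : ℕ => (n + 1 : ℝ≥0∞)⁻¹) atTop (𝓝 0) := by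
    have := (tendsto_add_atTop_iff_nat 1).2 ENNReal.tendsto_inv_nat_nhds_zero
    simpa using this
  have h1 : Tendsto (fun n => eLpNorm (fun x => ((rho a x : ℝ) : ℂ) * (f x - g n x)) 2 (omega a))
      atTop (𝓝 0) :=
    tendsto_of_tendsto_of_tendsto_of_le_of_le tendsto_const_nhds h0 (fun _ => zero_le)
      (fun n => (hlt n).le)
  refine ⟨g, hg, ?_, ?_⟩
  · exact tendsto_of_tendsto_of_tendsto_of_le_of_le tendsto_const_nhds h1 (fun _ => zero_le)
      (fun n => eLpNorm_two_le_weighted a _)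
  · have h2 := ENNReal.Tendsto.const_mul (a := eLpNorm (fun x => (((rho a x)⁻¹ : ℝ) : ℂ)) 2
      (omega a)) h1 (Or.inr (memLp_inv_rho ha).2.ne)
    rw [mul_zero] at h2
    exact tendsto_of_tendsto_of_tendsto_of_le_of_le tendsto_const_nhds h2 (fun _ => zero_le)
      (fun n => eLpNorm_one_le_weighted a
        (hf.sub (inX_of_mem_gauSpan ha (hg n))).aestronglyMeasurable)

/-- The `L¹` part of the approximation makes the transforms converge pointwise, the `L²` part
controls their norms, and Fatou's lemma concludes. Only this half of Plancherel is used outside the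
Gaussian span. -/
lemma eLpNorm_hank_le {a : ℝ} (ha : 0 ≤ a) {f : ℝ → ℂ} (hf : InX a f) :
    eLpNorm (hank a f) 2 (omega a) ≤ eLpNorm f 2 (omega a) := by
  obtain ⟨g, hg, h2, h1⟩ := exists_seq_gauSpan ha hf
  have hlim : ∀ ξ, Tendsto (fun n => hank a (g n) ξ) atTop (𝓝 (hank a f ξ)) := by
    intro ξ
    rw [tendsto_iff_edist_tendsto_0]
    have h3 := ENNReal.Tendsto.const_mul (a := ENNReal.ofReal (gaussMoment a)⁻¹) h1
      (Or.inr ENNReal.ofReal_ne_top)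
    rw [mul_zero] at h3
    refine tendsto_of_tendsto_of_tendsto_of_le_of_le tendsto_const_nhds h3 (fun _ => zero_le)
      (fun n => ?_)
    rw [edist_comm, edist_eq_enorm_sub, ← hank_sub ha (hf.integrable ha)
      (gauSpan_integrable ha (hg n))]
    exact enorm_hank_le ha _ ξ
  refine (Lp.eLpNorm_lim_le_liminf_eLpNorm (f := fun n => hank a (g n))
    (fun n => (continuous_hank ha (gauSpan_integrable ha (hg n))).aestronglyMeasurable) _
    (Eventually.of_forall hlim)).trans ?_
  have h4 : Tendsto (fun n => eLpNorm f 2 (omega a) +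
      eLpNorm (fun x => f x - g n x) 2 (omega a)) atTop (𝓝 (eLpNorm f 2 (omega a) + 0)) :=
    tendsto_const_nhds.add h2
  rw [add_zero] at h4
  rw [← h4.liminf_eq]
  refine liminf_le_liminf (Eventually.of_forall fun n => ?_)
  rw [eLpNorm_hank_gauSpan ha (hg n)]
  have hgX := inX_of_mem_gauSpan ha (hg n)
  have : g n = f - fun x => f x - g n x := by ext x; simp
  nth_rewrite 1 [this]
  exact eLpNorm_sub_le hf.aestronglyMeasurable (hf.sub hgX).aestronglyMeasurable (by norm_num)

lemma memLp_hank {a : ℝ} (ha : 0 ≤ a) {f : ℝ → ℂ} (hf : InX a f) :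
    MemLp (hank a f) 2 (omega a) :=
  ⟨(continuous_hank ha (hf.integrable ha)).aestronglyMeasurable,
    (eLpNorm_hank_le ha hf).trans_lt hf.memLp_two.2⟩

/-! ### The dispersive estimate -/

/-- The two arguments sum to something strictly inside `(-π, π)`, so no branch correction appears.
The factor `x` may lie on the imaginary axis, which is where the chirp parameter `2 i τ` is. -/
lemma mul_cpow_of_re_pos {x y : ℂ} (hx : 0 ≤ x.re) (hx0 : x ≠ 0) (hy : 0 < y.re) (s : ℂ) :
    (x * y) ^ s = x ^ s * y ^ s := by
  have hy0 : y ≠ 0 := by rintro rfl; simp at hy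
  have h1 := abs_le.1 (Complex.abs_arg_le_pi_div_two_iff.2 hx)
  have h2 := abs_lt.1 (Complex.abs_arg_lt_pi_div_two_iff.2 (Or.inl hy))
  have hlog : Complex.log (x * y) = Complex.log x + Complex.log y :=
    (Complex.log_mul_eq_add_log_iff hx0 hy0).2 ⟨by linarith, by linarith⟩
  rw [Complex.cpow_def_of_ne_zero (mul_ne_zero hx0 hy0), Complex.cpow_def_of_ne_zero hx0,
    Complex.cpow_def_of_ne_zero hy0, hlog, add_mul, Complex.exp_add]

/-- The Schrödinger multiplier `exp (-i τ ξ²)`. -/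
def chirp (τ ξ : ℝ) : ℂ := gau (2 * τ * Complex.I) ξ

lemma norm_chirp (τ ξ : ℝ) : ‖chirp τ ξ‖ = 1 := by
  unfold chirp
  rw [norm_gau]
  simp

lemma continuous_chirp : Continuous fun p : ℝ × ℝ => chirp p.1 p.2 := by
  unfold chirp gau
  fun_prop

lemma chirp_add (s t ξ : ℝ) : chirp (s + t) ξ = chirp s ξ * chirp t ξ := by
  unfold chirp
  rw [gau_mul]
  congr 1
  push_cast
  ring

lemma chirp_zero (ξ : ℝ) : chirp 0 ξ = 1 := by simp [chirp, gau]

lemma conj_chirp (t ξ : ℝ) : (starRingEnd ℂ) (chirp t ξ) = chirp (-t) ξ := by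
  unfold chirp
  rw [conj_gau]
  congr 1
  simp only [map_mul, Complex.conj_ofReal, Complex.conj_I, map_ofNat]
  push_cast
  ring

/-- With `ρ = 2 i τ`, the left side has Gaussian parameter `(ρ + z⁻¹)⁻¹ = ρ⁻¹ - ρ⁻² (ρ⁻¹ + z)⁻¹`.
The first term is an outer chirp. Since `ρ² = -4 τ²`, the second is the transform of a chirped
Gaussian, evaluated at `x / (2 τ)`. -/
lemma hank_chirp_hank_gau {a : ℝ} (ha : 0 ≤ a) {τ : ℝ} (hτ : τ ≠ 0) {z : ℂ} (hz : 0 < z.re)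
    (x : ℝ) :
    hank a (fun ξ => chirp τ ξ * hank a (gau z) ξ) x =
      (2 * τ * Complex.I) ^ (-(((a + 1) / 2 : ℝ) : ℂ)) * gau (2 * τ * Complex.I)⁻¹ x *
        hank a (fun y => gau (2 * τ * Complex.I)⁻¹ y * gau z y) (x / (2 * τ)) := by
  set ρ : ℂ := 2 * τ * Complex.I with hρ
  set s : ℂ := -(((a + 1) / 2 : ℝ) : ℂ) with hs
  have hz0 : z ≠ 0 := by rintro rfl; simp at hz
  have hτ' : (τ : ℂ) ≠ 0 := by exact_mod_cast hτ
  have hρ0 : ρ ≠ 0 := by simp [hρ, hτ]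
  have hρre : ρ.re = 0 := by simp [hρ]
  have hρire : ρ⁻¹.re = 0 := by simp [Complex.inv_re, hρre]
  have h1 : 0 < (ρ + z⁻¹).re := by
    have := inv_re_pos hz
    simp [hρre]; simpa using this
  have h2 : 0 < (ρ⁻¹ + z).re := by rw [Complex.add_re, hρire]; linarith
  have e0 : (fun ξ => chirp τ ξ * hank a (gau z) ξ) = fun ξ => z ^ s * gau (ρ + z⁻¹) ξ := by
    ext ξ
    rw [hank_gau ha hz, ← gau_mul]
    simp only [chirp, ← hρ]
    ring
  rw [e0, hank_const_mul, hank_gau ha h1]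
  simp_rw [gau_mul]
  rw [hank_gau ha h2]
  -- Both sides are the principal power of `ρ z + 1`.
  have hc : z ^ s * (ρ + z⁻¹) ^ s = ρ ^ s * (ρ⁻¹ + z) ^ s := by
    rw [← mul_cpow_of_re_pos hz.le hz0 h1, ← mul_cpow_of_re_pos hρre.ge hρ0 h2]
    congr 1
    field_simp
    ring
  have n1 : ρ + z⁻¹ ≠ 0 := by intro h; rw [h] at h1; simp at h1
  have n2 : ρ⁻¹ + z ≠ 0 := by intro h; rw [h] at h2; simp at h2
  have n3 : ρ * z + 1 ≠ 0 := by
    intro h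
    apply n1
    have : ρ + z⁻¹ = (ρ * z + 1) * z⁻¹ := by field_simp
    rw [this, h, zero_mul]
  have hg : gau (ρ + z⁻¹)⁻¹ x = gau ρ⁻¹ x * gau (ρ⁻¹ + z)⁻¹ (x / (2 * τ)) := by
    unfold gau
    rw [← Complex.exp_add]
    congr 1
    have e1 : (ρ + z⁻¹)⁻¹ = z / (ρ * z + 1) := by
      rw [show ρ + z⁻¹ = (ρ * z + 1) / z by field_simp, inv_div]
    have e2 : (ρ⁻¹ + z)⁻¹ = ρ / (ρ * z + 1) := by
      rw [show ρ⁻¹ + z = (ρ * z + 1) / ρ by field_simp; ring, inv_div]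
    have e3 : (((-(x / (2 * τ)) ^ 2 / 2 : ℝ)) : ℂ) = (x : ℂ) ^ 2 / (2 * ρ ^ 2) := by
      rw [hρ]
      push_cast
      rw [mul_pow, Complex.I_sq]
      field_simp
    rw [e1, e2, e3]
    obtain ⟨D, hD⟩ : ∃ D, D = ρ * z + 1 := ⟨_, rfl⟩
    rw [← hD] at n3 ⊢
    have hzD : z = (D - 1) / ρ := by rw [hD]; field_simp; ring
    rw [hzD]
    push_cast
    field_simp
    ring
  rw [hg]
  calc z ^ s * ((ρ + z⁻¹) ^ s * (gau ρ⁻¹ x * gau (ρ⁻¹ + z)⁻¹ (x / (2 * τ))))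
      = (z ^ s * (ρ + z⁻¹) ^ s) * (gau ρ⁻¹ x * gau (ρ⁻¹ + z)⁻¹ (x / (2 * τ))) := by ring
    _ = _ := by rw [hc]; ring

lemma chirp_mul_mem_gauSpan (τ : ℝ) {g : ℝ → ℂ} (hg : g ∈ gauSpan) :
    (fun x => chirp τ x * g x) ∈ gauSpan :=
  gau_mul_mem_gauSpan (by simp) hg

lemma hank_chirp_hank {a : ℝ} (ha : 0 ≤ a) {τ : ℝ} (hτ : τ ≠ 0) {g : ℝ → ℂ} (hg : g ∈ gauSpan)
    (x : ℝ) :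
    hank a (fun ξ => chirp τ ξ * hank a g ξ) x =
      (2 * τ * Complex.I) ^ (-(((a + 1) / 2 : ℝ) : ℂ)) * gau (2 * τ * Complex.I)⁻¹ x *
        hank a (fun y => gau (2 * τ * Complex.I)⁻¹ y * g y) (x / (2 * τ)) := by
  have hre : (0 : ℝ) ≤ ((2 * τ * Complex.I)⁻¹ : ℂ).re := by simp [Complex.inv_re]
  induction hg using Submodule.span_induction with
  | mem f hf =>
    obtain ⟨z, hz, rfl⟩ := hf
    exact hank_chirp_hank_gau ha hτ hz x
  | zero => simp [hank]
  | add f g hf' hg' hf hg =>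
    have i1 := gauSpan_integrable ha (chirp_mul_mem_gauSpan τ (hank_mem_gauSpan ha hf'))
    have i2 := gauSpan_integrable ha (chirp_mul_mem_gauSpan τ (hank_mem_gauSpan ha hg'))
    have i3 := gauSpan_integrable ha (gau_mul_mem_gauSpan hre hf')
    have i4 := gauSpan_integrable ha (gau_mul_mem_gauSpan hre hg')
    rw [hank_add_fun ha (gauSpan_integrable ha hf') (gauSpan_integrable ha hg')]
    simp_rw [Pi.add_apply, mul_add]
    rw [hank_add ha i1 i2, hank_add ha i3 i4, hf, hg, mul_add]
  | smul c f _ hf =>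
    rw [hank_smul_fun]
    simp_rw [Pi.smul_apply, smul_eq_mul, mul_left_comm _ c]
    rw [hank_const_mul, hank_const_mul, hf]
    ring

/-- The constant in the dispersive estimate. -/
def dispConst (a τ : ℝ) : ℝ := |2 * τ| ^ (-((a + 1) / 2)) * (gaussMoment a)⁻¹

lemma dispConst_pos {a : ℝ} (ha : 0 ≤ a) {τ : ℝ} (hτ : τ ≠ 0) : 0 < dispConst a τ := by
  unfold dispConst
  have := gaussMoment_pos ha
  have : 0 < |2 * τ| := by positivity
  positivity

/-- Both chirps in the kernel formula have purely imaginary parameter, hence modulus one. What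
remains is the modulus of the prefactor and the trivial `L¹ → L^∞` bound of the transform. -/
lemma enorm_hank_chirp_hank_le {a : ℝ} (ha : 0 ≤ a) {τ : ℝ} (hτ : τ ≠ 0) {g : ℝ → ℂ}
    (hg : g ∈ gauSpan) (x : ℝ) :
    ‖hank a (fun ξ => chirp τ ξ * hank a g ξ) x‖ₑ ≤
      ENNReal.ofReal (dispConst a τ) * eLpNorm g 1 (omega a) := by
  have hM := gaussMoment_pos ha
  rw [hank_chirp_hank ha hτ hg, enorm_mul, enorm_mul]
  have hg1 : ∀ y, ‖gau (2 * τ * Complex.I)⁻¹ y‖ = 1 := by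
    intro y
    rw [norm_gau]
    simp [Complex.inv_re]
  have h1 : ‖(2 * τ * Complex.I) ^ (-(((a + 1) / 2 : ℝ) : ℂ))‖ₑ =
      ENNReal.ofReal (|2 * τ| ^ (-((a + 1) / 2))) := by
    rw [← ofReal_norm, ← Complex.ofReal_neg, Complex.norm_cpow_real]
    congr 2
    simp
  have h2 : ‖gau (2 * τ * Complex.I)⁻¹ x‖ₑ = 1 := by
    rw [← ofReal_norm, hg1, ENNReal.ofReal_one]
  rw [h1, h2, mul_one, dispConst, ENNReal.ofReal_mul (by positivity),
    mul_assoc (ENNReal.ofReal _)]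
  gcongr
  refine (enorm_hank_le ha _ _).trans (le_of_eq ?_)
  congr 1
  refine eLpNorm_congr_norm_ae (Eventually.of_forall fun y => ?_)
  rw [norm_mul, hg1, one_mul]

/-- The bilinear form `⟨e^{iτB} f, ḡ⟩`, computed on the Hankel side. -/
def pairQ (a τ : ℝ) (f g : ℝ → ℂ) : ℂ := ∫ ξ, chirp τ ξ * (hank a f ξ * hank a g ξ) ∂(omega a)

lemma integrable_pairQ {a : ℝ} (ha : 0 ≤ a) (τ : ℝ) {f g : ℝ → ℂ} (hf : InX a f) (hg : InX a g) :
    Integrable (fun ξ => chirp τ ξ * (hank a f ξ * hank a g ξ)) (omega a) := by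
  have h := MemLp.integrable_mul (memLp_hank ha hf) (memLp_hank ha hg)
  refine h.bdd_mul (c := 1) (Continuous.aestronglyMeasurable ?_)
    (Eventually.of_forall fun ξ => (norm_chirp τ ξ).le)
  exact continuous_chirp.comp (continuous_const.prodMk continuous_id)

lemma lintegral_enorm_hank_mul_le {a : ℝ} (ha : 0 ≤ a) {f g : ℝ → ℂ} (hf : InX a f)
    (hg : InX a g) :
    ∫⁻ ξ, ‖hank a f ξ * hank a g ξ‖ₑ ∂(omega a) ≤
      eLpNorm f 2 (omega a) * eLpNorm g 2 (omega a) := by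
  have h3 := eLpNorm_smul_le_mul_eLpNorm (p := 2) (q := 2) (r := 1) (memLp_hank ha hg).1
    (memLp_hank ha hf).1
  rw [eLpNorm_one_eq_lintegral_enorm] at h3
  exact h3.trans (mul_le_mul' (eLpNorm_hank_le ha hf) (eLpNorm_hank_le ha hg))

lemma enorm_pairQ_le {a : ℝ} (ha : 0 ≤ a) (τ : ℝ) {f g : ℝ → ℂ} (hf : InX a f) (hg : InX a g) :
    ‖pairQ a τ f g‖ₑ ≤ eLpNorm f 2 (omega a) * eLpNorm g 2 (omega a) := by
  refine (enorm_integral_le_lintegral_enorm _).trans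
    (le_trans (lintegral_mono fun ξ => ?_) (lintegral_enorm_hank_mul_le ha hf hg))
  rw [enorm_mul, ← ofReal_norm (chirp τ ξ), norm_chirp, ENNReal.ofReal_one, one_mul]

lemma pairQ_sub_left {a : ℝ} (ha : 0 ≤ a) (τ : ℝ) {f f' g : ℝ → ℂ} (hf : InX a f)
    (hf' : InX a f') (hg : InX a g) :
    pairQ a τ (fun x => f x - f' x) g = pairQ a τ f g - pairQ a τ f' g := by
  unfold pairQ
  rw [← integral_sub (integrable_pairQ ha τ hf hg) (integrable_pairQ ha τ hf' hg)]
  simp_rw [hank_sub ha (hf.integrable ha) (hf'.integrable ha)]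
  congr 1
  ext ξ
  ring

lemma pairQ_comm (a τ : ℝ) (f g : ℝ → ℂ) : pairQ a τ f g = pairQ a τ g f := by
  unfold pairQ
  simp_rw [mul_comm (hank a f _)]

lemma pairQ_const_mul_left (a τ : ℝ) (c : ℂ) (f g : ℝ → ℂ) :
    pairQ a τ (fun x => c * f x) g = c * pairQ a τ f g := by
  unfold pairQ
  rw [← integral_const_mul]
  simp_rw [hank_const_mul]
  congr 1
  ext ξ
  ring

/-- When `f` is a Gaussian combination, symmetry moves the transform off `g` and the pointwise bound
applies. For general `f`, the approximants are measured in `L¹` and the error in `L²`, where the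
form is bounded uniformly in `τ`. -/
lemma enorm_pairQ_le_dispersive {a : ℝ} (ha : 0 ≤ a) {τ : ℝ} (hτ : τ ≠ 0) {f g : ℝ → ℂ}
    (hf : InX a f) (hg : InX a g) :
    ‖pairQ a τ f g‖ₑ ≤
      ENNReal.ofReal (dispConst a τ) * eLpNorm f 1 (omega a) * eLpNorm g 1 (omega a) := by
  have hspan : ∀ f ∈ gauSpan, ‖pairQ a τ f g‖ₑ ≤
      ENNReal.ofReal (dispConst a τ) * eLpNorm f 1 (omega a) * eLpNorm g 1 (omega a) := by
    intro f hf
    have e : pairQ a τ f g = ∫ x, hank a (fun ξ => chirp τ ξ * hank a f ξ) x * g x ∂(omega a) := by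
      rw [integral_hank_mul ha (gauSpan_integrable ha (chirp_mul_mem_gauSpan τ
        (hank_mem_gauSpan ha hf))) (hg.integrable ha)]
      unfold pairQ
      simp_rw [mul_assoc]
    rw [e, eLpNorm_one_eq_lintegral_enorm (f := g),
      ← lintegral_const_mul' _ _ (ENNReal.mul_ne_top ENNReal.ofReal_ne_top ?_)]
    · refine (enorm_integral_le_lintegral_enorm _).trans (lintegral_mono fun x => ?_)
      rw [enorm_mul]
      gcongr
      exact enorm_hank_chirp_hank_le ha hτ hf x
    · exact (memLp_one_iff_integrable.2 (gauSpan_integrable ha hf)).2.ne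
  obtain ⟨F, hF, h2, h1⟩ := exists_seq_gauSpan ha hf
  have hlim : Tendsto (fun n => ENNReal.ofReal (dispConst a τ) *
      (eLpNorm f 1 (omega a) + eLpNorm (fun x => f x - F n x) 1 (omega a)) *
        eLpNorm g 1 (omega a) + eLpNorm (fun x => f x - F n x) 2 (omega a) *
        eLpNorm g 2 (omega a)) atTop (𝓝 (ENNReal.ofReal (dispConst a τ) *
      (eLpNorm f 1 (omega a) + 0) * eLpNorm g 1 (omega a) + 0 * eLpNorm g 2 (omega a))) := by
    have hg1 : eLpNorm g 1 (omega a) ≠ ⊤ := (memLp_one_iff_integrable.2 (hg.integrable ha)).2.ne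
    refine Tendsto.add ?_ ?_
    · refine ENNReal.Tendsto.mul_const (ENNReal.Tendsto.const_mul (tendsto_const_nhds.add h1)
        (Or.inr ENNReal.ofReal_ne_top)) (Or.inr hg1)
    · exact ENNReal.Tendsto.mul_const h2 (Or.inr hg.memLp_two.2.ne)
  rw [add_zero, zero_mul, add_zero] at hlim
  refine ge_of_tendsto' hlim fun n => ?_
  have hFX := inX_of_mem_gauSpan ha (hF n)
  have e : pairQ a τ f g = pairQ a τ (F n) g + pairQ a τ (fun x => f x - F n x) g := by
    rw [pairQ_sub_left ha τ hf hFX hg]; ring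
  rw [e]
  refine (enorm_add_le _ _).trans (add_le_add ((hspan _ (hF n)).trans ?_)
    (enorm_pairQ_le ha τ (hf.sub hFX) hg))
  gcongr
  have : F n = f - fun x => f x - F n x := by ext x; simp
  nth_rewrite 1 [this]
  exact eLpNorm_sub_le hf.aestronglyMeasurable (hf.sub hFX).aestronglyMeasurable (by norm_num)

/-! ### Dyadic level sets -/

/-- The real powers of two in `ℝ≥0∞`. -/
def e2 (x : ℝ) : ℝ≥0∞ := (2 : ℝ≥0∞) ^ x

lemma e2_add (x y : ℝ) : e2 (x + y) = e2 x * e2 y :=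
  ENNReal.rpow_add _ _ (by norm_num) (by norm_num)

lemma e2_ne_top (x : ℝ) : e2 x ≠ ⊤ := by
  unfold e2
  rw [Ne, ENNReal.rpow_eq_top_iff]
  norm_num

lemma e2_rpow (x y : ℝ) : e2 x ^ y = e2 (x * y) := (ENNReal.rpow_mul _ _ _).symm

lemma e2_mono {x y : ℝ} (h : x ≤ y) : e2 x ≤ e2 y :=
  ENNReal.rpow_le_rpow_of_exponent_le (by norm_num) h

lemma e2_zero : e2 0 = 1 := ENNReal.rpow_zero

lemma e2_mul_neg (x : ℝ) : e2 x * e2 (-x) = 1 := by rw [← e2_add, add_neg_cancel, e2_zero]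

/-- The dyadic level set `{2^k ≤ f < 2^(k+1)}`. -/
def lev {α : Type*} (f : α → ℝ≥0∞) (k : ℤ) : Set α := {x | e2 k ≤ f x ∧ f x < e2 (k + 1)}

lemma measurableSet_lev {α : Type*} [MeasurableSpace α] {f : α → ℝ≥0∞} (hf : Measurable f)
    (k : ℤ) : MeasurableSet (lev f k) :=
  (measurableSet_le measurable_const hf).inter (measurableSet_lt hf measurable_const)

lemma exists_mem_lev {α : Type*} {f : α → ℝ≥0∞} {x : α} (h0 : f x ≠ 0) (h1 : f x ≠ ⊤) :
    ∃ k : ℤ, x ∈ lev f k := by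
  obtain ⟨k, hk⟩ := ENNReal.exists_mem_Ico_zpow h0 h1 (y := 2) (by norm_num) (by norm_num)
  refine ⟨k, ?_, ?_⟩
  · unfold e2
    rw [ENNReal.rpow_intCast]
    exact hk.1
  · unfold e2
    have := hk.2
    rw [← ENNReal.rpow_intCast] at this
    push_cast at this
    exact this

lemma lev_unique {α : Type*} {f : α → ℝ≥0∞} {x : α} {k l : ℤ} (hk : x ∈ lev f k)
    (hl : x ∈ lev f l) : k = l := by
  by_contra hne
  wlog h : k < l with H
  · exact H hl hk (Ne.symm hne) (by omega)
  have h1 : e2 (k + 1) ≤ e2 l := e2_mono (by exact_mod_cast h)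
  exact absurd (hk.2.trans_le (h1.trans hl.1)) (lt_irrefl _)

lemma pairwise_disjoint_lev {α : Type*} (f : α → ℝ≥0∞) :
    Pairwise (Function.onFun Disjoint (lev f)) := fun _ _ hkl =>
  Set.disjoint_left.2 fun _ hk hl => hkl (lev_unique hk hl)

/-- Chebyshev's inequality on each level set, summed over disjoint sets. -/
lemma tsum_lev_le {α : Type*} [MeasurableSpace α] (μ : Measure α) {f : α → ℝ≥0∞}
    (hf : Measurable f) {p : ℝ} (hp : 0 ≤ p) :
    ∑' k : ℤ, e2 (k * p) * μ (lev f k) ≤ ∫⁻ x, f x ^ p ∂μ := by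
  calc ∑' k : ℤ, e2 (k * p) * μ (lev f k)
      ≤ ∑' k : ℤ, ∫⁻ x in lev f k, f x ^ p ∂μ := by
        refine ENNReal.tsum_le_tsum fun k => ?_
        rw [← setLIntegral_const]
        refine setLIntegral_mono (hf.pow_const p) fun x hx => ?_
        rw [← e2_rpow]
        exact ENNReal.rpow_le_rpow hx.1 hp
    _ = ∫⁻ x in ⋃ k, lev f k, f x ^ p ∂μ :=
        (lintegral_iUnion (measurableSet_lev hf) (pairwise_disjoint_lev f) _).symm
    _ ≤ ∫⁻ x, f x ^ p ∂μ := setLIntegral_le_lintegral _ _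

lemma le_tsum_lev {α : Type*} {f : α → ℝ≥0∞} {x : α} (h : f x ≠ ⊤) :
    f x ≤ ∑' k : ℤ, (lev f k).indicator (fun _ => e2 (k + 1)) x := by
  by_cases h0 : f x = 0
  · rw [h0]; exact zero_le
  obtain ⟨k, hk⟩ := exists_mem_lev h0 h
  refine le_trans ?_ (ENNReal.le_tsum k)
  rw [indicator_of_mem hk]
  exact hk.2.le

/-! ### Summation of dyadic pieces -/

/-- The geometric weight `2^(-δ |n|)`. -/
def gw (δ : ℝ) (n : ℤ) : ℝ≥0∞ := e2 (-(δ * |(n : ℝ)|))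

lemma tsum_gw_ne_top {δ : ℝ} (hδ : 0 < δ) : ∑' n : ℤ, gw δ n ≠ ⊤ := by
  have hr : (2 : ℝ) ^ (-δ) < 1 := Real.rpow_lt_one_of_one_lt_of_neg (by norm_num) (by linarith)
  have hr0 : (0 : ℝ) ≤ (2 : ℝ) ^ (-δ) := by positivity
  have hs : Summable fun n : ℤ => ((2 : ℝ) ^ (-δ)) ^ n.natAbs := by
    refine Summable.of_nat_of_neg ?_ ?_
    · simpa using summable_geometric_of_lt_one hr0 hr
    · simpa using summable_geometric_of_lt_one hr0 hr
  have : ∀ n : ℤ, gw δ n = ENNReal.ofReal (((2 : ℝ) ^ (-δ)) ^ n.natAbs) := by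
    intro n
    unfold gw e2
    rw [← Real.rpow_natCast, ← Real.rpow_mul (by norm_num), Nat.cast_natAbs,
      ← ENNReal.ofReal_rpow_of_pos (by norm_num)]
    push_cast
    congr 1
    · norm_num
    · ring
  simp_rw [this]
  exact hs.tsum_ofReal_ne_top

/-- A Schur-type test: the term with `a k` is summed first in `l`, the term with `b l` first in `k`.
-/
lemma tsum_tsum_le_of_weight {a b : ℤ → ℝ≥0∞} (ha : ∑' k, a k ≤ 1) (hb : ∑' k, b k ≤ 1)
    {T w : ℤ → ℤ → ℝ≥0∞} {S : ℝ≥0∞} (hw1 : ∀ k, ∑' l, w k l ≤ S) (hw2 : ∀ l, ∑' k, w k l ≤ S)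
    (hT : ∀ k l, T k l ≤ (a k + b l) * w k l) : ∑' k, ∑' l, T k l ≤ 2 * S := by
  calc ∑' k, ∑' l, T k l ≤ ∑' k, ∑' l, (a k * w k l + b l * w k l) :=
        ENNReal.tsum_le_tsum fun k => ENNReal.tsum_le_tsum fun l => by
          rw [← add_mul]; exact hT k l
    _ = ∑' k, ∑' l, a k * w k l + ∑' k, ∑' l, b l * w k l := by
        simp_rw [ENNReal.tsum_add]
    _ = ∑' k, a k * ∑' l, w k l + ∑' l, b l * ∑' k, w k l := by
        rw [ENNReal.tsum_comm (f := fun k l => b l * w k l)]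
        simp_rw [ENNReal.tsum_mul_left]
    _ ≤ ∑' k, a k * S + ∑' l, b l * S := by
        gcongr with k l
        · exact hw1 k
        · exact hw2 l
    _ ≤ 1 * S + 1 * S := by
        rw [ENNReal.tsum_mul_right, ENNReal.tsum_mul_right]
        gcongr
    _ = 2 * S := by rw [← add_mul]; norm_num

lemma tsum_gw_add (δ : ℝ) (k : ℤ) : ∑' l : ℤ, gw δ (k + l) = ∑' n : ℤ, gw δ n :=
  (Equiv.addLeft k).tsum_eq (gw δ)

lemma tsum_gw_sub (δ : ℝ) (k : ℤ) : ∑' l : ℤ, gw δ (k - l) = ∑' n : ℤ, gw δ n :=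
  (Equiv.subLeft k).tsum_eq (gw δ)

lemma sqrt_mul_le_add (x y : ℝ≥0∞) : x ^ (1 / 2 : ℝ) * y ^ (1 / 2 : ℝ) ≤ x + y := by
  have h : ∀ z : ℝ≥0∞, z ^ (1 / 2 : ℝ) * z ^ (1 / 2 : ℝ) = z := by
    intro z
    rw [← ENNReal.rpow_add_of_nonneg _ _ (by norm_num) (by norm_num)]
    norm_num
  rcases le_total x y with hxy | hxy
  · calc x ^ (1 / 2 : ℝ) * y ^ (1 / 2 : ℝ) ≤ y ^ (1 / 2 : ℝ) * y ^ (1 / 2 : ℝ) := by gcongr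
      _ = y := h y
      _ ≤ x + y := le_add_self
  · calc x ^ (1 / 2 : ℝ) * y ^ (1 / 2 : ℝ) ≤ x ^ (1 / 2 : ℝ) * x ^ (1 / 2 : ℝ) := by gcongr
      _ = x := h x
      _ ≤ x + y := le_self_add

/-- Restricted `L¹` and `L²` bounds on dyadic pieces sum to an `L^p` bound. -/
lemma exists_interpolation_bound {p : ℝ} (hp1 : 1 < p) (hp2 : p < 2) :
    ∃ C : ℝ≥0∞, C ≠ ⊤ ∧ ∀ (W V : ℤ → ℝ≥0∞) (T : ℤ → ℤ → ℝ≥0∞),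
      ∑' k : ℤ, e2 (k * p) * W k ≤ 1 → ∑' k : ℤ, e2 (k * p) * V k ≤ 1 →
      (∀ k l : ℤ, T k l ≤ (e2 (k + 1) * W k) * (e2 (l + 1) * V l)) →
      (∀ k l : ℤ, T k l ≤ (e2 (k + 1) * W k ^ (1 / 2 : ℝ)) * (e2 (l + 1) * V l ^ (1 / 2 : ℝ))) →
      ∑' k, ∑' l, T k l ≤ C := by
  -- In terms of the normalized masses, the `L¹` bound carries `2 ^ (-(p - 1) (k + l))` and the `L²`
  -- bound carries `2 ^ ((1 - p / 2) (k + l))`. Each is used where it decays, so `δ` is the slower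
  -- rate, positive exactly because `1 < p < 2`.
  set δ : ℝ := min (p - 1) (1 - p / 2) with hδ
  have hδ0 : 0 < δ := lt_min (by linarith) (by linarith)
  refine ⟨2 * (e2 2 * ∑' n : ℤ, gw δ n),
    ENNReal.mul_ne_top (by norm_num) (ENNReal.mul_ne_top (e2_ne_top _) (tsum_gw_ne_top hδ0)), ?_⟩
  intro W V T hW hV h1 h2
  have hWk : ∀ k : ℤ, e2 (k * p) * W k ≤ 1 := fun k => (ENNReal.le_tsum k).trans hW
  have eW : ∀ (U : ℤ → ℝ≥0∞) (k : ℤ), U k = e2 (-(k * p)) * (e2 (k * p) * U k) := by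
    intro U k
    rw [← mul_assoc, mul_comm (e2 (-(k * p))), e2_mul_neg, one_mul]
  refine tsum_tsum_le_of_weight (w := fun k l => e2 2 * gw δ (k + l)) hW hV ?_ ?_ ?_
  · intro k
    rw [ENNReal.tsum_mul_left, tsum_gw_add]
  · intro l
    simp_rw [add_comm _ l]
    rw [ENNReal.tsum_mul_left, tsum_gw_add]
  intro k l
  set A := e2 (k * p) * W k
  set B := e2 (l * p) * V l
  -- The `L¹` bound is the good one for `k + l ≥ 0`, the `L²` bound for `k + l ≤ 0`. The factor `e2
  -- 2` comes from using the upper endpoints `2 ^ (k + 1)` and `2 ^ (l + 1)`.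
  rcases le_total 0 (k + l) with hkl | hkl
  · refine (h1 k l).trans ?_
    rw [eW W k, eW V l]
    change (e2 (k + 1) * (e2 (-(k * p)) * A)) * (e2 (l + 1) * (e2 (-(l * p)) * B)) ≤ _
    have e : (e2 (k + 1) * (e2 (-(k * p)) * A)) * (e2 (l + 1) * (e2 (-(l * p)) * B)) =
        (A * B) * (e2 2 * e2 (-((p - 1) * ((k : ℝ) + l)))) := by
      have h4 : e2 2 * e2 (-((p - 1) * ((k : ℝ) + l))) =
          e2 (k + 1) * e2 (-(k * p)) * e2 (l + 1) * e2 (-(l * p)) := by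
        simp only [← e2_add]; congr 1; ring
      rw [h4]
      ring
    rw [e]
    have hkl' : (0 : ℝ) ≤ (k : ℝ) + l := by exact_mod_cast hkl
    gcongr
    · calc A * B ≤ 1 * B := by gcongr; exact hWk k
        _ = B := one_mul _
        _ ≤ A + B := le_add_self
    · refine e2_mono ?_
      push_cast
      rw [abs_of_nonneg hkl']
      have := min_le_left (p - 1) (1 - p / 2)
      nlinarith
  · refine (h2 k l).trans ?_
    rw [eW W k, eW V l]
    change (e2 (k + 1) * (e2 (-(k * p)) * A) ^ (1 / 2 : ℝ)) *
      (e2 (l + 1) * (e2 (-(l * p)) * B) ^ (1 / 2 : ℝ)) ≤ _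
    rw [ENNReal.mul_rpow_of_nonneg _ A (by norm_num : (0 : ℝ) ≤ 1 / 2),
      ENNReal.mul_rpow_of_nonneg _ B (by norm_num : (0 : ℝ) ≤ 1 / 2), e2_rpow, e2_rpow]
    have e : (e2 (k + 1) * (e2 (-(k * p) * (1 / 2)) * A ^ (1 / 2 : ℝ))) *
        (e2 (l + 1) * (e2 (-(l * p) * (1 / 2)) * B ^ (1 / 2 : ℝ))) =
        (A ^ (1 / 2 : ℝ) * B ^ (1 / 2 : ℝ)) *
          (e2 2 * e2 ((1 - p / 2) * ((k : ℝ) + l))) := by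
      have h4 : e2 2 * e2 ((1 - p / 2) * ((k : ℝ) + l)) =
          e2 (k + 1) * e2 (-(k * p) * (1 / 2)) * e2 (l + 1) * e2 (-(l * p) * (1 / 2)) := by
        simp only [← e2_add]; congr 1; ring
      rw [h4]
      ring
    rw [e]
    have hkl' : (k : ℝ) + l ≤ 0 := by exact_mod_cast hkl
    gcongr
    · exact sqrt_mul_le_add A B
    · refine e2_mono ?_
      push_cast
      rw [abs_of_nonpos hkl']
      have := min_le_right (p - 1) (1 - p / 2)
      nlinarith

/-- Summation of the dyadic pieces of the fractional integral. -/
lemma exists_fractional_bound {γ : ℝ} (h0 : 0 < γ) (h1 : γ < 1) :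
    ∃ C : ℝ≥0∞, C ≠ ⊤ ∧ ∀ (W V : ℤ → ℝ≥0∞) (T : ℤ → ℤ → ℝ≥0∞),
      ∑' k : ℤ, e2 (k * (2 / (2 - γ))) * W k ≤ 1 → ∑' k : ℤ, e2 (k * (2 / (2 - γ))) * V k ≤ 1 →
      (∀ k l : ℤ, T k l ≤ e2 (k + 1) * e2 (l + 1) * (W k * V l ^ (1 - γ))) →
      (∀ k l : ℤ, T k l ≤ e2 (k + 1) * e2 (l + 1) * (V l * W k ^ (1 - γ))) →
      ∑' k, ∑' l, T k l ≤ C := by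
  -- This is the exponent for which `p - 1` and `1 - p (1 - γ)` are the same number `η`, so that the
  -- combined weight depends on `k - l` only.
  set p : ℝ := 2 / (2 - γ) with hp
  set η : ℝ := γ / (2 - γ) with hη
  have h2γ : (0 : ℝ) < 2 - γ := by linarith
  have hη0 : 0 < η := by positivity
  have r1 : 1 - p = -η := by rw [hp, hη]; field_simp; ring
  have r2 : 1 - p * (1 - γ) = η := by rw [hp, hη]; field_simp; ring
  refine ⟨2 * (e2 2 * ∑' n : ℤ, gw η n),
    ENNReal.mul_ne_top (by norm_num) (ENNReal.mul_ne_top (e2_ne_top _) (tsum_gw_ne_top hη0)), ?_⟩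
  intro W V T hW hV ht1 ht2
  have hWk : ∀ k : ℤ, e2 (k * p) * W k ≤ 1 := fun k => (ENNReal.le_tsum k).trans hW
  have hVk : ∀ k : ℤ, e2 (k * p) * V k ≤ 1 := fun k => (ENNReal.le_tsum k).trans hV
  have eW : ∀ (U : ℤ → ℝ≥0∞) (k : ℤ), U k = e2 (-(k * p)) * (e2 (k * p) * U k) := by
    intro U k
    rw [← mul_assoc, mul_comm (e2 (-(k * p))), e2_mul_neg, one_mul]
  -- The power `1 - γ` has to fall on the lower level for the geometric factor to decay. The
  -- statement is symmetric in the two families, so it also covers the other order of indices.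
  have key : ∀ (U U' : ℤ → ℝ≥0∞) (k l : ℤ), l ≤ k → e2 (l * p) * U' l ≤ 1 →
      e2 (k + 1) * e2 (l + 1) * (U k * U' l ^ (1 - γ)) ≤
        (e2 (k * p) * U k) * (e2 2 * gw η (k - l)) := by
    intro U U' k l hkl hB1
    rw [eW U' l]
    nth_rewrite 1 [eW U k]
    set A := e2 (k * p) * U k
    set B := e2 (l * p) * U' l
    rw [ENNReal.mul_rpow_of_nonneg _ B (by linarith : (0 : ℝ) ≤ 1 - γ), e2_rpow]
    have e : e2 (k + 1) * e2 (l + 1) * ((e2 (-(k * p)) * A) *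
        (e2 (-(l * p) * (1 - γ)) * B ^ (1 - γ))) =
        (A * B ^ (1 - γ)) * (e2 2 * e2 (-(η * ((k : ℝ) - l)))) := by
      have h4 : e2 2 * e2 (-(η * ((k : ℝ) - l))) =
          e2 (k + 1) * e2 (l + 1) * e2 (-(k * p)) * e2 (-(l * p) * (1 - γ)) := by
        simp only [← e2_add]
        congr 1
        linear_combination (-(k : ℝ)) * r1 - (l : ℝ) * r2
      rw [h4]
      ring
    rw [e]
    have hkl' : (0 : ℝ) ≤ (k : ℝ) - l := by
      have : (l : ℝ) ≤ k := by exact_mod_cast hkl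
      linarith
    gcongr
    · calc A * B ^ (1 - γ) ≤ A * 1 := by
            gcongr
            exact ENNReal.rpow_le_one hB1 (by linarith)
        _ = A := mul_one _
    · refine e2_mono ?_
      push_cast
      rw [abs_of_nonneg hkl']
  have hsymm : ∀ k l : ℤ, gw η (k - l) = gw η (l - k) := by
    intro k l
    unfold gw
    push_cast
    rw [abs_sub_comm]
  refine tsum_tsum_le_of_weight (w := fun k l => e2 2 * gw η (k - l)) hW hV ?_ ?_ ?_
  · intro k
    rw [ENNReal.tsum_mul_left, tsum_gw_sub]
  · intro l
    simp_rw [hsymm _ l]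
    rw [ENNReal.tsum_mul_left, tsum_gw_sub]
  intro k l
  rcases le_total l k with hkl | hkl
  · refine ((ht1 k l).trans (key W V k l hkl (hVk l))).trans ?_
    gcongr
    exact le_self_add
  · refine (ht2 k l).trans ?_
    rw [mul_comm (e2 (k + 1)), hsymm]
    refine (key V W l k hkl (hWk k)).trans ?_
    gcongr
    exact le_add_self

/-! ### Interpolation for the propagator -/

/-- The part of `f` on the `k`-th dyadic level set of `‖f‖`. -/
def piece (f : ℝ → ℂ) (k : ℤ) : ℝ → ℂ := (lev (fun x => ‖f x‖ₑ) k).indicator f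

lemma measurable_piece {f : ℝ → ℂ} (hf : Measurable f) (k : ℤ) : Measurable (piece f k) :=
  hf.indicator (measurableSet_lev hf.enorm k)

lemma InX.piece {a : ℝ} {f : ℝ → ℂ} (hf : InX a f) (hm : Measurable f) (k : ℤ) :
    InX a (piece f k) :=
  hf.mono (measurable_piece hm k).aestronglyMeasurable
    (Eventually.of_forall fun _ => norm_indicator_le_norm_self _ _)

lemma enorm_piece_le (f : ℝ → ℂ) (k : ℤ) (x : ℝ) :
    ‖piece f k x‖ₑ ≤ (lev (fun x => ‖f x‖ₑ) k).indicator (fun _ => e2 (k + 1)) x := by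
  unfold piece
  by_cases hx : x ∈ lev (fun x => ‖f x‖ₑ) k
  · rw [indicator_of_mem hx, indicator_of_mem hx]
    exact hx.2.le
  · simp [hx]

lemma eLpNorm_one_piece_le {a : ℝ} {f : ℝ → ℂ} (hf : Measurable f) (k : ℤ) :
    eLpNorm (piece f k) 1 (omega a) ≤ e2 (k + 1) * omega a (lev (fun x => ‖f x‖ₑ) k) := by
  rw [eLpNorm_one_eq_lintegral_enorm]
  refine (lintegral_mono (enorm_piece_le f k)).trans ?_
  rw [lintegral_indicator (measurableSet_lev hf.enorm k), setLIntegral_const]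

lemma eLpNorm_two_eq_lintegral (a : ℝ) (f : ℝ → ℂ) :
    eLpNorm f 2 (omega a) = (∫⁻ x, ‖f x‖ₑ ^ (2 : ℝ) ∂(omega a)) ^ (1 / 2 : ℝ) := by
  rw [eLpNorm_eq_lintegral_rpow_enorm_toReal (by norm_num) (by norm_num)]
  simp

lemma eLpNorm_two_piece_le {a : ℝ} {f : ℝ → ℂ} (hf : Measurable f) (k : ℤ) :
    eLpNorm (piece f k) 2 (omega a) ≤
      e2 (k + 1) * omega a (lev (fun x => ‖f x‖ₑ) k) ^ (1 / 2 : ℝ) := by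
  rw [eLpNorm_two_eq_lintegral]
  have h : ∫⁻ x, ‖piece f k x‖ₑ ^ (2 : ℝ) ∂(omega a) ≤
      e2 (k + 1) ^ (2 : ℝ) * omega a (lev (fun x => ‖f x‖ₑ) k) := by
    rw [← setLIntegral_const, ← lintegral_indicator (measurableSet_lev hf.enorm k)]
    refine lintegral_mono fun x => ?_
    refine (ENNReal.rpow_le_rpow (enorm_piece_le f k x) (by norm_num)).trans ?_
    by_cases hx : x ∈ lev (fun x => ‖f x‖ₑ) k
    · rw [indicator_of_mem hx, indicator_of_mem hx]
    · simp [hx]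
  refine (ENNReal.rpow_le_rpow h (by norm_num)).trans (le_of_eq ?_)
  rw [ENNReal.mul_rpow_of_nonneg _ _ (by norm_num), ← ENNReal.rpow_mul]
  norm_num

/-- At most one piece is nonzero at each point. Partial sums are therefore dominated by `f` itself,
as dominated convergence requires. -/
lemma sum_piece_eq (f : ℝ → ℂ) (s : Finset ℤ) (x : ℝ) :
    (∑ k ∈ s, piece f k x = f x) ∨ (∑ k ∈ s, piece f k x = 0) := by
  by_cases h : ∃ k ∈ s, x ∈ lev (fun x => ‖f x‖ₑ) k
  · obtain ⟨k, hk, hx⟩ := h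
    left
    rw [Finset.sum_eq_single_of_mem k hk, piece, indicator_of_mem hx]
    intro l _ hl
    rw [piece, indicator_of_notMem]
    exact fun hxl => hl (lev_unique hxl hx)
  · right
    push Not at h
    exact Finset.sum_eq_zero fun k hk => by rw [piece, indicator_of_notMem (h k hk)]

lemma eventually_sum_piece_eq (f : ℝ → ℂ) (x : ℝ) :
    ∀ᶠ s : Finset ℤ in atTop, ∑ k ∈ s, piece f k x = f x := by
  by_cases h0 : f x = 0
  · refine Eventually.of_forall fun s => ?_
    rcases sum_piece_eq f s x with h | h
    · exact h
    · rw [h, h0]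
  obtain ⟨k, hk⟩ := exists_mem_lev (f := fun x => ‖f x‖ₑ) (x := x) (by simpa using h0) (by simp)
  filter_upwards [eventually_ge_atTop {k}] with s hs
  have hks : k ∈ s := by simpa using hs
  rw [Finset.sum_eq_single_of_mem k hks, piece, indicator_of_mem hk]
  intro l _ hl
  rw [piece, indicator_of_notMem]
  exact fun hxl => hl (lev_unique hxl hk)

lemma tendsto_eLpNorm_sub_sum_piece {a : ℝ} {f : ℝ → ℂ} (hm : Measurable f)
    (hf : MemLp f 2 (omega a)) :
    Tendsto (fun s : Finset ℤ => eLpNorm (fun x => f x - ∑ k ∈ s, piece f k x) 2 (omega a))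
      atTop (𝓝 0) := by
  simp_rw [eLpNorm_two_eq_lintegral]
  have hfin : ∫⁻ x, ‖f x‖ₑ ^ (2 : ℝ) ∂(omega a) ≠ ⊤ := by
    have := hf.2
    rw [eLpNorm_two_eq_lintegral] at this
    intro h
    rw [h] at this
    norm_num at this
  have h1 : Tendsto (fun s : Finset ℤ => ∫⁻ x, ‖f x - ∑ k ∈ s, piece f k x‖ₑ ^ (2 : ℝ) ∂(omega a))
      atTop (𝓝 (∫⁻ _, 0 ∂(omega a))) := by
    refine tendsto_lintegral_filter_of_dominated_convergence (fun x => ‖f x‖ₑ ^ (2 : ℝ)) ?_ ?_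
      hfin ?_
    · exact Eventually.of_forall fun s => (((hm.sub (Finset.measurable_fun_sum s fun k _ =>
        measurable_piece hm k)).enorm).pow_const _)
    · refine Eventually.of_forall fun s => Eventually.of_forall fun x => ?_
      rcases sum_piece_eq f s x with h | h
      · rw [h]; simp
      · rw [h, sub_zero]
    · refine Eventually.of_forall fun x => ?_
      refine tendsto_const_nhds.congr' ?_
      filter_upwards [eventually_sum_piece_eq f x] with s hs
      rw [hs]; simp
  rw [lintegral_zero] at h1
  have h2 := (ENNReal.continuous_rpow_const (y := (1 / 2 : ℝ))).tendsto 0 |>.comp h1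
  simpa [Function.comp_def] using h2

lemma inX_sum_piece {a : ℝ} {f : ℝ → ℂ} (hm : Measurable f) (hf : InX a f) (s : Finset ℤ) :
    InX a (fun x => ∑ k ∈ s, piece f k x) := by
  refine hf.mono (Finset.measurable_fun_sum s fun k _ =>
    measurable_piece hm k).aestronglyMeasurable (Eventually.of_forall fun x => ?_)
  rcases sum_piece_eq f s x with h | h
  · rw [h]
  · rw [h]; simp

lemma pairQ_add_left {a : ℝ} (ha : 0 ≤ a) (τ : ℝ) {f f' g : ℝ → ℂ} (hf : InX a f)
    (hf' : InX a f') (hg : InX a g) :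
    pairQ a τ (fun x => f x + f' x) g = pairQ a τ f g + pairQ a τ f' g := by
  unfold pairQ
  rw [← integral_add (integrable_pairQ ha τ hf hg) (integrable_pairQ ha τ hf' hg)]
  simp_rw [hank_add ha (hf.integrable ha) (hf'.integrable ha)]
  congr 1
  ext ξ
  ring

lemma pairQ_sum_piece {a : ℝ} (ha : 0 ≤ a) (τ : ℝ) {f g : ℝ → ℂ} (hm : Measurable f)
    (hf : InX a f) (hg : InX a g) (s : Finset ℤ) :
    pairQ a τ (fun x => ∑ k ∈ s, piece f k x) g = ∑ k ∈ s, pairQ a τ (piece f k) g := by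
  classical
  induction s using Finset.induction_on with
  | empty => simp [pairQ, hank]
  | insert k s hk ih =>
    simp_rw [Finset.sum_insert hk]
    rw [pairQ_add_left ha τ (hf.piece hm k) (inX_sum_piece hm hf s) hg, ih]

/-- Finite sums are handled by additivity; the remainder tends to zero because the form is
`L²`-continuous in its first argument. -/
lemma enorm_pairQ_le_tsum {a : ℝ} (ha : 0 ≤ a) (τ : ℝ) {f g : ℝ → ℂ} (hm : Measurable f)
    (hf : InX a f) (hg : InX a g) :
    ‖pairQ a τ f g‖ₑ ≤ ∑' k : ℤ, ‖pairQ a τ (piece f k) g‖ₑ := by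
  have h1 := ENNReal.Tendsto.mul_const (b := eLpNorm g 2 (omega a))
    (tendsto_eLpNorm_sub_sum_piece hm hf.memLp_two) (Or.inr hg.memLp_two.2.ne)
  have h2 := (tendsto_const_nhds (x := ∑' k : ℤ, ‖pairQ a τ (piece f k) g‖ₑ)).add h1
  rw [zero_mul, add_zero] at h2
  refine ge_of_tendsto' h2 fun s => ?_
  have hs := inX_sum_piece hm hf s
  have e : pairQ a τ f g = ∑ k ∈ s, pairQ a τ (piece f k) g +
      pairQ a τ (fun x => f x - ∑ k ∈ s, piece f k x) g := by
    rw [pairQ_sub_left ha τ hf hs hg, pairQ_sum_piece ha τ hm hf hg]; ring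
  rw [e]
  refine (enorm_add_le _ _).trans (add_le_add ?_ (enorm_pairQ_le ha τ (hf.sub hs) hg))
  exact (enorm_sum_le _ _).trans (ENNReal.sum_le_tsum s)

lemma enorm_pairQ_le_tsum_tsum {a : ℝ} (ha : 0 ≤ a) (τ : ℝ) {f g : ℝ → ℂ} (hm : Measurable f)
    (hf : InX a f) (hmg : Measurable g) (hg : InX a g) :
    ‖pairQ a τ f g‖ₑ ≤ ∑' k : ℤ, ∑' l : ℤ, ‖pairQ a τ (piece f k) (piece g l)‖ₑ := by
  refine (enorm_pairQ_le_tsum ha τ hm hf hg).trans (ENNReal.tsum_le_tsum fun k => ?_)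
  rw [pairQ_comm]
  refine (enorm_pairQ_le_tsum ha τ hmg hg (hf.piece hm k)).trans (le_of_eq ?_)
  simp_rw [pairQ_comm a τ (piece g _)]

/-- Pointwise `r ^ p ≤ r + r ^ 2` for `1 ≤ p ≤ 2`. -/
lemma lintegral_rpow_ne_top {a : ℝ} (ha : 0 ≤ a) {f : ℝ → ℂ} (hf : InX a f) {p : ℝ}
    (hp1 : 1 ≤ p) (hp2 : p ≤ 2) : ∫⁻ x, ‖f x‖ₑ ^ p ∂(omega a) ≠ ⊤ := by
  have h1 : ∫⁻ x, ‖f x‖ₑ ∂(omega a) ≠ ⊤ := (hf.integrable ha).2.ne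
  have h2 : ∫⁻ x, ‖f x‖ₑ ^ (2 : ℝ) ∂(omega a) ≠ ⊤ := by
    have := hf.memLp_two.2
    rw [eLpNorm_two_eq_lintegral] at this
    intro h
    rw [h] at this
    norm_num at this
  refine ne_top_of_le_ne_top (ENNReal.add_ne_top.2 ⟨h1, h2⟩) ?_
  rw [← lintegral_add_left' hf.aestronglyMeasurable.enorm]
  refine lintegral_mono fun x => ?_
  rcases le_total ‖f x‖ₑ 1 with h | h
  · calc ‖f x‖ₑ ^ p ≤ ‖f x‖ₑ ^ (1 : ℝ) := ENNReal.rpow_le_rpow_of_exponent_ge h hp1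
      _ = ‖f x‖ₑ := ENNReal.rpow_one _
      _ ≤ _ := le_self_add
  · exact (ENNReal.rpow_le_rpow_of_exponent_le h hp2).trans le_add_self

/-- The normalized interpolation bound. -/
lemma exists_pairQ_normalized {p : ℝ} (hp1 : 1 < p) (hp2 : p < 2) :
    ∃ C : ℝ≥0∞, C ≠ ⊤ ∧ ∀ (a : ℝ), 0 ≤ a → ∀ τ : ℝ, τ ≠ 0 → ∀ f g : ℝ → ℂ,
      Measurable f → InX a f → Measurable g → InX a g →
      ENNReal.ofReal (dispConst a τ) * ∫⁻ x, ‖f x‖ₑ ^ p ∂(omega a) ≤ 1 →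
      ENNReal.ofReal (dispConst a τ) * ∫⁻ x, ‖g x‖ₑ ^ p ∂(omega a) ≤ 1 →
      ENNReal.ofReal (dispConst a τ) * ‖pairQ a τ f g‖ₑ ≤ C := by
  obtain ⟨C, hC, H⟩ := exists_interpolation_bound hp1 hp2
  refine ⟨C, hC, fun a ha τ hτ f g hmf hf hmg hg h1 h2 => ?_⟩
  -- Weighting the measure by `M` removes `τ` from both bounds: `M |Q|` is at most `(M ‖f‖₁) (M
  -- ‖g‖₁)` and at most `(M^{1/2} ‖f‖₂) (M^{1/2} ‖g‖₂)`. The summation lemma then gives a constant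
  -- independent of `a` and `τ`.
  set M := ENNReal.ofReal (dispConst a τ)
  refine (mul_le_mul_right (enorm_pairQ_le_tsum_tsum ha τ hmf hf hmg hg) M).trans ?_
  simp_rw [← ENNReal.tsum_mul_left]
  have hsum : ∀ f : ℝ → ℂ, Measurable f → M * ∫⁻ x, ‖f x‖ₑ ^ p ∂(omega a) ≤ 1 →
      ∑' k : ℤ, e2 (k * p) * (M * omega a (lev (fun x => ‖f x‖ₑ) k)) ≤ 1 := by
    intro f hmf h
    refine le_trans ?_ h
    simp_rw [mul_left_comm _ M]
    rw [ENNReal.tsum_mul_left]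
    gcongr
    exact tsum_lev_le _ hmf.enorm (by linarith)
  refine H (fun k => M * omega a (lev (fun x => ‖f x‖ₑ) k))
    (fun k => M * omega a (lev (fun x => ‖g x‖ₑ) k)) _ (hsum f hmf h1) (hsum g hmg h2) ?_ ?_
  · intro k l
    calc M * ‖pairQ a τ (piece f k) (piece g l)‖ₑ
        ≤ M * (M * eLpNorm (piece f k) 1 (omega a) * eLpNorm (piece g l) 1 (omega a)) := by
          gcongr
          exact enorm_pairQ_le_dispersive ha hτ (hf.piece hmf k) (hg.piece hmg l)
      _ ≤ M * (M * (e2 (k + 1) * omega a (lev (fun x => ‖f x‖ₑ) k)) *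
          (e2 (l + 1) * omega a (lev (fun x => ‖g x‖ₑ) l))) := by
          gcongr
          · exact eLpNorm_one_piece_le hmf k
          · exact eLpNorm_one_piece_le hmg l
      _ = _ := by ring
  · intro k l
    have hMM : M = M ^ (1 / 2 : ℝ) * M ^ (1 / 2 : ℝ) := by
      rw [← ENNReal.rpow_add_of_nonneg _ _ (by norm_num) (by norm_num)]; norm_num
    rw [ENNReal.mul_rpow_of_nonneg M _ (by norm_num), ENNReal.mul_rpow_of_nonneg M _ (by norm_num)]
    calc M * ‖pairQ a τ (piece f k) (piece g l)‖ₑ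
        ≤ (M ^ (1 / 2 : ℝ) * M ^ (1 / 2 : ℝ)) *
          (eLpNorm (piece f k) 2 (omega a) * eLpNorm (piece g l) 2 (omega a)) := by
          rw [← hMM]
          gcongr
          exact enorm_pairQ_le ha τ (hf.piece hmf k) (hg.piece hmg l)
      _ ≤ (M ^ (1 / 2 : ℝ) * M ^ (1 / 2 : ℝ)) *
          ((e2 (k + 1) * omega a (lev (fun x => ‖f x‖ₑ) k) ^ (1 / 2 : ℝ)) *
          (e2 (l + 1) * omega a (lev (fun x => ‖g x‖ₑ) l) ^ (1 / 2 : ℝ))) := by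
          gcongr
          · exact eLpNorm_two_piece_le hmf k
          · exact eLpNorm_two_piece_le hmg l
      _ = _ := by ring

lemma pairQ_eq_zero_of_lintegral_eq_zero {a : ℝ} (τ : ℝ) {f : ℝ → ℂ} (g : ℝ → ℂ)
    (hm : Measurable f) {p : ℝ} (hp : 0 < p) (h : ∫⁻ x, ‖f x‖ₑ ^ p ∂(omega a) = 0) :
    pairQ a τ f g = 0 := by
  rw [lintegral_eq_zero_iff (hm.enorm.pow_const p)] at h
  have h0 : f =ᵐ[omega a] 0 := by
    filter_upwards [h] with x hx
    simpa [hp] using hx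
  unfold pairQ
  simp_rw [hank_congr h0, hank_zero_fun]
  simp

/-- The exponent `2(a+3)/(a+5)`. -/
def strP (a : ℝ) : ℝ := 2 * (a + 3) / (a + 5)

/-- The exponent of time decay `(a+1)/(a+3)`. -/
def strG (a : ℝ) : ℝ := (a + 1) / (a + 3)

lemma one_lt_strP {a : ℝ} (ha : 0 ≤ a) : 1 < strP a := by
  unfold strP; rw [lt_div_iff₀ (by linarith)]; linarith

lemma strP_lt_two {a : ℝ} (ha : 0 ≤ a) : strP a < 2 := by
  unfold strP; rw [div_lt_iff₀ (by linarith)]; linarith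

lemma strG_pos {a : ℝ} (ha : 0 ≤ a) : 0 < strG a := by unfold strG; positivity

lemma strG_lt_one {a : ℝ} (ha : 0 ≤ a) : strG a < 1 := by
  unfold strG; rw [div_lt_iff₀ (by linarith)]; linarith

lemma strP_eq {a : ℝ} (ha : 0 ≤ a) : strP a = 2 / (2 - strG a) := by
  unfold strP strG
  have h1 : a + 3 ≠ 0 := by linarith
  have h2 : a + 5 ≠ 0 := by linarith
  rw [show 2 - (a + 1) / (a + 3) = (a + 5) / (a + 3) by field_simp; ring]
  field_simp

/-- Undoing the normalization costs the power `2 / p - 1` of the dispersive constant. For `p = strP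
a` this power is `2 / (a + 3)`, which turns the decay rate `(a + 1) / 2` into `(a + 1) / (a + 3)`.
-/
lemma exists_pairQ_decay {a : ℝ} (ha : 0 ≤ a) :
    ∃ C : ℝ≥0∞, C ≠ ⊤ ∧ ∀ τ : ℝ, τ ≠ 0 → ∀ f g : ℝ → ℂ,
      Measurable f → InX a f → Measurable g → InX a g →
      ‖pairQ a τ f g‖ₑ ≤ C * ENNReal.ofReal (|τ| ^ (-strG a)) *
        ((∫⁻ x, ‖f x‖ₑ ^ strP a ∂(omega a)) ^ (1 / strP a) *
          (∫⁻ x, ‖g x‖ₑ ^ strP a ∂(omega a)) ^ (1 / strP a)) := by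
  have hp1 := one_lt_strP ha
  have hp2 := strP_lt_two ha
  set p := strP a with hp
  have hp0 : 0 < p := by linarith
  obtain ⟨C, hC, H⟩ := exists_pairQ_normalized hp1 hp2
  set θ : ℝ := 2 / p - 1 with hθ
  set c0 : ℝ := 2 ^ (-((a + 1) / 2)) * (gaussMoment a)⁻¹ with hc0
  have hM := gaussMoment_pos ha
  have hc0pos : 0 < c0 := by positivity
  refine ⟨C * ENNReal.ofReal (c0 ^ θ), ENNReal.mul_ne_top hC ENNReal.ofReal_ne_top, ?_⟩
  intro τ hτ f g hmf hf hmg hg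
  have hIf := lintegral_rpow_ne_top ha hf hp1.le hp2.le
  have hIg := lintegral_rpow_ne_top ha hg hp1.le hp2.le
  by_cases hf0 : ∫⁻ x, ‖f x‖ₑ ^ p ∂(omega a) = 0
  · rw [pairQ_eq_zero_of_lintegral_eq_zero τ g hmf hp0 hf0]; simp
  by_cases hg0 : ∫⁻ x, ‖g x‖ₑ ^ p ∂(omega a) = 0
  · rw [pairQ_comm, pairQ_eq_zero_of_lintegral_eq_zero τ f hmg hp0 hg0]; simp
  set m := dispConst a τ with hm
  have hm0 : 0 < m := dispConst_pos ha hτ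
  have scale : ∀ f : ℝ → ℂ, ∫⁻ x, ‖f x‖ₑ ^ p ∂(omega a) ≠ ⊤ →
      ∫⁻ x, ‖f x‖ₑ ^ p ∂(omega a) ≠ 0 → ∃ l : ℝ, 0 < l ∧
        ENNReal.ofReal m * ∫⁻ x, ‖(l : ℂ) * f x‖ₑ ^ p ∂(omega a) ≤ 1 ∧
        ENNReal.ofReal l⁻¹ = ENNReal.ofReal (m ^ (1 / p)) *
          (∫⁻ x, ‖f x‖ₑ ^ p ∂(omega a)) ^ (1 / p) := by
    intro f htop h0
    set i := (∫⁻ x, ‖f x‖ₑ ^ p ∂(omega a)).toReal with hi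
    have hi0 : 0 < i := ENNReal.toReal_pos h0 htop
    have hI : ∫⁻ x, ‖f x‖ₑ ^ p ∂(omega a) = ENNReal.ofReal i := (ENNReal.ofReal_toReal htop).symm
    have hmi : 0 < m * i := by positivity
    -- The scalar that makes the weighted `p`-th power integral equal to `1`.
    refine ⟨(m * i) ^ (-(1 / p)), by positivity, ?_, ?_⟩
    · set l := (m * i) ^ (-(1 / p)) with hl
      have hl0 : 0 < l := by positivity
      have e : ∀ x, ‖(l : ℂ) * f x‖ₑ ^ p = ENNReal.ofReal (l ^ p) * ‖f x‖ₑ ^ p := by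
        intro x
        rw [enorm_mul, ENNReal.mul_rpow_of_nonneg _ _ hp0.le, ← ofReal_norm (l : ℂ),
          Complex.norm_real, Real.norm_of_nonneg hl0.le, ENNReal.ofReal_rpow_of_pos hl0]
      simp_rw [e]
      rw [lintegral_const_mul' _ _ ENNReal.ofReal_ne_top, hI, ← ENNReal.ofReal_mul (by positivity),
        ← ENNReal.ofReal_mul hm0.le]
      have : l ^ p = (m * i)⁻¹ := by
        rw [hl, ← Real.rpow_mul hmi.le, ← Real.rpow_neg_one]
        congr 1
        field_simp
      rw [this, mul_left_comm, inv_mul_cancel₀ hmi.ne', ENNReal.ofReal_one]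
    · rw [hI, ENNReal.ofReal_rpow_of_pos hi0, ← ENNReal.ofReal_mul (by positivity),
        ← Real.mul_rpow hm0.le hi0.le, ← Real.rpow_neg hmi.le, neg_neg]
  obtain ⟨l, hl0, hl1, hl2⟩ := scale f hIf hf0
  obtain ⟨l', hl0', hl1', hl2'⟩ := scale g hIg hg0
  have key := H a ha τ hτ (fun x => (l : ℂ) * f x) (fun x => (l' : ℂ) * g x)
    (hmf.const_mul _) (hf.const_mul _) (hmg.const_mul _) (hg.const_mul _) hl1 hl1'
  rw [pairQ_const_mul_left, pairQ_comm, pairQ_const_mul_left, pairQ_comm, enorm_mul, enorm_mul,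
    ← ofReal_norm (l : ℂ), ← ofReal_norm (l' : ℂ), Complex.norm_real, Complex.norm_real,
    Real.norm_of_nonneg hl0.le, Real.norm_of_nonneg hl0'.le] at key
  have inv : ∀ r : ℝ, 0 < r → ENNReal.ofReal r⁻¹ * ENNReal.ofReal r = 1 := by
    intro r hr
    rw [← ENNReal.ofReal_mul (by positivity), inv_mul_cancel₀ hr.ne', ENNReal.ofReal_one]
  have e1 : ‖pairQ a τ f g‖ₑ = (ENNReal.ofReal m⁻¹ * ENNReal.ofReal l⁻¹ * ENNReal.ofReal l'⁻¹) *
      (ENNReal.ofReal m * (ENNReal.ofReal l * (ENNReal.ofReal l' * ‖pairQ a τ f g‖ₑ))) := by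
    calc ‖pairQ a τ f g‖ₑ = (ENNReal.ofReal m⁻¹ * ENNReal.ofReal m) *
          (ENNReal.ofReal l⁻¹ * ENNReal.ofReal l) * (ENNReal.ofReal l'⁻¹ * ENNReal.ofReal l') *
          ‖pairQ a τ f g‖ₑ := by rw [inv m hm0, inv l hl0, inv l' hl0']; simp
      _ = _ := by ring
  rw [e1]
  refine (mul_le_mul_right key _).trans (le_of_eq ?_)
  rw [hl2, hl2']
  have e2 : ENNReal.ofReal m⁻¹ * ENNReal.ofReal (m ^ (1 / p)) * ENNReal.ofReal (m ^ (1 / p)) =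
      ENNReal.ofReal (c0 ^ θ) * ENNReal.ofReal (|τ| ^ (-strG a)) := by
    have hτ0 : 0 < |τ| := by positivity
    rw [← ENNReal.ofReal_mul (by positivity), ← ENNReal.ofReal_mul (by positivity),
      ← ENNReal.ofReal_mul (by positivity)]
    congr 1
    have e3 : m = c0 * |τ| ^ (-((a + 1) / 2)) := by
      rw [hm, hc0, dispConst, abs_mul, abs_of_pos (by norm_num : (0 : ℝ) < 2),
        Real.mul_rpow (by norm_num) hτ0.le]
      ring
    have e4 : m⁻¹ * m ^ (1 / p) * m ^ (1 / p) = m ^ θ := by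
      rw [← Real.rpow_neg_one, ← Real.rpow_add hm0, ← Real.rpow_add hm0]
      congr 1
      rw [hθ]; ring
    rw [e4, e3, Real.mul_rpow hc0pos.le (by positivity), ← Real.rpow_mul hτ0.le]
    congr 2
    rw [hθ, hp]
    unfold strP strG
    have h1 : a + 3 ≠ 0 := by linarith
    have h2 : a + 5 ≠ 0 := by linarith
    field_simp
    ring
  calc _ = (ENNReal.ofReal m⁻¹ * ENNReal.ofReal (m ^ (1 / p)) * ENNReal.ofReal (m ^ (1 / p))) *
        ((∫⁻ x, ‖f x‖ₑ ^ p ∂(omega a)) ^ (1 / p) * (∫⁻ x, ‖g x‖ₑ ^ p ∂(omega a)) ^ (1 / p)) * C := by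
        ring
    _ = _ := by rw [e2]; ring

/-! ### Fractional integration in time -/

/-- The kernel `|u|^(-γ)`. -/
def fker (γ u : ℝ) : ℝ≥0∞ := ENNReal.ofReal (|u| ^ (-γ))

lemma measurable_fker (γ : ℝ) : Measurable (fker γ) := by unfold fker; fun_prop

lemma fker_neg (γ u : ℝ) : fker γ (-u) = fker γ u := by simp [fker]

lemma lintegral_fker_Ioo {γ : ℝ} (h1 : γ < 1) {r : ℝ} (hr : 0 < r) :
    ∫⁻ u in Ioc 0 r, fker γ u = ENNReal.ofReal (r ^ (1 - γ) / (1 - γ)) := by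
  have hi : IntervalIntegrable (fun u : ℝ => u ^ (-γ)) volume 0 r :=
    intervalIntegral.intervalIntegrable_rpow' (by linarith)
  have h2 : ∫ u in (0 : ℝ)..r, u ^ (-γ) = r ^ (1 - γ) / (1 - γ) := by
    rw [integral_rpow (Or.inl (by linarith)), Real.zero_rpow (by linarith), sub_zero,
      show -γ + 1 = 1 - γ by ring]
  rw [← h2, intervalIntegral.integral_of_le hr.le, ofReal_integral_eq_lintegral_ofReal]
  · refine setLIntegral_congr_fun measurableSet_Ioc fun u hu => ?_
    simp only [fker, abs_of_pos hu.1]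
  · exact (intervalIntegrable_iff_integrableOn_Ioc_of_le hr.le).1 hi
  · filter_upwards [ae_restrict_mem measurableSet_Ioc] with u hu
    exact Real.rpow_nonneg hu.1.le _

lemma lintegral_fker_le {γ : ℝ} (h1 : γ < 1) {r : ℝ} (hr : 0 < r) :
    ∫⁻ u, (Icc (-r) r).indicator (fker γ) u ≤ ENNReal.ofReal (2 / (1 - γ) * r ^ (1 - γ)) := by
  set h : ℝ → ℝ≥0∞ := (Ioc 0 r).indicator (fker γ) with hh
  have hle : ∀ᵐ u : ℝ, (Icc (-r) r).indicator (fker γ) u ≤ h u + h (-u) := by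
    filter_upwards [(measure_eq_zero_iff_ae_notMem.1 (Real.volume_singleton (a := 0)))] with u hu
    have hu0 : u ≠ 0 := hu
    by_cases hm : u ∈ Icc (-r) r
    · rw [indicator_of_mem hm]
      rcases lt_or_gt_of_ne hu0 with h' | h'
      · refine le_trans ?_ le_add_self
        rw [hh, indicator_of_mem (show -u ∈ Ioc 0 r from ⟨by linarith, by linarith [hm.1]⟩), fker_neg]
      · refine le_trans ?_ le_self_add
        rw [hh, indicator_of_mem (show u ∈ Ioc 0 r from ⟨h', hm.2⟩)]
    · rw [indicator_of_notMem hm]; exact zero_le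
  have hmh : Measurable h := (measurable_fker γ).indicator measurableSet_Ioc
  refine (lintegral_mono_ae hle).trans (le_of_eq ?_)
  rw [lintegral_add_left hmh, lintegral_neg_eq_self, hh, lintegral_indicator measurableSet_Ioc,
    lintegral_fker_Ioo h1 hr, ← ENNReal.ofReal_add]
  · congr 1; ring
  all_goals exact div_nonneg (by positivity) (by linarith)

/-- Split at distance `r = |A|` from `t`: inside, integrate the kernel over the whole interval;
outside, bound the kernel by `r ^ (-γ)` and use the measure of `A`. Both parts scale as `|A| ^ (1 -
γ)`. -/
lemma setLIntegral_fker_le {γ : ℝ} (h0 : 0 < γ) (h1 : γ < 1) (A : Set ℝ) (t : ℝ) :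
    ∫⁻ s in A, fker γ (t - s) ≤ ENNReal.ofReal (2 / (1 - γ) + 1) * volume A ^ (1 - γ) := by
  have hK : (0 : ℝ) < 2 / (1 - γ) + 1 := by
    have : 0 < 1 - γ := by linarith
    positivity
  by_cases hA0 : volume A = 0
  · rw [setLIntegral_measure_zero _ _ hA0]; exact zero_le
  by_cases hAt : volume A = ⊤
  · rw [hAt, ENNReal.top_rpow_of_pos (by linarith), ENNReal.mul_top]
    · exact le_top
    · simpa using hK
  set r := (volume A).toReal with hr
  have hr0 : 0 < r := ENNReal.toReal_pos hA0 hAt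
  have hA : volume A = ENNReal.ofReal r := (ENNReal.ofReal_toReal hAt).symm
  have hle : ∀ s, fker γ (t - s) ≤
      (Icc (-r) r).indicator (fker γ) (t - s) + ENNReal.ofReal (r ^ (-γ)) := by
    intro s
    by_cases hm : t - s ∈ Icc (-r) r
    · rw [indicator_of_mem hm]; exact le_self_add
    · rw [indicator_of_notMem hm, zero_add]
      refine ENNReal.ofReal_le_ofReal ?_
      have hlt : r < |t - s| := by
        rw [mem_Icc, ← abs_le] at hm
        linarith
      exact Real.rpow_le_rpow_of_nonpos hr0 hlt.le (by linarith)
  calc ∫⁻ s in A, fker γ (t - s)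
      ≤ ∫⁻ s in A, ((Icc (-r) r).indicator (fker γ) (t - s) + ENNReal.ofReal (r ^ (-γ))) :=
        lintegral_mono fun s => hle s
    _ = (∫⁻ s in A, (Icc (-r) r).indicator (fker γ) (t - s)) +
        ENNReal.ofReal (r ^ (-γ)) * volume A := by
        rw [lintegral_add_right _ measurable_const, setLIntegral_const]
    _ ≤ (∫⁻ s, (Icc (-r) r).indicator (fker γ) (t - s)) +
        ENNReal.ofReal (r ^ (-γ)) * volume A := by
        gcongr
        exact Measure.restrict_le_self
    _ ≤ ENNReal.ofReal (2 / (1 - γ) * r ^ (1 - γ)) + ENNReal.ofReal (r ^ (1 - γ)) := by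
        gcongr
        · rw [lintegral_sub_left_eq_self (fun u => (Icc (-r) r).indicator (fker γ) u) t]
          exact lintegral_fker_le h1 hr0
        · rw [hA, ← ENNReal.ofReal_mul (by positivity), ← Real.rpow_add_one hr0.ne',
            show -γ + 1 = 1 - γ by ring]
    _ = ENNReal.ofReal (2 / (1 - γ) + 1) * volume A ^ (1 - γ) := by
        have : (0 : ℝ) < 1 - γ := by linarith
        rw [hA, ENNReal.ofReal_rpow_of_pos hr0, ← ENNReal.ofReal_mul hK.le,
          ← ENNReal.ofReal_add (by positivity) (by positivity)]
        congr 1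
        ring

/-- Cut both functions along dyadic level sets. On a product of two level sets the kernel can be
integrated first in either variable, which gives the two competing bounds of
`exists_fractional_bound`. -/
lemma exists_hls_normalized {γ : ℝ} (h0 : 0 < γ) (h1 : γ < 1) :
    ∃ C : ℝ≥0∞, C ≠ ⊤ ∧ ∀ f g : ℝ → ℝ≥0∞, Measurable f → Measurable g →
      ∫⁻ t, f t ^ (2 / (2 - γ)) ≤ 1 → ∫⁻ t, g t ^ (2 / (2 - γ)) ≤ 1 →
      ∫⁻ t, ∫⁻ s, f t * g s * fker γ (t - s) ≤ C := by
  obtain ⟨C, hC, H⟩ := exists_fractional_bound h0 h1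
  set p : ℝ := 2 / (2 - γ) with hp
  have h2γ : (0 : ℝ) < 2 - γ := by linarith
  have hp0 : 0 < p := by positivity
  set K := ENNReal.ofReal (2 / (1 - γ) + 1) with hKdef
  refine ⟨K * C, ENNReal.mul_ne_top ENNReal.ofReal_ne_top hC, fun f g hf hg hfi hgi => ?_⟩
  have hfin : ∀ f : ℝ → ℝ≥0∞, Measurable f → ∫⁻ t, f t ^ p ≤ 1 → ∀ᵐ t, f t ≠ ⊤ := by
    intro f hf hfi
    have := ae_lt_top (hf.pow_const p) (ne_top_of_le_ne_top ENNReal.one_ne_top hfi)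
    filter_upwards [this] with t ht htop
    rw [htop, ENNReal.top_rpow_of_pos hp0] at ht
    exact lt_irrefl _ ht
  have hker : Measurable fun q : ℝ × ℝ => fker γ (q.1 - q.2) :=
    (measurable_fker γ).comp (measurable_fst.sub measurable_snd)
  have hmA := fun k => measurableSet_lev hf k
  have hmB := fun k => measurableSet_lev hg k
  let T : ℤ → ℤ → ℝ≥0∞ := fun k l => e2 (k + 1) * e2 (l + 1) *
    ∫⁻ t in lev f k, ∫⁻ s in lev g l, fker γ (t - s)
  have hmain : ∫⁻ t, ∫⁻ s, f t * g s * fker γ (t - s) ≤ ∑' k, ∑' l, T k l := by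
    have hi : ∀ᵐ t, ∫⁻ s, f t * g s * fker γ (t - s) ≤
        ∑' k : ℤ, ∑' l : ℤ, (lev f k).indicator (fun _ => e2 (k + 1)) t *
          (e2 (l + 1) * ∫⁻ s in lev g l, fker γ (t - s)) := by
      filter_upwards [hfin f hf hfi] with t ht
      have e : ∀ᵐ s, f t * g s * fker γ (t - s) ≤ ∑' k : ℤ, ∑' l : ℤ,
          (lev f k).indicator (fun _ => e2 (k + 1)) t *
            ((lev g l).indicator (fun s => e2 (l + 1) * fker γ (t - s)) s) := by
        filter_upwards [hfin g hg hgi] with s hs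
        calc f t * g s * fker γ (t - s)
            ≤ (∑' k : ℤ, (lev f k).indicator (fun _ => e2 (k + 1)) t) *
              (∑' l : ℤ, (lev g l).indicator (fun _ => e2 (l + 1)) s) * fker γ (t - s) := by
              gcongr
              · exact le_tsum_lev ht
              · exact le_tsum_lev hs
          _ = _ := by
              rw [mul_assoc, ← ENNReal.tsum_mul_right, ← ENNReal.tsum_mul_right]
              refine tsum_congr fun k => ?_
              rw [← ENNReal.tsum_mul_left]
              refine tsum_congr fun l => ?_
              congr 1
              by_cases hs' : s ∈ lev g l
              · simp [hs']
              · simp [hs']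
      refine (lintegral_mono_ae e).trans (le_of_eq ?_)
      have hmt : Measurable fun s => fker γ (t - s) :=
        hker.comp (measurable_const.prodMk measurable_id)
      have hmi : ∀ l : ℤ, Measurable fun s =>
          (lev g l).indicator (fun s => e2 (l + 1) * fker γ (t - s)) s := fun l =>
        (measurable_const.mul hmt).indicator (hmB l)
      rw [lintegral_tsum fun k => (Measurable.tsum fun l =>
        (hmi l).const_mul _).aemeasurable]
      refine tsum_congr fun k => ?_
      rw [lintegral_tsum fun l => ((hmi l).const_mul _).aemeasurable]
      refine tsum_congr fun l => ?_
      rw [lintegral_const_mul _ (hmi l), lintegral_indicator (hmB l),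
        lintegral_const_mul _ hmt]
    refine (lintegral_mono_ae hi).trans (le_of_eq ?_)
    have hmI : ∀ l : ℤ, Measurable fun t => ∫⁻ s in lev g l, fker γ (t - s) := fun l =>
      hker.lintegral_prod_right'
    have hmk : ∀ k l : ℤ, Measurable fun t => (lev f k).indicator (fun _ => e2 (k + 1)) t *
        (e2 (l + 1) * ∫⁻ s in lev g l, fker γ (t - s)) := fun k l =>
      (measurable_const.indicator (hmA k)).mul ((hmI l).const_mul _)
    rw [lintegral_tsum fun k => (Measurable.tsum fun l => hmk k l).aemeasurable]
    refine tsum_congr fun k => ?_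
    rw [lintegral_tsum fun l => (hmk k l).aemeasurable]
    refine tsum_congr fun l => ?_
    have e : ∀ t, (lev f k).indicator (fun _ => e2 (k + 1)) t *
        (e2 (l + 1) * ∫⁻ s in lev g l, fker γ (t - s)) =
        (lev f k).indicator (fun t => e2 (k + 1) * e2 (l + 1) *
          ∫⁻ s in lev g l, fker γ (t - s)) t := by
      intro t
      by_cases ht : t ∈ lev f k
      · simp [ht, mul_assoc]
      · simp [ht]
    simp_rw [e]
    rw [lintegral_indicator (hmA k), lintegral_const_mul _ (hmI l)]
  refine hmain.trans ?_
  have hT1 : ∀ k l, T k l ≤ K * (e2 (k + 1) * e2 (l + 1) *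
      (volume (lev f k) * volume (lev g l) ^ (1 - γ))) := by
    intro k l
    calc T k l ≤ e2 (k + 1) * e2 (l + 1) * ∫⁻ t in lev f k, K * volume (lev g l) ^ (1 - γ) := by
          simp only [T]
          gcongr with t
          exact setLIntegral_fker_le h0 h1 _ t
      _ = _ := by rw [setLIntegral_const]; ring
  have hT2 : ∀ k l, T k l ≤ K * (e2 (k + 1) * e2 (l + 1) *
      (volume (lev g l) * volume (lev f k) ^ (1 - γ))) := by
    intro k l
    calc T k l = e2 (k + 1) * e2 (l + 1) *
          ∫⁻ s in lev g l, ∫⁻ t in lev f k, fker γ (s - t) := by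
          simp only [T]
          rw [lintegral_lintegral_swap hker.aemeasurable]
          congr 1
          refine lintegral_congr fun s => lintegral_congr fun t => ?_
          rw [← fker_neg, neg_sub]
      _ ≤ e2 (k + 1) * e2 (l + 1) * ∫⁻ t in lev g l, K * volume (lev f k) ^ (1 - γ) := by
          gcongr with t
          exact setLIntegral_fker_le h0 h1 _ t
      _ = _ := by rw [setLIntegral_const]; ring
  have hK0 : K ≠ 0 := by
    have : 0 < 1 - γ := by linarith
    have : (0 : ℝ) < 2 / (1 - γ) + 1 := by positivity
    simpa [hKdef] using this
  have hKt : K ≠ ⊤ := ENNReal.ofReal_ne_top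
  have hT' : ∀ k l, T k l = K * (K⁻¹ * T k l) := by
    intro k l
    rw [← mul_assoc, ENNReal.mul_inv_cancel hK0 hKt, one_mul]
  have hdiv : ∀ k l X, T k l ≤ K * X → K⁻¹ * T k l ≤ X := by
    intro k l X hX
    calc K⁻¹ * T k l ≤ K⁻¹ * (K * X) := by gcongr
      _ = X := by rw [← mul_assoc, ENNReal.inv_mul_cancel hK0 hKt, one_mul]
  have hsum : ∑' k, ∑' l, T k l = K * ∑' k, ∑' l, K⁻¹ * T k l := by
    rw [← ENNReal.tsum_mul_left]
    refine tsum_congr fun k => ?_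
    rw [← ENNReal.tsum_mul_left]
    exact tsum_congr fun l => hT' k l
  rw [hsum]
  gcongr
  exact H (fun k => volume (lev f k)) (fun k => volume (lev g k)) (fun k l => K⁻¹ * T k l)
    ((tsum_lev_le volume hf hp0.le).trans hfi) ((tsum_lev_le volume hg hp0.le).trans hgi)
    (fun k l => hdiv k l _ (hT1 k l)) (fun k l => hdiv k l _ (hT2 k l))

/-- The Hardy–Littlewood–Sobolev inequality on the line, on the diagonal. -/
lemma exists_hls {γ : ℝ} (h0 : 0 < γ) (h1 : γ < 1) :
    ∃ C : ℝ≥0∞, C ≠ ⊤ ∧ ∀ f g : ℝ → ℝ≥0∞, Measurable f → Measurable g →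
      ∫⁻ t, ∫⁻ s, f t * g s * fker γ (t - s) ≤
        C * ((∫⁻ t, f t ^ (2 / (2 - γ))) ^ (1 / (2 / (2 - γ))) *
          (∫⁻ t, g t ^ (2 / (2 - γ))) ^ (1 / (2 / (2 - γ)))) := by
  obtain ⟨C, hC, H⟩ := exists_hls_normalized h0 h1
  set p : ℝ := 2 / (2 - γ) with hp
  have h2γ : (0 : ℝ) < 2 - γ := by linarith
  have hp0 : 0 < p := by positivity
  -- The added `1` makes the constant nonzero, so that the right side is infinite when one norm is
  -- infinite and the other is not zero.
  refine ⟨C + 1, ENNReal.add_ne_top.2 ⟨hC, ENNReal.one_ne_top⟩, fun f g hf hg => ?_⟩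
  by_cases hf0 : ∫⁻ t, f t ^ p = 0
  · have hz : f =ᵐ[volume] 0 := by
      rw [lintegral_eq_zero_iff (hf.pow_const p)] at hf0
      filter_upwards [hf0] with x hx
      simpa [hp0, hp0.le, hp0.not_gt] using hx
    have : ∫⁻ t, ∫⁻ s, f t * g s * fker γ (t - s) = ∫⁻ _ : ℝ, 0 := by
      refine lintegral_congr_ae ?_
      filter_upwards [hz] with t ht
      simp [ht]
    rw [this]; simp
  by_cases hg0 : ∫⁻ t, g t ^ p = 0
  · have hz : g =ᵐ[volume] 0 := by
      rw [lintegral_eq_zero_iff (hg.pow_const p)] at hg0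
      filter_upwards [hg0] with x hx
      simpa [hp0, hp0.le, hp0.not_gt] using hx
    have : ∀ t, ∫⁻ s, f t * g s * fker γ (t - s) = ∫⁻ _ : ℝ, 0 := by
      intro t
      refine lintegral_congr_ae ?_
      filter_upwards [hz] with s hs
      simp [hs]
    simp [this]
  have hpow0 : ∀ {I : ℝ≥0∞}, I ≠ 0 → I ^ (1 / p) ≠ 0 := fun h => by
    simp [h, hp0.le]
  by_cases hft : ∫⁻ t, f t ^ p = ⊤
  · rw [hft, ENNReal.top_rpow_of_pos (by positivity), ENNReal.top_mul (hpow0 hg0),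
      ENNReal.mul_top (by simp)]
    exact le_top
  by_cases hgt : ∫⁻ t, g t ^ p = ⊤
  · rw [hgt, ENNReal.top_rpow_of_pos (by positivity), ENNReal.mul_top (hpow0 hf0),
      ENNReal.mul_top (by simp)]
    exact le_top
  set I := (∫⁻ t, f t ^ p) ^ (1 / p) with hI
  set J := (∫⁻ t, g t ^ p) ^ (1 / p) with hJ
  have hI0 : I ≠ 0 := hpow0 hf0
  have hJ0 : J ≠ 0 := hpow0 hg0
  have hIt : I ≠ ⊤ := ENNReal.rpow_ne_top_of_nonneg (by positivity) hft
  have hJt : J ≠ ⊤ := ENNReal.rpow_ne_top_of_nonneg (by positivity) hgt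
  have norm1 : ∀ (f : ℝ → ℝ≥0∞) (I : ℝ≥0∞), Measurable f → I = (∫⁻ t, f t ^ p) ^ (1 / p) →
      I ≠ 0 → I ≠ ⊤ → ∫⁻ t, (I⁻¹ * f t) ^ p ≤ 1 := by
    intro f I hf hI hI0 hIt
    simp_rw [ENNReal.mul_rpow_of_nonneg _ _ hp0.le]
    rw [lintegral_const_mul _ (hf.pow_const p)]
    have : ∫⁻ t, f t ^ p = I ^ p := by
      rw [hI, ← ENNReal.rpow_mul, one_div_mul_cancel hp0.ne', ENNReal.rpow_one]
    rw [this, ← ENNReal.mul_rpow_of_nonneg _ _ hp0.le, ENNReal.inv_mul_cancel hI0 hIt,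
      ENNReal.one_rpow]
  have key := H (fun t => I⁻¹ * f t) (fun t => J⁻¹ * g t) (hf.const_mul _) (hg.const_mul _)
    (norm1 f I hf hI hI0 hIt) (norm1 g J hg hJ hJ0 hJt)
  have hker : Measurable fun q : ℝ × ℝ => fker γ (q.1 - q.2) :=
    (measurable_fker γ).comp (measurable_fst.sub measurable_snd)
  have hm2 : Measurable fun q : ℝ × ℝ => f q.1 * g q.2 * fker γ (q.1 - q.2) :=
    ((hf.comp measurable_fst).mul (hg.comp measurable_snd)).mul hker
  have e : ∫⁻ t, ∫⁻ s, (I⁻¹ * f t) * (J⁻¹ * g s) * fker γ (t - s) =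
      (I⁻¹ * J⁻¹) * ∫⁻ t, ∫⁻ s, f t * g s * fker γ (t - s) := by
    have hmo : Measurable fun t => ∫⁻ s, f t * g s * fker γ (t - s) := hm2.lintegral_prod_right'
    rw [← lintegral_const_mul _ hmo]
    refine lintegral_congr fun t => ?_
    have hmt : Measurable fun s => f t * g s * fker γ (t - s) :=
      hm2.comp (measurable_const.prodMk measurable_id)
    rw [← lintegral_const_mul _ hmt]
    refine lintegral_congr fun s => ?_
    ring
  rw [e] at key
  calc ∫⁻ t, ∫⁻ s, f t * g s * fker γ (t - s)
      = (I * I⁻¹) * (J * J⁻¹) * ∫⁻ t, ∫⁻ s, f t * g s * fker γ (t - s) := by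
        rw [ENNReal.mul_inv_cancel hI0 hIt, ENNReal.mul_inv_cancel hJ0 hJt]; simp
    _ = (I * J) * ((I⁻¹ * J⁻¹) * ∫⁻ t, ∫⁻ s, f t * g s * fker γ (t - s)) := by ring
    _ ≤ (I * J) * C := by gcongr
    _ ≤ (C + 1) * (I * J) := by
        rw [mul_comm]
        gcongr
        exact le_self_add

/-! ### The bilinear Strichartz estimate -/

/-- Apply the decay bound at each pair of distinct times, then Hardy–Littlewood–Sobolev to the
spatial norms as functions of time. The identity `strP_eq` makes the time exponent equal to the
space exponent. -/
lemma exists_bilinear_strichartz {a : ℝ} (ha : 0 ≤ a) :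
    ∃ C : ℝ≥0∞, C ≠ ⊤ ∧ ∀ F G : ℝ → ℝ → ℂ,
      Measurable (fun q : ℝ × ℝ => F q.1 q.2) → Measurable (fun q : ℝ × ℝ => G q.1 q.2) →
      (∀ t, InX a (fun x => F x t)) → (∀ t, InX a (fun x => G x t)) →
      ∫⁻ t, ∫⁻ s, ‖pairQ a (t - s) (fun x => G x t) (fun x => F x s)‖ₑ ≤
        C * (spaceTimeNorm a (strP a) G * spaceTimeNorm a (strP a) F) := by
  obtain ⟨C1, hC1, H1⟩ := exists_pairQ_decay ha
  obtain ⟨C2, hC2, H2⟩ := exists_hls (strG_pos ha) (strG_lt_one ha)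
  refine ⟨C1 * C2, ENNReal.mul_ne_top hC1 hC2, fun F G hF hG hFX hGX => ?_⟩
  have hp0 : 0 < strP a := by linarith [one_lt_strP ha]
  obtain ⟨nF, hnF⟩ : ∃ n : ℝ → ℝ≥0∞,
      n = fun s => (∫⁻ x, ‖F x s‖ₑ ^ strP a ∂(omega a)) ^ (1 / strP a) := ⟨_, rfl⟩
  obtain ⟨nG, hnG⟩ : ∃ n : ℝ → ℝ≥0∞,
      n = fun s => (∫⁻ x, ‖G x s‖ₑ ^ strP a ∂(omega a)) ^ (1 / strP a) := ⟨_, rfl⟩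
  have hm : ∀ F : ℝ → ℝ → ℂ, Measurable (fun q : ℝ × ℝ => F q.1 q.2) →
      Measurable fun s => (∫⁻ x, ‖F x s‖ₑ ^ strP a ∂(omega a)) ^ (1 / strP a) := by
    intro F hF
    have : Measurable fun q : ℝ × ℝ => ‖F q.1 q.2‖ₑ ^ strP a := hF.enorm.pow_const _
    exact this.lintegral_prod_left'.pow_const _
  have hmF : Measurable nF := hnF ▸ hm F hF
  have hmG : Measurable nG := hnG ▸ hm G hG
  have hFF : ∀ F : ℝ → ℝ → ℂ, (∫⁻ t, ((∫⁻ x, ‖F x t‖ₑ ^ strP a ∂(omega a)) ^ (1 / strP a)) ^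
      strP a) ^ (1 / strP a) = spaceTimeNorm a (strP a) F := by
    intro F
    simp_rw [← ENNReal.rpow_mul, one_div_mul_cancel hp0.ne', ENNReal.rpow_one]
    rfl
  have hle : ∀ t, ∀ᵐ s : ℝ, ‖pairQ a (t - s) (fun x => G x t) (fun x => F x s)‖ₑ ≤
      C1 * (nG t * nF s * fker (strG a) (t - s)) := by
    intro t
    filter_upwards [(measure_eq_zero_iff_ae_notMem.1 (Real.volume_singleton (a := t)))] with s hs
    have hs0 : t - s ≠ 0 := by
      intro h
      exact hs (by simp; linarith)
    have hGt : Measurable fun x => G x t := hG.comp (measurable_id.prodMk measurable_const)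
    have hFs : Measurable fun x => F x s := hF.comp (measurable_id.prodMk measurable_const)
    refine (H1 (t - s) hs0 _ _ hGt (hGX t) hFs (hFX s)).trans (le_of_eq ?_)
    simp only [hnF, hnG, fker]
    ring
  have hm2 : Measurable fun q : ℝ × ℝ => nG q.1 * nF q.2 * fker (strG a) (q.1 - q.2) :=
    ((hmG.comp measurable_fst).mul (hmF.comp measurable_snd)).mul
      ((measurable_fker _).comp (measurable_fst.sub measurable_snd))
  calc ∫⁻ t, ∫⁻ s, ‖pairQ a (t - s) (fun x => G x t) (fun x => F x s)‖ₑ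
      ≤ ∫⁻ t, ∫⁻ s, C1 * (nG t * nF s * fker (strG a) (t - s)) :=
        lintegral_mono fun t => lintegral_mono_ae (hle t)
    _ = C1 * ∫⁻ t, ∫⁻ s, nG t * nF s * fker (strG a) (t - s) := by
        have hmo : Measurable fun t => ∫⁻ s, nG t * nF s * fker (strG a) (t - s) :=
          hm2.lintegral_prod_right'
        rw [← lintegral_const_mul _ hmo]
        refine lintegral_congr fun t => ?_
        have hmt : Measurable fun s => nG t * nF s * fker (strG a) (t - s) :=
          hm2.comp (measurable_const.prodMk measurable_id)
        rw [lintegral_const_mul _ hmt]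
    _ ≤ C1 * (C2 * (spaceTimeNorm a (strP a) G * spaceTimeNorm a (strP a) F)) := by
        gcongr
        refine (H2 nG nF hmG hmF).trans (le_of_eq ?_)
        rw [← strP_eq ha, hnF, hnG, hFF G, hFF F]
    _ = _ := by ring

lemma two_wexp_ge {a : ℝ} : a + 2 ≤ 2 * ((2 * wexp a : ℕ) : ℝ) := by
  have := Nat.le_ceil a
  have h0 : (0 : ℝ) ≤ ⌈a⌉₊ := by positivity
  unfold wexp
  push_cast
  linarith

/-! ### The Bessel operator on rapidly decreasing functions -/

lemma invXDeriv_congr {f g : ℝ → ℂ} (h : EqOn f g (Ioi 0)) :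
    EqOn (invXDeriv f) (invXDeriv g) (Ioi 0) := by
  intro x hx
  have : f =ᶠ[𝓝 x] g := h.eventuallyEq_of_mem (Ioi_mem_nhds hx)
  simp only [invXDeriv, this.deriv_eq]

lemma contDiffOn_invXDeriv {f : ℝ → ℂ} (hf : ContDiffOn ℝ ∞ f (Ioi 0)) :
    ContDiffOn ℝ ∞ (invXDeriv f) (Ioi 0) := by
  refine ContDiffOn.mul ?_ ?_
  · exact Complex.ofRealCLM.contDiff.comp_contDiffOn
      (contDiffOn_id.inv fun x hx => (ne_of_gt hx : x ≠ 0))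
  · exact hf.deriv_of_isOpen isOpen_Ioi (by simp)

lemma contDiffOn_invXDeriv_iterate {f : ℝ → ℂ} (hf : ContDiffOn ℝ ∞ f (Ioi 0)) (k : ℕ) :
    ContDiffOn ℝ ∞ (invXDeriv^[k] f) (Ioi 0) := by
  induction k with
  | zero => exact hf
  | succ k ih =>
    rw [Function.iterate_succ_apply']
    exact contDiffOn_invXDeriv ih

lemma hasDerivAt_of_contDiffOn {f : ℝ → ℂ} (hf : ContDiffOn ℝ ∞ f (Ioi 0)) {x : ℝ} (hx : 0 < x) :
    HasDerivAt f ((x : ℂ) * invXDeriv f x) x := by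
  have h : DifferentiableAt ℝ f x :=
    (hf.contDiffAt (Ioi_mem_nhds hx)).differentiableAt (by simp)
  convert! h.hasDerivAt using 1
  have : (x : ℂ) ≠ 0 := by exact_mod_cast hx.ne'
  simp only [invXDeriv, Complex.ofReal_inv]
  field_simp

/-- The Bessel operator in terms of `(1/x) ∂_x`. -/
def bop (a : ℝ) (f : ℝ → ℂ) (x : ℝ) : ℂ :=
  (x : ℂ) ^ 2 * invXDeriv (invXDeriv f) x + ((a : ℂ) + 1) * invXDeriv f x

lemma contDiffOn_bop (a : ℝ) {f : ℝ → ℂ} (hf : ContDiffOn ℝ ∞ f (Ioi 0)) :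
    ContDiffOn ℝ ∞ (bop a f) (Ioi 0) := by
  have h1 := contDiffOn_invXDeriv hf
  have h2 := contDiffOn_invXDeriv h1
  have hx : ContDiffOn ℝ ∞ (fun x : ℝ => (x : ℂ)) (Ioi 0) := Complex.ofRealCLM.contDiff.contDiffOn
  exact ((hx.pow 2).mul h2).add (contDiffOn_const.mul h1)

/-- The operator `(1/x) ∂_x` intertwines the Bessel operators with parameters `a` and `a + 2`.
Iterating this controls all seminorms of `bop a f` by those of `f`. -/
lemma invXDeriv_bop (a : ℝ) {f : ℝ → ℂ} (hf : ContDiffOn ℝ ∞ f (Ioi 0)) :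
    EqOn (invXDeriv (bop a f)) (bop (a + 2) (invXDeriv f)) (Ioi 0) := by
  intro x hx
  have hx0 : (x : ℂ) ≠ 0 := by exact_mod_cast (ne_of_gt hx : x ≠ 0)
  have h1 := hasDerivAt_of_contDiffOn (contDiffOn_invXDeriv hf) hx
  have h2 := hasDerivAt_of_contDiffOn (contDiffOn_invXDeriv (contDiffOn_invXDeriv hf)) hx
  have h3 : HasDerivAt (fun x : ℝ => (x : ℂ) ^ 2) (2 * (x : ℂ)) x := by
    simpa using (hasDerivAt_id x).ofReal_comp.fun_pow 2
  have h := ((h3.mul h2).add (h1.const_mul ((a : ℂ) + 1))).deriv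
  have hd : deriv (bop a f) x = _ := h
  simp only [invXDeriv] at hd ⊢
  rw [hd]
  simp only [bop, invXDeriv]
  push_cast
  field_simp
  ring

lemma invXDeriv_iterate_bop (a : ℝ) {f : ℝ → ℂ} (hf : ContDiffOn ℝ ∞ f (Ioi 0)) (k : ℕ) :
    EqOn (invXDeriv^[k] (bop a f)) (bop (a + 2 * k) (invXDeriv^[k] f)) (Ioi 0) := by
  induction k with
  | zero => simp [EqOn]
  | succ k ih =>
    rw [Function.iterate_succ_apply', Function.iterate_succ_apply']
    intro x hx
    rw [invXDeriv_congr ih hx, invXDeriv_bop _ (contDiffOn_invXDeriv_iterate hf k) hx]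
    congr 1
    push_cast
    ring

lemma invXDeriv_sub {f g : ℝ → ℂ} (hf : ContDiffOn ℝ ∞ f (Ioi 0)) (hg : ContDiffOn ℝ ∞ g (Ioi 0)) :
    EqOn (invXDeriv (fun x => f x - g x)) (fun x => invXDeriv f x - invXDeriv g x) (Ioi 0) := by
  intro x hx
  have h1 : DifferentiableAt ℝ f x :=
    (hf.contDiffAt (Ioi_mem_nhds hx)).differentiableAt (by simp)
  have h2 : DifferentiableAt ℝ g x :=
    (hg.contDiffAt (Ioi_mem_nhds hx)).differentiableAt (by simp)
  simp only [invXDeriv, deriv_fun_sub h1 h2, mul_sub]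

lemma invXDeriv_iterate_sub {f g : ℝ → ℂ} (hf : ContDiffOn ℝ ∞ f (Ioi 0))
    (hg : ContDiffOn ℝ ∞ g (Ioi 0)) (k : ℕ) :
    EqOn (invXDeriv^[k] (fun x => f x - g x)) (fun x => invXDeriv^[k] f x - invXDeriv^[k] g x)
      (Ioi 0) := by
  induction k with
  | zero => simp [EqOn]
  | succ k ih =>
    intro x hx
    simp only [Function.iterate_succ_apply']
    rw [invXDeriv_congr ih hx, invXDeriv_sub (contDiffOn_invXDeriv_iterate hf k)
      (contDiffOn_invXDeriv_iterate hg k) hx]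

/-- A family of functions in `𝒮⁺` with uniform bounds on all seminorms. -/
structure UnifSchwartz {ι : Type*} (f : ι → ℝ → ℂ) : Prop where
  smooth : ∀ i, ContDiffOn ℝ ∞ (f i) (Ioi 0)
  bounded : ∀ m k : ℕ, ∃ M : ℝ, ∀ i, ∀ x : ℝ, 0 < x → x ^ m * ‖invXDeriv^[k] (f i) x‖ ≤ M

lemma UnifSchwartz.bop {ι : Type*} {f : ι → ℝ → ℂ} (hf : UnifSchwartz f) (a : ℝ) :
    UnifSchwartz (fun i => bop a (f i)) := by
  refine ⟨fun i => contDiffOn_bop a (hf.smooth i), fun m k => ?_⟩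
  obtain ⟨M1, h1⟩ := hf.bounded (m + 2) (k + 2)
  obtain ⟨M2, h2⟩ := hf.bounded m (k + 1)
  refine ⟨M1 + |a + 2 * k + 1| * M2, fun i x hx => ?_⟩
  rw [invXDeriv_iterate_bop a (hf.smooth i) k hx]
  have h1' := h1 i x hx
  have h2' := h2 i x hx
  rw [Function.iterate_succ_apply', Function.iterate_succ_apply'] at h1'
  rw [Function.iterate_succ_apply'] at h2'
  have hn : ‖(BesselSchrodinger.bop (a + 2 * k) (invXDeriv^[k] (f i)) x)‖ ≤
      x ^ 2 * ‖invXDeriv (invXDeriv (invXDeriv^[k] (f i))) x‖ +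
        |a + 2 * k + 1| * ‖invXDeriv (invXDeriv^[k] (f i)) x‖ := by
    unfold BesselSchrodinger.bop
    refine (norm_add_le _ _).trans (le_of_eq ?_)
    rw [norm_mul, norm_mul, norm_pow, Complex.norm_real, Real.norm_of_nonneg hx.le]
    congr 2
    rw [← Complex.ofReal_one, ← Complex.ofReal_add, Complex.norm_real, Real.norm_eq_abs]
  calc _ ≤ x ^ m * (x ^ 2 * ‖invXDeriv (invXDeriv (invXDeriv^[k] (f i))) x‖ +
        |a + 2 * k + 1| * ‖invXDeriv (invXDeriv^[k] (f i)) x‖) := by gcongr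
    _ = x ^ (m + 2) * ‖invXDeriv (invXDeriv (invXDeriv^[k] (f i))) x‖ +
        |a + 2 * k + 1| * (x ^ m * ‖invXDeriv (invXDeriv^[k] (f i)) x‖) := by ring
    _ ≤ _ := by gcongr

lemma UnifSchwartz.sub {ι : Type*} {f g : ι → ℝ → ℂ} (hf : UnifSchwartz f) (hg : UnifSchwartz g) :
    UnifSchwartz (fun i x => f i x - g i x) := by
  refine ⟨fun i => (hf.smooth i).sub (hg.smooth i), fun m k => ?_⟩
  obtain ⟨M1, h1⟩ := hf.bounded m k
  obtain ⟨M2, h2⟩ := hg.bounded m k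
  refine ⟨M1 + M2, fun i x hx => ?_⟩
  rw [invXDeriv_iterate_sub (hf.smooth i) (hg.smooth i) k hx]
  calc _ ≤ x ^ m * (‖invXDeriv^[k] (f i) x‖ + ‖invXDeriv^[k] (g i) x‖) := by
        gcongr
        exact norm_sub_le _ _
    _ = x ^ m * ‖invXDeriv^[k] (f i) x‖ + x ^ m * ‖invXDeriv^[k] (g i) x‖ := by ring
    _ ≤ _ := add_le_add (h1 i x hx) (h2 i x hx)

lemma UnifSchwartz.invXDeriv {ι : Type*} {f : ι → ℝ → ℂ} (hf : UnifSchwartz f) :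
    UnifSchwartz (fun i => invXDeriv (f i)) := by
  refine ⟨fun i => contDiffOn_invXDeriv (hf.smooth i), fun m k => ?_⟩
  obtain ⟨M, h⟩ := hf.bounded m (k + 1)
  exact ⟨M, fun i x hx => by simpa only [Function.iterate_succ_apply] using h i x hx⟩

lemma UnifSchwartz.exists_decay {ι : Type*} {f : ι → ℝ → ℂ} (hf : UnifSchwartz f) (n : ℕ) :
    ∃ K : ℝ, 0 ≤ K ∧ ∀ i, ∀ x : ℝ, 0 < x → ‖f i x‖ ≤ K * ((1 + x ^ 2) ^ n)⁻¹ := by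
  obtain ⟨M1, h1⟩ := hf.bounded 0 0
  obtain ⟨M2, h2⟩ := hf.bounded (2 * n) 0
  refine ⟨2 ^ n * (|M1| + |M2|), by positivity, fun i x hx => ?_⟩
  rw [← div_eq_mul_inv, le_div_iff₀ (by positivity)]
  have h1' := (h1 i x hx).trans (le_abs_self M1)
  have h2' := (h2 i x hx).trans (le_abs_self M2)
  simp only [Function.iterate_zero, id, pow_zero, one_mul] at h1' h2'
  -- Reduces decay of order `n` to the two seminorms with weights `1` and `x ^ (2 n)`.
  have hle : (1 + x ^ 2) ^ n ≤ 2 ^ n * (1 + x ^ (2 * n)) := by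
    rcases le_total x 1 with h | h
    · have : (1 + x ^ 2) ^ n ≤ 2 ^ n := pow_le_pow_left₀ (by positivity) (by nlinarith) n
      have h0 : 0 ≤ (2 : ℝ) ^ n * x ^ (2 * n) := by positivity
      linarith
    · have : (1 + x ^ 2) ^ n ≤ (2 * x ^ 2) ^ n := pow_le_pow_left₀ (by positivity) (by nlinarith) n
      rw [mul_pow, ← pow_mul] at this
      have h0 : 0 ≤ (2 : ℝ) ^ n := by positivity
      linarith
  calc ‖f i x‖ * (1 + x ^ 2) ^ n ≤ ‖f i x‖ * (2 ^ n * (1 + x ^ (2 * n))) := by gcongr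
    _ = 2 ^ n * (‖f i x‖ + x ^ (2 * n) * ‖f i x‖) := by ring
    _ ≤ _ := by gcongr

lemma UnifSchwartz.inX {ι : Type*} {f : ι → ℝ → ℂ} (hf : UnifSchwartz f) {a : ℝ} (ha : 0 ≤ a)
    (i : ι) : InX a (f i) := by
  obtain ⟨K, -, h⟩ := hf.exists_decay (2 * wexp a)
  exact InX.of_decay ha (aestronglyMeasurable_omega_of_continuousOn (hf.smooth i).continuousOn) (h i)

lemma tendsto_rpow_mul_atTop {a K : ℝ} (ha : 0 ≤ a) {n : ℕ} (hn : a + 2 ≤ 2 * n) {h : ℝ → ℂ}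
    (hh : ∀ x : ℝ, 0 < x → ‖h x‖ ≤ K * ((1 + x ^ 2) ^ n)⁻¹) :
    Tendsto (fun x : ℝ => ((x ^ (a + 1) : ℝ) : ℂ) * h x) atTop (𝓝 0) := by
  have h0 : Tendsto (fun x : ℝ => |K| * x⁻¹) atTop (𝓝 0) := by
    simpa using (tendsto_inv_atTop_zero (𝕜 := ℝ)).const_mul |K|
  refine squeeze_zero_norm' ?_ h0
  filter_upwards [eventually_gt_atTop 0] with x hx0
  rw [norm_mul, Complex.norm_real, Real.norm_of_nonneg (by positivity)]
  have h1 : x ^ (a + 1) * x ≤ (1 + x ^ 2) ^ n := by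
    rw [← Real.rpow_add_one hx0.ne']
    exact rpow_le_one_add_sq_pow hx0 n (by linarith) (by linarith)
  have h2 : (0 : ℝ) < (1 + x ^ 2) ^ n := by positivity
  calc x ^ (a + 1) * ‖h x‖ ≤ x ^ (a + 1) * (|K| * ((1 + x ^ 2) ^ n)⁻¹) := by
        gcongr
        exact (hh x hx0).trans (by gcongr; exact le_abs_self K)
    _ = |K| * (x⁻¹ * ((x ^ (a + 1) * x) * ((1 + x ^ 2) ^ n)⁻¹)) := by field_simp
    _ ≤ |K| * (x⁻¹ * 1) := by
        gcongr
        rw [← div_eq_mul_inv]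
        exact (div_le_one h2).2 h1
    _ = _ := by ring

lemma hasDerivAt_rpow_mul_besD {a : ℝ} (ha : 0 ≤ a) (ξ : ℝ) {y : ℝ} (hy : 0 < y) :
    HasDerivAt (fun y : ℝ => y ^ a * (ξ * besD a (ξ * y))) (-ξ ^ 2 * (y ^ a * bes a (ξ * y))) y := by
  have h1 : HasDerivAt (fun y : ℝ => y ^ a) (a * y ^ (a - 1)) y :=
    Real.hasDerivAt_rpow_const (Or.inl hy.ne')
  have h2 : HasDerivAt (fun y : ℝ => ξ * y) ξ y := by
    simpa using (hasDerivAt_id y).const_mul ξ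
  have h3 := ((hasDerivAt_besD ha (ξ * y)).comp y h2).const_mul ξ
  convert! h1.mul h3 using 1
  rw [Real.rpow_sub_one hy.ne']
  simp only [besD, Function.comp]
  have : a + 1 ≠ 0 := by linarith
  field_simp
  ring

/-- The boundary term in Green's identity for the Bessel operator. -/
def greenTerm (a ξ : ℝ) (f : ℝ → ℂ) (y : ℝ) : ℂ :=
  ((y ^ (a + 1) : ℝ) : ℂ) * (invXDeriv f y * (bes a (ξ * y) : ℂ) +
    f y * ((ξ ^ 2 / (a + 1) * bes (a + 2) (ξ * y) : ℝ) : ℂ))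

/-- The Wronskian form, convenient for differentiation. The defining form instead shows the factor
`y ^ (a + 1)`, which makes the boundary value at `0` vanish. -/
lemma greenTerm_eq {a : ℝ} (ξ : ℝ) (f : ℝ → ℂ) {y : ℝ} (hy : 0 < y) :
    greenTerm a ξ f y = ((y ^ (a + 1) : ℝ) : ℂ) * (invXDeriv f y) * (bes a (ξ * y) : ℂ) -
      f y * ((y ^ a * (ξ * besD a (ξ * y)) : ℝ) : ℂ) := by
  unfold greenTerm besD
  rw [Real.rpow_add_one hy.ne']
  push_cast
  ring

lemma hasDerivAt_greenTerm {a : ℝ} (ha : 0 ≤ a) (ξ : ℝ) {f : ℝ → ℂ}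
    (hf : ContDiffOn ℝ ∞ f (Ioi 0)) {y : ℝ} (hy : 0 < y) :
    HasDerivAt (greenTerm a ξ f)
      ((y ^ a : ℝ) • ((bop a f y + (ξ : ℂ) ^ 2 * f y) * (bes a (ξ * y) : ℂ))) y := by
  have e : greenTerm a ξ f =ᶠ[𝓝 y] fun y => ((y ^ (a + 1) : ℝ) : ℂ) * (invXDeriv f y) *
      (bes a (ξ * y) : ℂ) - f y * ((y ^ a * (ξ * besD a (ξ * y)) : ℝ) : ℂ) := by
    filter_upwards [Ioi_mem_nhds hy] with z hz using greenTerm_eq ξ f hz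
  refine HasDerivAt.congr_of_eventuallyEq ?_ e
  have h1 : HasDerivAt (fun y : ℝ => ((y ^ (a + 1) : ℝ) : ℂ)) (((a + 1) * y ^ a : ℝ) : ℂ) y := by
    have := Real.hasDerivAt_rpow_const (x := y) (p := a + 1) (Or.inl hy.ne')
    simpa using this.ofReal_comp
  have h2 := hasDerivAt_of_contDiffOn (contDiffOn_invXDeriv hf) hy
  have h3 : HasDerivAt (fun y : ℝ => ξ * y) ξ y := by
    simpa using (hasDerivAt_id y).const_mul ξ
  have h4 : HasDerivAt (fun y : ℝ => (bes a (ξ * y) : ℂ)) ((besD a (ξ * y) * ξ : ℝ) : ℂ) y :=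
    ((hasDerivAt_bes ha (ξ * y)).comp y h3).ofReal_comp
  have h5 := (hasDerivAt_rpow_mul_besD ha ξ hy).ofReal_comp
  have h6 := hasDerivAt_of_contDiffOn hf hy
  convert! ((h1.mul h2).mul h4).sub (h6.mul h5) using 1
  simp only [bop, Complex.real_smul, Pi.mul_apply]
  rw [Real.rpow_add_one hy.ne']
  push_cast
  ring

/-- The integrand is the derivative of `greenTerm`, which is `y ^ (a + 1)` times a bounded, rapidly
decreasing function and hence vanishes at both ends of the half-line. -/
lemma integral_green {a : ℝ} (ha : 0 ≤ a) (ξ : ℝ) {ι : Type*} {f : ι → ℝ → ℂ}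
    (hf : UnifSchwartz f) (i : ι) :
    ∫ y, (bop a (f i) y + (ξ : ℂ) ^ 2 * f i y) * (bes a (ξ * y) : ℂ) ∂(omega a) = 0 := by
  have ha1 : 0 < a + 1 := by linarith
  obtain ⟨K1, hK1, h1⟩ := hf.exists_decay (2 * wexp a)
  obtain ⟨K2, hK2, h2⟩ := hf.invXDeriv.exists_decay (2 * wexp a)
  have hi : Integrable (fun y => (bop a (f i) y + (ξ : ℂ) ^ 2 * f i y) * (bes a (ξ * y) : ℂ))
      (omega a) :=
    integrable_mul_bes ha ((((hf.bop a).inX ha i).add ((hf.inX ha i).const_mul _)).integrable ha) ξ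
  set Q : ℝ → ℂ := fun y => invXDeriv (f i) y * (bes a (ξ * y) : ℂ) +
    f i y * ((ξ ^ 2 / (a + 1) * bes (a + 2) (ξ * y) : ℝ) : ℂ) with hQ
  have hQb : ∀ x : ℝ, 0 < x →
      ‖Q x‖ ≤ (K2 + K1 * (ξ ^ 2 / (a + 1))) * ((1 + x ^ 2) ^ (2 * wexp a))⁻¹ := by
    intro x hx
    have e1 := norm_bes_le ha (ξ * x)
    have e2 := norm_bes_le (a := a + 2) (by linarith) (ξ * x)
    have e3 : ‖((ξ ^ 2 / (a + 1) * bes (a + 2) (ξ * x) : ℝ) : ℂ)‖ ≤ ξ ^ 2 / (a + 1) := by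
      rw [Complex.ofReal_mul, norm_mul, Complex.norm_real, Real.norm_of_nonneg (by positivity)]
      exact mul_le_of_le_one_right (by positivity) e2
    calc ‖Q x‖ ≤ ‖invXDeriv (f i) x‖ * 1 + ‖f i x‖ * (ξ ^ 2 / (a + 1)) := by
          refine (norm_add_le _ _).trans ?_
          rw [norm_mul, norm_mul]
          gcongr
      _ ≤ (K2 * ((1 + x ^ 2) ^ (2 * wexp a))⁻¹) * 1 +
          (K1 * ((1 + x ^ 2) ^ (2 * wexp a))⁻¹) * (ξ ^ 2 / (a + 1)) := by
          gcongr
          · exact h2 i x hx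
          · exact h1 i x hx
      _ = _ := by ring
  set K := K2 + K1 * (ξ ^ 2 / (a + 1)) with hK
  have hK0 : 0 ≤ K := by positivity
  have hG0 : greenTerm a ξ (f i) 0 = 0 := by
    simp [greenTerm, Real.zero_rpow ha1.ne']
  have hcont : ContinuousWithinAt (greenTerm a ξ (f i)) (Ici 0) 0 := by
    rw [ContinuousWithinAt, hG0]
    have h0 : Tendsto (fun y : ℝ => K * y ^ (a + 1)) (𝓝[≥] 0) (𝓝 0) := by
      have : ContinuousAt (fun y : ℝ => K * y ^ (a + 1)) 0 :=
        continuousAt_const.mul (Real.continuousAt_rpow_const _ _ (Or.inr ha1.le))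
      have h := this.tendsto
      simp only [Real.zero_rpow ha1.ne', mul_zero] at h
      exact h.mono_left nhdsWithin_le_nhds
    refine squeeze_zero_norm' ?_ h0
    filter_upwards [self_mem_nhdsWithin] with y hy
    rcases (show (0 : ℝ) ≤ y from hy).eq_or_lt with rfl | hy
    · rw [hG0]; simp [Real.zero_rpow ha1.ne']
    · show ‖((y ^ (a + 1) : ℝ) : ℂ) * Q y‖ ≤ _
      rw [norm_mul, Complex.norm_real, Real.norm_of_nonneg (by positivity), mul_comm]
      gcongr
      refine (hQb y hy).trans (mul_le_of_le_one_right hK0 (inv_le_one_of_one_le₀ ?_))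
      exact one_le_pow₀ (by nlinarith)
  rw [integral_omega, integral_Ioi_of_hasDerivAt_of_tendsto hcont
    (fun y hy => hasDerivAt_greenTerm ha ξ (hf.smooth i) hy) (integrable_omega_iff.1 hi)
    (tendsto_rpow_mul_atTop ha two_wexp_ge hQb), hG0, sub_zero]

lemma hank_bop {a : ℝ} (ha : 0 ≤ a) {ι : Type*} {f : ι → ℝ → ℂ} (hf : UnifSchwartz f) (i : ι)
    (ξ : ℝ) : hank a (bop a (f i)) ξ = -(ξ : ℂ) ^ 2 * hank a (f i) ξ := by
  have h1 := ((hf.bop a).inX ha i).integrable ha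
  have h2 := (hf.inX ha i).integrable ha
  have h := hank_add ha h1 (h2.const_mul ((ξ : ℂ) ^ 2)) ξ
  rw [hank_const_mul] at h
  have h0 : hank a (fun x => bop a (f i) x + (ξ : ℂ) ^ 2 * f i x) ξ = 0 := by
    unfold hank
    rw [integral_green ha ξ hf i, mul_zero]
  rw [h0] at h
  linear_combination -h

lemma UnifSchwartz.exists_hank_bound {a : ℝ} (ha : 0 ≤ a) {ι : Type*} {f : ι → ℝ → ℂ}
    (hf : UnifSchwartz f) : ∃ K : ℝ, 0 ≤ K ∧ ∀ i ξ, ‖hank a (f i) ξ‖ ≤ K := by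
  obtain ⟨K, hK, h⟩ := hf.exists_decay (2 * wexp a)
  have hM := gaussMoment_pos ha
  refine ⟨(gaussMoment a)⁻¹ * ∫ x, K * ((1 + x ^ 2) ^ (2 * wexp a))⁻¹ ∂(omega a), ?_,
    fun i ξ => (norm_hank_le ha ((hf.inX ha i).integrable ha) ξ).trans ?_⟩
  · have : 0 ≤ ∫ x, K * ((1 + x ^ 2) ^ (2 * wexp a))⁻¹ ∂(omega a) :=
      integral_nonneg fun x => by positivity
    positivity
  · gcongr 1
    refine integral_mono_ae ((hf.inX ha i).integrable ha).norm
      ((integrable_inv_one_add_sq_pow ha two_wexp_ge).const_mul K) ?_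
    filter_upwards [ae_omega_pos a] with x hx using h i x hx

/-- Hankel transforms of uniformly Schwartz families decay uniformly. -/
lemma UnifSchwartz.exists_hank_decay {a : ℝ} (ha : 0 ≤ a) (n : ℕ) {ι : Type*} {f : ι → ℝ → ℂ}
    (hf : UnifSchwartz f) :
    ∃ K : ℝ, 0 ≤ K ∧ ∀ i ξ, ‖hank a (f i) ξ‖ ≤ K * ((1 + ξ ^ 2) ^ n)⁻¹ := by
  induction n generalizing f with
  | zero => simpa using hf.exists_hank_bound ha
  | succ n ih =>
    -- The transform of `f - bop a f` is `(1 + ξ²)` times that of `f`, so each induction step gains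
    -- one power of decay.
    obtain ⟨K, hK, h⟩ := ih (hf.sub (hf.bop a))
    refine ⟨K, hK, fun i ξ => ?_⟩
    have h1 := h i ξ
    rw [hank_sub ha ((hf.inX ha i).integrable ha) (((hf.bop a).inX ha i).integrable ha),
      hank_bop ha hf, show hank a (f i) ξ - -(ξ : ℂ) ^ 2 * hank a (f i) ξ =
        ((1 + ξ ^ 2 : ℝ) : ℂ) * hank a (f i) ξ by push_cast; ring, norm_mul, Complex.norm_real,
      Real.norm_of_nonneg (by positivity)] at h1
    have h2 : (0 : ℝ) < 1 + ξ ^ 2 := by positivity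
    calc ‖hank a (f i) ξ‖ = ((1 + ξ ^ 2) * ‖hank a (f i) ξ‖) * (1 + ξ ^ 2)⁻¹ := by field_simp
      _ ≤ (K * ((1 + ξ ^ 2) ^ n)⁻¹) * (1 + ξ ^ 2)⁻¹ := by gcongr
      _ = _ := by rw [pow_succ (1 + ξ ^ 2) n, mul_inv, mul_assoc]

/-! ### Inversion -/

/-- Symmetry used twice transfers inversion from Gaussians to `f`: both functions have the same
integral against every Gaussian, so they agree almost everywhere, and continuity gives every `x >
0`. -/
lemma hank_hank {a : ℝ} (ha : 0 ≤ a) {f : ℝ → ℂ} (hf : Integrable f (omega a))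
    (hc : ContinuousOn f (Ioi 0)) (hh : Integrable (hank a f) (omega a)) {x : ℝ} (hx : 0 < x) :
    hank a (hank a f) x = f x := by
  have hbdd : ∀ z : ℂ, 0 < z.re → ∀ x, ‖gau z x‖ ≤ 1 := by
    intro z hz x
    rw [norm_gau, Real.exp_le_one_iff]
    nlinarith [mul_nonneg hz.le (sq_nonneg x)]
  have hhc := continuous_hank ha hh
  have hi1 : ∀ z : ℂ, 0 < z.re → Integrable (fun x => hank a (hank a f) x * gau z x) (omega a) :=
    fun z hz => ((inX_gau ha hz).integrable ha).bdd_mul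
      (c := (gaussMoment a)⁻¹ * ∫ y, ‖hank a f y‖ ∂(omega a)) hhc.aestronglyMeasurable
      (Eventually.of_forall fun x => norm_hank_le ha hh x)
  have hi2 : ∀ z : ℂ, 0 < z.re → Integrable (fun x => f x * gau z x) (omega a) :=
    fun z hz => hf.mul_bdd (c := 1) (continuous_gau z).aestronglyMeasurable
      (Eventually.of_forall fun x => hbdd z hz x)
  have key : (fun x => hank a (hank a f) x - f x) =ᵐ[omega a] 0 := by
    refine ae_eq_zero_of_integral_gau ?_ fun z hz => ?_
    · simp_rw [sub_mul]
      exact (hi1 1 (by simp)).sub (hi2 1 (by simp))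
    · simp_rw [sub_mul]
      have hg := gau_mem_gauSpan hz
      rw [integral_sub (hi1 z hz) (hi2 z hz), integral_hank_mul ha hh (gauSpan_integrable ha hg),
        integral_hank_mul ha hf (gauSpan_integrable ha (hank_mem_gauSpan ha hg)),
        hank_hank_gauSpan ha hg, sub_self]
  have h2 : hank a (hank a f) =ᵐ[volume.restrict (Ioi 0)] f := by
    have := ae_omega_iff.1 key
    filter_upwards [this] with y hy
    exact sub_eq_zero.1 hy
  exact Measure.eqOn_open_of_ae_eq h2 isOpen_Ioi hhc.continuousOn hc hx

/-! ### Differentiating Hankel transforms of rapidly decreasing functions -/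

/-- Continuous functions decaying faster than any power. -/
structure Rapid (v : ℝ → ℂ) : Prop where
  cont : Continuous v
  decay : ∀ n : ℕ, ∃ K : ℝ, 0 ≤ K ∧ ∀ ξ, ‖v ξ‖ ≤ K * ((1 + ξ ^ 2) ^ n)⁻¹

lemma Rapid.inX {v : ℝ → ℂ} (hv : Rapid v) {a : ℝ} (ha : 0 ≤ a) : InX a v := by
  obtain ⟨K, -, h⟩ := hv.decay (2 * wexp a)
  exact InX.of_decay ha hv.cont.aestronglyMeasurable fun x _ => h x

lemma Rapid.integrable {v : ℝ → ℂ} (hv : Rapid v) {a : ℝ} (ha : 0 ≤ a) :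
    Integrable v (omega a) := (hv.inX ha).integrable ha

lemma Rapid.add {v w : ℝ → ℂ} (hv : Rapid v) (hw : Rapid w) : Rapid fun ξ => v ξ + w ξ := by
  refine ⟨hv.cont.add hw.cont, fun n => ?_⟩
  obtain ⟨K, hK, h⟩ := hv.decay n
  obtain ⟨K', hK', h'⟩ := hw.decay n
  refine ⟨K + K', by positivity, fun ξ => (norm_add_le _ _).trans ?_⟩
  rw [add_mul]
  exact add_le_add (h ξ) (h' ξ)

lemma Rapid.const_mul {v : ℝ → ℂ} (hv : Rapid v) (c : ℂ) : Rapid fun ξ => c * v ξ := by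
  refine ⟨continuous_const.mul hv.cont, fun n => ?_⟩
  obtain ⟨K, hK, h⟩ := hv.decay n
  refine ⟨‖c‖ * K, by positivity, fun ξ => ?_⟩
  rw [norm_mul, mul_assoc]
  gcongr
  exact h ξ

lemma Rapid.sub {v w : ℝ → ℂ} (hv : Rapid v) (hw : Rapid w) : Rapid fun ξ => v ξ - w ξ := by
  simpa [sub_eq_add_neg] using hv.add (hw.const_mul (-1))

lemma abs_le_one_add_sq (ξ : ℝ) : |ξ| ≤ 1 + ξ ^ 2 := by
  nlinarith [sq_abs ξ, sq_nonneg (|ξ| - 1)]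

lemma Rapid.pow_mul {v : ℝ → ℂ} (hv : Rapid v) (m : ℕ) : Rapid fun ξ => (ξ : ℂ) ^ m * v ξ := by
  refine ⟨by have := hv.cont; fun_prop, fun n => ?_⟩
  obtain ⟨K, hK, h⟩ := hv.decay (n + m)
  refine ⟨K, hK, fun ξ => ?_⟩
  have h2 : (0 : ℝ) < (1 + ξ ^ 2) ^ m := by positivity
  rw [norm_mul, norm_pow, Complex.norm_real, Real.norm_eq_abs]
  calc |ξ| ^ m * ‖v ξ‖ ≤ (1 + ξ ^ 2) ^ m * (K * ((1 + ξ ^ 2) ^ (n + m))⁻¹) := by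
        gcongr
        · exact abs_le_one_add_sq ξ
        · exact h ξ
    _ = K * ((1 + ξ ^ 2) ^ n)⁻¹ := by
        rw [pow_add (1 + ξ ^ 2) n m]
        field_simp

/-- The derivative of the Hankel transform. -/
def hankD (a : ℝ) (v : ℝ → ℂ) (x : ℝ) : ℂ :=
  ((gaussMoment a)⁻¹ : ℝ) * ∫ ξ, ((ξ : ℂ) * v ξ) * (besD a (x * ξ) : ℂ) ∂(omega a)

/-- The second derivative of the Hankel transform. -/
def hankDD (a : ℝ) (v : ℝ → ℂ) (x : ℝ) : ℂ :=
  ((gaussMoment a)⁻¹ : ℝ) * ∫ ξ, ((ξ : ℂ) ^ 2 * v ξ) *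
    ((a / (a + 1) * bes (a + 2) (x * ξ) - bes a (x * ξ) : ℝ) : ℂ) ∂(omega a)

lemma continuous_besD {a : ℝ} (ha : 0 ≤ a) : Continuous (besD a) :=
  continuous_iff_continuousAt.2 fun x => (hasDerivAt_besD ha x).continuousAt

/-- A single differentiation under the integral serves both the transform and its derivative. The
linear growth allowed for `j` and `j'` is what `besD` needs, and rapid decay of `w` absorbs it. -/
lemma hasDerivAt_integral_mul_scaled {a : ℝ} {w : ℝ → ℂ} {j j' : ℝ → ℝ}
    (hj : ∀ x, HasDerivAt j (j' x) x) (hj' : Continuous j') {c : ℝ}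
    (hb : ∀ x, |j x| ≤ c * (1 + |x|)) (hb' : ∀ x, |j' x| ≤ c * (1 + |x|))
    (hw : Rapid w) (ha : 0 ≤ a) (x : ℝ) :
    HasDerivAt (fun x => ∫ ξ, w ξ * (j (x * ξ) : ℂ) ∂(omega a))
      (∫ ξ, ((ξ : ℂ) * w ξ) * (j' (x * ξ) : ℂ) ∂(omega a)) x := by
  have hjc : Continuous j := continuous_iff_continuousAt.2 fun x => (hj x).continuousAt
  have hc : 0 ≤ c := by
    have := (abs_nonneg _).trans (hb 0)
    simpa using this
  have hwc := hw.cont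
  have hrw : Rapid fun ξ => (ξ : ℂ) ^ 1 * w ξ := hw.pow_mul 1
  have hrw2 : Rapid fun ξ => (ξ : ℂ) ^ 2 * w ξ := hw.pow_mul 2
  refine (hasDerivAt_integral_of_dominated_loc_of_deriv_le
    (F := fun (x ξ : ℝ) => w ξ * (j (x * ξ) : ℂ)) (F' := fun (x ξ : ℝ) => ((ξ : ℂ) * w ξ) * (j' (x * ξ) : ℂ))
    (bound := fun ξ : ℝ => c * ‖(ξ : ℂ) ^ 1 * w ξ‖ + c * (|x| + 1) * ‖(ξ : ℂ) ^ 2 * w ξ‖)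
    (Metric.ball_mem_nhds x one_pos) ?_ ?_ ?_ ?_ ?_ ?_).2
  · exact Eventually.of_forall fun y => Continuous.aestronglyMeasurable (by fun_prop)
  · refine Integrable.mono' (g := fun ξ : ℝ => c * ‖w ξ‖ + c * |x| * ‖(ξ : ℂ) ^ 1 * w ξ‖)
      (((hw.integrable ha).norm.const_mul _).add ((hrw.integrable ha).norm.const_mul _))
      (Continuous.aestronglyMeasurable (by fun_prop)) (Eventually.of_forall fun ξ => ?_)
    rw [norm_mul, Complex.norm_real, Real.norm_eq_abs, norm_mul, norm_pow, Complex.norm_real,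
      Real.norm_eq_abs]
    calc ‖w ξ‖ * |j (x * ξ)| ≤ ‖w ξ‖ * (c * (1 + |x * ξ|)) := by gcongr; exact hb _
      _ = _ := by rw [abs_mul]; ring
  · exact Continuous.aestronglyMeasurable (by fun_prop)
  · refine Eventually.of_forall fun ξ y hy => ?_
    have hy' : |y| ≤ |x| + 1 := by
      have h1 : |y - x| < 1 := by simpa [Real.dist_eq] using hy
      have h2 := abs_sub_abs_le_abs_sub y x
      linarith
    rw [norm_mul, norm_mul, norm_mul, norm_mul, norm_pow, norm_pow, Complex.norm_real,
      Complex.norm_real, Real.norm_eq_abs, Real.norm_eq_abs]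
    calc |ξ| * ‖w ξ‖ * |j' (y * ξ)| ≤ |ξ| * ‖w ξ‖ * (c * (1 + (|x| + 1) * |ξ|)) := by
          gcongr
          refine (hb' _).trans ?_
          rw [abs_mul]
          gcongr
      _ = _ := by ring
  · exact ((hrw.integrable ha).norm.const_mul _).add ((hrw2.integrable ha).norm.const_mul _)
  · refine Eventually.of_forall fun ξ y _ => ?_
    have h1 : HasDerivAt (fun y : ℝ => y * ξ) ξ y := by
      simpa using (hasDerivAt_id y).mul_const ξ
    have h2 := (((hj (y * ξ)).comp y h1).ofReal_comp).const_mul (w ξ)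
    convert! h2 using 1
    push_cast
    ring

lemma hasDerivAt_hank {a : ℝ} (ha : 0 ≤ a) {v : ℝ → ℂ} (hv : Rapid v) (x : ℝ) :
    HasDerivAt (hank a v) (hankD a v x) x := by
  refine (hasDerivAt_integral_mul_scaled (j := bes a) (j' := besD a) (c := 1)
    (hasDerivAt_bes ha) (continuous_besD ha) (fun x => ?_) (fun x => ?_) hv ha x).const_mul _
  · linarith [abs_bes_le ha x, abs_nonneg x]
  · linarith [abs_besD_le ha x]

lemma hasDerivAt_hankD {a : ℝ} (ha : 0 ≤ a) {v : ℝ → ℂ} (hv : Rapid v) (x : ℝ) :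
    HasDerivAt (hankD a v) (hankDD a v x) x := by
  have h1 : Rapid fun ξ => (ξ : ℂ) * v ξ := by simpa using hv.pow_mul 1
  have hc : Continuous fun x => a / (a + 1) * bes (a + 2) x - bes a x :=
    (continuous_const.mul (continuous_bes (by linarith))).sub (continuous_bes ha)
  have h2 := (hasDerivAt_integral_mul_scaled (j := besD a)
    (j' := fun x => a / (a + 1) * bes (a + 2) x - bes a x) (c := 2)
    (hasDerivAt_besD ha) hc (fun x => ?_) (fun x => ?_) h1 ha x).const_mul
      (((gaussMoment a)⁻¹ : ℝ) : ℂ)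
  · convert! h2 using 1
    unfold hankDD
    congr 2
    ext ξ
    ring
  · linarith [abs_besD_le ha x, abs_nonneg x]
  · linarith [abs_besD_deriv_le ha x, abs_nonneg x]

lemma continuous_hankDD {a : ℝ} (ha : 0 ≤ a) {v : ℝ → ℂ} (hv : Rapid v) :
    Continuous (hankDD a v) := by
  have h1 := hv.pow_mul 2
  have hc1 := continuous_bes ha
  have hc2 := continuous_bes (a := a + 2) (by linarith)
  have hvc := hv.cont
  refine continuous_const.mul (continuous_of_dominated
    (bound := fun ξ => ‖(ξ : ℂ) ^ 2 * v ξ‖ * 2) (fun x => ?_) (fun x => ?_)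
    ((h1.integrable ha).norm.mul_const 2) (Eventually.of_forall fun ξ => ?_))
  · exact Continuous.aestronglyMeasurable (by fun_prop)
  · refine Eventually.of_forall fun ξ => ?_
    rw [norm_mul, Complex.norm_real, Real.norm_eq_abs]
    gcongr
    exact abs_besD_deriv_le ha _
  · fun_prop

lemma deriv_hank {a : ℝ} (ha : 0 ≤ a) {v : ℝ → ℂ} (hv : Rapid v) : deriv (hank a v) = hankD a v :=
  funext fun x => (hasDerivAt_hank ha hv x).deriv

lemma deriv_hankD {a : ℝ} (ha : 0 ≤ a) {v : ℝ → ℂ} (hv : Rapid v) :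
    deriv (hankD a v) = hankDD a v :=
  funext fun x => (hasDerivAt_hankD ha hv x).deriv

lemma contDiff_hank {a : ℝ} (ha : 0 ≤ a) {v : ℝ → ℂ} (hv : Rapid v) :
    ContDiff ℝ 2 (hank a v) := by
  rw [show (2 : WithTop ℕ∞) = 1 + 1 by norm_num, contDiff_succ_iff_deriv]
  refine ⟨fun x => (hasDerivAt_hank ha hv x).differentiableAt, by simp, ?_⟩
  rw [deriv_hank ha hv, contDiff_one_iff_deriv, deriv_hankD ha hv]
  exact ⟨fun x => (hasDerivAt_hankD ha hv x).differentiableAt, continuous_hankDD ha hv⟩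

lemma integrable_bdd_kernel {a : ℝ} (ha : 0 ≤ a) {w : ℝ → ℂ} (hw : Rapid w) {j : ℝ → ℝ}
    (hj : Continuous j) {c : ℝ} (hb : ∀ x, |j x| ≤ c) (x : ℝ) :
    Integrable (fun ξ => w ξ * (j (x * ξ) : ℂ)) (omega a) :=
  (hw.integrable ha).mul_bdd (c := c) (Continuous.aestronglyMeasurable (by fun_prop))
    (Eventually.of_forall fun ξ => by
      rw [Complex.norm_real, Real.norm_eq_abs]; exact hb _)

/-- The singular term `(a / x) ξ besD a (x ξ)` equals `-(a / (a + 1)) ξ² bes (a + 2) (x ξ)`. It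
cancels the corresponding part of the second derivative and leaves `-ξ² bes a (x ξ)`. -/
lemma besselOp_hank {a : ℝ} (ha : 0 ≤ a) {v : ℝ → ℂ} (hv : Rapid v) {x : ℝ} (hx : 0 < x) :
    besselOp a (hank a v) x = -hank a (fun ξ => (ξ : ℂ) ^ 2 * v ξ) x := by
  unfold besselOp
  rw [deriv_hank ha hv, deriv_hankD ha hv]
  unfold hankDD hankD hank
  have h2 := hv.pow_mul 2
  have hc : Continuous fun x => a / (a + 1) * bes (a + 2) x - bes a x :=
    (continuous_const.mul (continuous_bes (by linarith))).sub (continuous_bes ha)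
  have e : ∀ ξ : ℝ, ((a / x : ℝ) : ℂ) * (((ξ : ℂ) * v ξ) * (besD a (x * ξ) : ℂ)) =
      -(((ξ : ℂ) ^ 2 * v ξ) * (bes a (x * ξ) : ℂ)) -
        ((ξ : ℂ) ^ 2 * v ξ) * ((a / (a + 1) * bes (a + 2) (x * ξ) - bes a (x * ξ) : ℝ) : ℂ) := by
    intro ξ
    have h1 : (x : ℂ) ≠ 0 := by exact_mod_cast hx.ne'
    have h3 : (a : ℂ) + 1 ≠ 0 := by
      have : a + 1 ≠ 0 := by linarith
      exact_mod_cast this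
    simp only [besD]
    push_cast
    field_simp
    ring
  rw [mul_left_comm, ← mul_add, ← integral_const_mul]
  simp_rw [e]
  have hi : Integrable (fun ξ : ℝ => -(((ξ : ℂ) ^ 2 * v ξ) * (bes a (x * ξ) : ℂ))) (omega a) :=
    (integrable_mul_bes ha (h2.integrable ha) x).neg
  rw [integral_sub hi
    (integrable_bdd_kernel ha h2 hc (abs_besD_deriv_le ha) x), integral_neg]
  ring

/-- The derivative itself tends to zero at the origin, because `besD a 0 = 0`, and `x ^ a ≤ 1` near
`0`. This also covers `a = 0`, where the power gives no help. -/
lemma tendsto_rpow_mul_deriv_hank {a : ℝ} (ha : 0 ≤ a) {v : ℝ → ℂ} (hv : Rapid v) :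
    Tendsto (fun x : ℝ => ((x ^ a : ℝ) : ℂ) * deriv (hank a v) x) (𝓝[>] 0) (𝓝 0) := by
  rw [deriv_hank ha hv]
  have h0 : hankD a v 0 = 0 := by simp [hankD, besD]
  have h1 : Tendsto (fun x => ‖hankD a v x‖) (𝓝[>] 0) (𝓝 0) := by
    have := ((hasDerivAt_hankD ha hv 0).continuousAt.norm).tendsto
    rw [h0, norm_zero] at this
    exact this.mono_left nhdsWithin_le_nhds
  refine squeeze_zero_norm' ?_ h1
  filter_upwards [self_mem_nhdsWithin, mem_nhdsWithin_of_mem_nhds (Iio_mem_nhds one_pos)] with x hx hx1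
  have hx' : 0 < x := hx
  rw [norm_mul, Complex.norm_real, Real.norm_of_nonneg (by positivity)]
  exact mul_le_of_le_one_left (norm_nonneg _) (Real.rpow_le_one hx'.le (le_of_lt hx1) ha)

/-! ### The Duhamel formula on the frequency side -/

/-- Frequency-side data: an initial datum and a forcing term with uniform rapid decay. -/
structure FreqData (f : ℝ → ℂ) (g : ℝ → ℝ → ℂ) : Prop where
  rapid : Rapid f
  cont : Continuous fun p : ℝ × ℝ => g p.1 p.2
  decay : ∀ n : ℕ, ∃ K : ℝ, 0 ≤ K ∧ ∀ s ξ, ‖g s ξ‖ ≤ K * ((1 + ξ ^ 2) ^ n)⁻¹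

/-- The Duhamel formula. -/
def duhamel (f : ℝ → ℂ) (g : ℝ → ℝ → ℂ) (t ξ : ℝ) : ℂ :=
  chirp t ξ * (f ξ + ∫ s in (0 : ℝ)..t, chirp (-s) ξ * g s ξ)

/-- The time derivative of the Duhamel formula. -/
def duhamelD (f : ℝ → ℂ) (g : ℝ → ℝ → ℂ) (t ξ : ℝ) : ℂ :=
  -Complex.I * ((ξ : ℂ) ^ 2 * duhamel f g t ξ) + g t ξ

lemma FreqData.rapid_slice {f : ℝ → ℂ} {g : ℝ → ℝ → ℂ} (h : FreqData f g) (s : ℝ) :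
    Rapid (g s) := by
  refine ⟨h.cont.comp (continuous_const.prodMk continuous_id), fun n => ?_⟩
  obtain ⟨K, hK, hb⟩ := h.decay n
  exact ⟨K, hK, fun ξ => hb s ξ⟩

lemma continuous_chirp_neg_mul {g : ℝ → ℝ → ℂ} (hg : Continuous fun p : ℝ × ℝ => g p.1 p.2) :
    Continuous fun p : ℝ × ℝ => chirp (-p.1) p.2 * g p.1 p.2 :=
  (continuous_chirp.comp (continuous_fst.neg.prodMk continuous_snd)).mul hg

lemma FreqData.continuous_duhamel {f : ℝ → ℂ} {g : ℝ → ℝ → ℂ} (h : FreqData f g) :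
    Continuous fun p : ℝ × ℝ => duhamel f g p.1 p.2 := by
  unfold duhamel
  refine continuous_chirp.mul ((h.rapid.cont.comp continuous_snd).add ?_)
  refine intervalIntegral.continuous_parametric_intervalIntegral_of_continuous
    (f := fun (p : ℝ × ℝ) s => chirp (-s) p.2 * g s p.2) ?_ continuous_fst
  have hp : Continuous fun q : (ℝ × ℝ) × ℝ => (q.2, q.1.2) := by fun_prop
  simpa only [Function.comp_def, Function.uncurry_def] using
    (continuous_chirp_neg_mul h.cont).comp hp

lemma FreqData.exists_duhamel_decay {f : ℝ → ℂ} {g : ℝ → ℝ → ℂ} (h : FreqData f g) (n : ℕ) :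
    ∃ K : ℝ, 0 ≤ K ∧ ∀ t ξ, ‖duhamel f g t ξ‖ ≤ K * (1 + |t|) * ((1 + ξ ^ 2) ^ n)⁻¹ := by
  obtain ⟨K0, hK0, h0⟩ := h.rapid.decay n
  obtain ⟨K1, hK1, h1⟩ := h.decay n
  refine ⟨K0 + K1, by positivity, fun t ξ => ?_⟩
  have hw : 0 ≤ ((1 + ξ ^ 2) ^ n)⁻¹ := by positivity
  have hi : ‖∫ s in (0 : ℝ)..t, chirp (-s) ξ * g s ξ‖ ≤ K1 * ((1 + ξ ^ 2) ^ n)⁻¹ * |t - 0| := by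
    refine intervalIntegral.norm_integral_le_of_norm_le_const fun s _ => ?_
    rw [norm_mul, norm_chirp, one_mul]
    exact h1 s ξ
  unfold duhamel
  rw [norm_mul, norm_chirp, one_mul]
  refine (norm_add_le _ _).trans ((add_le_add (h0 ξ) hi).trans ?_)
  rw [sub_zero]
  have e1 : 0 ≤ K0 * |t| * ((1 + ξ ^ 2) ^ n)⁻¹ := by positivity
  have e2 : 0 ≤ K1 * ((1 + ξ ^ 2) ^ n)⁻¹ := by positivity
  nlinarith

lemma FreqData.rapid_duhamel {f : ℝ → ℂ} {g : ℝ → ℝ → ℂ} (h : FreqData f g) (t : ℝ) :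
    Rapid (duhamel f g t) := by
  have hc : Continuous (duhamel f g t) := by
    have hp : Continuous fun ξ : ℝ => (t, ξ) := by fun_prop
    simpa only [Function.comp_def] using h.continuous_duhamel.comp hp
  refine ⟨hc, fun n => ?_⟩
  obtain ⟨K, hK, hb⟩ := h.exists_duhamel_decay n
  exact ⟨K * (1 + |t|), by positivity, fun ξ => hb t ξ⟩

lemma FreqData.rapid_duhamelD {f : ℝ → ℂ} {g : ℝ → ℝ → ℂ} (h : FreqData f g) (t : ℝ) :
    Rapid (duhamelD f g t) :=
  (((h.rapid_duhamel t).pow_mul 2).const_mul _).add (h.rapid_slice t)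

lemma hasDerivAt_chirp (t ξ : ℝ) :
    HasDerivAt (fun t => chirp t ξ) (-Complex.I * (ξ : ℂ) ^ 2 * chirp t ξ) t := by
  unfold chirp gau
  have h1 : HasDerivAt (fun t : ℝ => 2 * (t : ℂ) * Complex.I * ((-(ξ ^ 2) / 2 : ℝ) : ℂ))
      (2 * 1 * Complex.I * ((-(ξ ^ 2) / 2 : ℝ) : ℂ)) t :=
    (((hasDerivAt_id t).ofReal_comp.const_mul 2).mul_const _).mul_const _
  convert! h1.cexp using 1
  push_cast
  ring

lemma FreqData.hasDerivAt_duhamel {f : ℝ → ℂ} {g : ℝ → ℝ → ℂ} (h : FreqData f g) (t ξ : ℝ) :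
    HasDerivAt (fun t => duhamel f g t ξ) (duhamelD f g t ξ) t := by
  have hc : Continuous fun s => chirp (-s) ξ * g s ξ := by
    have hp : Continuous fun s : ℝ => (s, ξ) := by fun_prop
    simpa only [Function.comp_def] using (continuous_chirp_neg_mul h.cont).comp hp
  have h1 : HasDerivAt (fun t => f ξ + ∫ s in (0 : ℝ)..t, chirp (-s) ξ * g s ξ)
      (chirp (-t) ξ * g t ξ) t :=
    (intervalIntegral.integral_hasDerivAt_right (hc.intervalIntegrable _ _)
      (hc.stronglyMeasurableAtFilter _ _) hc.continuousAt).const_add _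
  convert! (hasDerivAt_chirp t ξ).mul h1 using 1
  unfold duhamelD duhamel
  have h2 : chirp t ξ * chirp (-t) ξ = 1 := by rw [← chirp_add, add_neg_cancel, chirp_zero]
  linear_combination (-g t ξ) * h2

lemma FreqData.exists_duhamelD_decay {f : ℝ → ℂ} {g : ℝ → ℝ → ℂ} (h : FreqData f g) (n : ℕ) :
    ∃ K : ℝ, 0 ≤ K ∧ ∀ t ξ, ‖duhamelD f g t ξ‖ ≤ K * (1 + |t|) * ((1 + ξ ^ 2) ^ n)⁻¹ := by
  obtain ⟨K0, hK0, h0⟩ := h.exists_duhamel_decay (n + 1)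
  obtain ⟨K1, hK1, h1⟩ := h.decay n
  refine ⟨K0 + K1, by positivity, fun t ξ => ?_⟩
  unfold duhamelD
  refine (norm_add_le _ _).trans ?_
  rw [norm_mul, norm_neg, Complex.norm_I, one_mul, norm_mul, norm_pow, Complex.norm_real,
    Real.norm_eq_abs, sq_abs]
  have e1 : ξ ^ 2 * ‖duhamel f g t ξ‖ ≤ K0 * (1 + |t|) * ((1 + ξ ^ 2) ^ n)⁻¹ := by
    have hp : (0 : ℝ) < (1 + ξ ^ 2) ^ n := by positivity
    calc ξ ^ 2 * ‖duhamel f g t ξ‖ ≤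
          (1 + ξ ^ 2) * (K0 * (1 + |t|) * ((1 + ξ ^ 2) ^ (n + 1))⁻¹) := by
          gcongr
          · linarith
          · exact h0 t ξ
      _ = _ := by
          rw [pow_succ (1 + ξ ^ 2) n]
          field_simp
  have e2 : 0 ≤ K1 * |t| * ((1 + ξ ^ 2) ^ n)⁻¹ := by positivity
  have e3 := h1 t ξ
  linarith

lemma abs_le_of_mem_ball {t s : ℝ} (hs : s ∈ Metric.ball t 1) : |s| ≤ |t| + 1 := by
  have h1 : |s - t| < 1 := by simpa [Real.dist_eq] using hs
  have h2 := abs_sub_abs_le_abs_sub s t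
  linarith

/-! ### The solution -/

lemma FreqData.hasDerivAt_hank_duhamel {a : ℝ} (ha : 0 ≤ a) {f : ℝ → ℂ} {g : ℝ → ℝ → ℂ}
    (h : FreqData f g) (x t : ℝ) :
    HasDerivAt (fun t => hank a (duhamel f g t) x) (hank a (duhamelD f g t) x) t := by
  obtain ⟨K, hK, hb⟩ := h.exists_duhamelD_decay (2 * wexp a)
  refine ((hasDerivAt_integral_of_dominated_loc_of_deriv_le
    (F := fun t ξ => duhamel f g t ξ * (bes a (x * ξ) : ℂ))
    (F' := fun t ξ => duhamelD f g t ξ * (bes a (x * ξ) : ℂ))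
    (bound := fun ξ => K * (1 + (|t| + 1)) * ((1 + ξ ^ 2) ^ (2 * wexp a))⁻¹)
    (Metric.ball_mem_nhds t one_pos) ?_ ?_ ?_ ?_ ?_ ?_).2).const_mul _
  · exact Eventually.of_forall fun s =>
      (integrable_mul_bes ha ((h.rapid_duhamel s).integrable ha) x).1
  · exact integrable_mul_bes ha ((h.rapid_duhamel t).integrable ha) x
  · exact (integrable_mul_bes ha ((h.rapid_duhamelD t).integrable ha) x).1
  · refine Eventually.of_forall fun ξ s hs => ?_
    rw [norm_mul]
    refine (mul_le_of_le_one_right (norm_nonneg _) (norm_bes_le ha _)).trans ((hb s ξ).trans ?_)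
    gcongr
    exact abs_le_of_mem_ball hs
  · exact (integrable_inv_one_add_sq_pow ha two_wexp_ge).const_mul _
  · exact Eventually.of_forall fun ξ s _ => (h.hasDerivAt_duhamel s ξ).mul_const _

/-- The difference quotient error of the Duhamel formula. -/
def duhamelErr (f : ℝ → ℂ) (g : ℝ → ℝ → ℂ) (t h ξ : ℝ) : ℂ :=
  ((h⁻¹ : ℝ) : ℂ) * (duhamel f g (t + h) ξ - duhamel f g t ξ) - duhamelD f g t ξ

lemma FreqData.rapid_duhamelErr {f : ℝ → ℂ} {g : ℝ → ℝ → ℂ} (h : FreqData f g) (t r : ℝ) :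
    Rapid (duhamelErr f g t r) :=
  (((h.rapid_duhamel _).sub (h.rapid_duhamel t)).const_mul _).sub (h.rapid_duhamelD t)

/-- The mean value inequality bounds the difference quotient by the same `B` as the derivative. The
resulting majorant does not depend on the increment. -/
lemma FreqData.norm_duhamelErr_le {f : ℝ → ℂ} {g : ℝ → ℝ → ℂ} (hd : FreqData f g) {t ξ B : ℝ}
    (hB : ∀ s ∈ Metric.ball t 1, ‖duhamelD f g s ξ‖ ≤ B) {h : ℝ} (h0 : h ≠ 0) (h1 : |h| < 1) :
    ‖duhamelErr f g t h ξ‖ ≤ 2 * B := by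
  have ht : t ∈ Metric.ball t 1 := Metric.mem_ball_self one_pos
  have hth : t + h ∈ Metric.ball t 1 := by simpa [Real.dist_eq] using h1
  have hmv := (convex_ball t 1).norm_image_sub_le_of_norm_hasDerivWithin_le
    (fun s hs => (hd.hasDerivAt_duhamel s ξ).hasDerivWithinAt) hB ht hth
  rw [add_sub_cancel_left, Real.norm_eq_abs] at hmv
  have hh : 0 < |h| := abs_pos.2 h0
  unfold duhamelErr
  refine (norm_sub_le _ _).trans ?_
  rw [norm_mul, Complex.norm_real, Real.norm_eq_abs, abs_inv]
  have : |h|⁻¹ * ‖duhamel f g (t + h) ξ - duhamel f g t ξ‖ ≤ B := by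
    rw [inv_mul_le_iff₀ hh, mul_comm]
    exact hmv
  linarith [hB t ht]

lemma FreqData.tendsto_duhamelErr {f : ℝ → ℂ} {g : ℝ → ℝ → ℂ} (hd : FreqData f g) (t ξ : ℝ) :
    Tendsto (fun h => duhamelErr f g t h ξ) (𝓝[≠] 0) (𝓝 0) := by
  have := (hasDerivAt_iff_tendsto_slope_zero.1 (hd.hasDerivAt_duhamel t ξ)).sub_const
    (duhamelD f g t ξ)
  rw [sub_self] at this
  refine this.congr fun h => ?_
  simp only [duhamelErr, Complex.real_smul]

/-- Dominated convergence on the frequency side, with the rapidly decreasing majorant from the mean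
value inequality. The `L²` bound of the transform later carries it to physical space. -/
lemma FreqData.tendsto_eLpNorm_duhamelErr {a : ℝ} (ha : 0 ≤ a) {f : ℝ → ℂ} {g : ℝ → ℝ → ℂ}
    (hd : FreqData f g) (t : ℝ) :
    Tendsto (fun h => eLpNorm (duhamelErr f g t h) 2 (omega a)) (𝓝[≠] 0) (𝓝 0) := by
  obtain ⟨K, hK, hb⟩ := hd.exists_duhamelD_decay (2 * wexp a)
  set B : ℝ → ℝ := fun ξ => K * (1 + (|t| + 1)) * ((1 + ξ ^ 2) ^ (2 * wexp a))⁻¹ with hBdef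
  have hB0 : ∀ ξ, 0 ≤ B ξ := fun ξ => by simp only [hBdef]; positivity
  have hBc : Continuous B := by
    refine continuous_const.mul (Continuous.inv₀ (by fun_prop) fun ξ => ?_)
    positivity
  have hBb : ∀ ξ, ∀ s ∈ Metric.ball t 1, ‖duhamelD f g s ξ‖ ≤ B ξ := by
    intro ξ s hs
    refine (hb s ξ).trans ?_
    simp only [hBdef]
    gcongr
    exact abs_le_of_mem_ball hs
  have hBX : InX a (fun ξ => ((2 * B ξ : ℝ) : ℂ)) := by
    refine InX.of_decay ha (K := 2 * (K * (1 + (|t| + 1))))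
      (Continuous.aestronglyMeasurable (by fun_prop)) fun x _ => ?_
    rw [Complex.norm_real, Real.norm_of_nonneg (by have := hB0 x; positivity)]
    simp only [hBdef]
    rw [mul_assoc 2]
  have hBfin : ∫⁻ ξ, ‖((2 * B ξ : ℝ) : ℂ)‖ₑ ^ (2 : ℝ) ∂(omega a) ≠ ⊤ :=
    lintegral_rpow_ne_top ha hBX (by norm_num) (by norm_num)
  have hlim : Tendsto (fun h => ∫⁻ ξ, ‖duhamelErr f g t h ξ‖ₑ ^ (2 : ℝ) ∂(omega a)) (𝓝[≠] 0)
      (𝓝 (∫⁻ _, 0 ∂(omega a))) := by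
    refine tendsto_lintegral_filter_of_dominated_convergence
      (fun ξ => ‖((2 * B ξ : ℝ) : ℂ)‖ₑ ^ (2 : ℝ)) ?_ ?_ hBfin ?_
    · exact Eventually.of_forall fun h =>
        ((hd.rapid_duhamelErr t h).cont.measurable.enorm.pow_const _)
    · filter_upwards [self_mem_nhdsWithin,
        mem_nhdsWithin_of_mem_nhds (Metric.ball_mem_nhds (0 : ℝ) one_pos)] with h h0 h1
      refine Eventually.of_forall fun ξ => ?_
      gcongr
      rw [enorm_le_iff_norm_le, Complex.norm_real,
        Real.norm_of_nonneg (by have := hB0 ξ; positivity)]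
      exact hd.norm_duhamelErr_le (hBb ξ) h0 (by simpa using h1)
    · refine Eventually.of_forall fun ξ => ?_
      have := ((ENNReal.continuous_rpow_const (y := 2)).tendsto _).comp
        ((hd.tendsto_duhamelErr t ξ).enorm)
      simpa [Function.comp_def] using this
  have h2 := ((ENNReal.continuous_rpow_const (y := 1 / 2)).tendsto _).comp hlim
  simp only [lintegral_zero] at h2
  rw [ENNReal.zero_rpow_of_pos (by norm_num)] at h2
  refine h2.congr fun h => ?_
  rw [Function.comp, eLpNorm_two_eq_lintegral]

lemma FreqData.isSolution {a : ℝ} (ha : 0 ≤ a) {φ : ℝ → ℂ} {F : ℝ → ℝ → ℂ} {f : ℝ → ℂ}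
    {g : ℝ → ℝ → ℂ} (hd : FreqData f g) (hφ : ∀ x, 0 < x → hank a f x = φ x)
    (hF : ∀ x t, 0 < x → hank a (g t) x = F x t) :
    IsSolution a φ F (fun x t => hank a (duhamel f g t) x) where
  contDiff_space t := (contDiff_hank ha (hd.rapid_duhamel t)).contDiffOn
  differentiable_time x _ t := (hd.hasDerivAt_hank_duhamel ha x t).differentiableAt
  equation x t hx := by
    rw [(hd.hasDerivAt_hank_duhamel ha x t).deriv]
    change _ - Complex.I * besselOp a (hank a (duhamel f g t)) x = _
    rw [besselOp_hank ha (hd.rapid_duhamel t) hx, ← hF x t hx]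
    unfold duhamelD
    rw [hank_add ha ((((hd.rapid_duhamel t).pow_mul 2).const_mul _).integrable ha)
      ((hd.rapid_slice t).integrable ha), hank_const_mul]
    ring
  neumann t := tendsto_rpow_mul_deriv_hank ha (hd.rapid_duhamel t)
  initial x hx := by
    have : duhamel f g 0 = f := by ext ξ; simp [duhamel, chirp_zero]
    simp only [this]
    exact hφ x hx
  memLp t := memLp_hank ha ((hd.rapid_duhamel t).inX ha)
  -- The error of the difference quotient of `u` is the transform of `duhamelErr`, and the transform
  -- does not increase `L²` norms.
  deriv_memLp t := by
    refine tendsto_of_tendsto_of_tendsto_of_le_of_le tendsto_const_nhds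
      (hd.tendsto_eLpNorm_duhamelErr ha t) (fun _ => zero_le) fun h => ?_
    refine le_trans (le_of_eq ?_) (eLpNorm_hank_le ha ((hd.rapid_duhamelErr t h).inX ha))
    congr 1
    ext x
    have i1 := (hd.rapid_duhamel (t + h)).integrable ha
    have i2 := (hd.rapid_duhamel t).integrable ha
    rw [(hd.hasDerivAt_hank_duhamel ha x t).deriv]
    have i3 : Integrable (fun ξ => ((h⁻¹ : ℝ) : ℂ) *
        (duhamel f g (t + h) ξ - duhamel f g t ξ)) (omega a) := (i1.sub i2).const_mul _
    unfold duhamelErr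
    rw [hank_sub ha i3 ((hd.rapid_duhamelD t).integrable ha), hank_const_mul, hank_sub ha i1 i2]

/-! ### From Schwartz data to frequency-side data -/

lemma IsSchwartzHalfLine.unifSchwartz {φ : ℝ → ℂ} (h : IsSchwartzHalfLine φ) :
    UnifSchwartz (fun _ : Unit => φ) :=
  ⟨fun _ => h.smooth, fun m k => (h.bounded m k).imp fun _ hM _ => hM⟩

lemma IsSchwartzHalfPlane.unifSchwartz {F : ℝ → ℝ → ℂ} (h : IsSchwartzHalfPlane F) :
    UnifSchwartz (fun t x => F x t) := by
  refine ⟨fun t => ?_, fun m k => ?_⟩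
  · exact h.smooth.comp (f := fun x : ℝ => (x, t)) (contDiff_id.prodMk contDiff_const).contDiffOn
      fun x hx => ⟨hx, mem_univ _⟩
  -- The order `m + k` allows `k` derivatives, and its weight still dominates `x ^ m`, uniformly in
  -- `t`.
  · obtain ⟨M, hM⟩ := h.bounded (m + k) k 0 (by omega)
    refine ⟨M, fun t x hx => le_trans ?_ (hM x t hx)⟩
    simp only [iteratedDeriv_zero]
    gcongr
    have h1 : (1 : ℝ) ≤ 1 + x ^ 2 + t ^ 2 := by nlinarith [sq_nonneg x, sq_nonneg t]
    calc x ^ m = (x ^ 2) ^ ((m : ℝ) / 2) := by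
          rw [← Real.rpow_natCast, ← Real.rpow_natCast, ← Real.rpow_mul hx.le]
          congr 1
          push_cast
          ring
      _ ≤ (1 + x ^ 2 + t ^ 2) ^ ((m : ℝ) / 2) := by
          gcongr
          nlinarith [sq_nonneg t]
      _ ≤ _ := by
          refine Real.rpow_le_rpow_of_exponent_le h1 ?_
          push_cast
          linarith [(Nat.cast_nonneg k : (0 : ℝ) ≤ k)]

lemma IsSchwartzHalfPlane.continuous_time {F : ℝ → ℝ → ℂ} (h : IsSchwartzHalfPlane F) {x : ℝ}
    (hx : 0 < x) : Continuous (F x) := by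
  have := h.smooth.continuousOn.comp (f := fun t : ℝ => (x, t)) (s := univ)
    (by fun_prop) fun t _ => ⟨hx, mem_univ _⟩
  exact continuousOn_univ.1 this

lemma IsSchwartzHalfPlane.continuous_hank {a : ℝ} (ha : 0 ≤ a) {F : ℝ → ℝ → ℂ}
    (h : IsSchwartzHalfPlane F) :
    Continuous fun p : ℝ × ℝ => hank a (fun x => F x p.1) p.2 := by
  obtain ⟨K, -, hK⟩ := h.unifSchwartz.exists_decay (2 * wexp a)
  unfold hank
  refine continuous_const.mul (continuous_of_dominated
    (bound := fun x => K * ((1 + x ^ 2) ^ (2 * wexp a))⁻¹) (fun p => ?_) (fun p => ?_)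
    ((integrable_inv_one_add_sq_pow ha two_wexp_ge).const_mul _) ?_)
  · exact (integrable_mul_bes ha ((h.unifSchwartz.inX ha p.1).integrable ha) p.2).1
  · filter_upwards [ae_omega_pos a] with x hx
    rw [norm_mul]
    exact (mul_le_of_le_one_right (norm_nonneg _) (norm_bes_le ha _)).trans (hK p.1 x hx)
  · filter_upwards [ae_omega_pos a] with x hx
    have h1 := h.continuous_time hx
    have h2 := continuous_bes ha
    fun_prop

lemma freqData_hank {a : ℝ} (ha : 0 ≤ a) {φ : ℝ → ℂ} {F : ℝ → ℝ → ℂ}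
    (hφ : IsSchwartzHalfLine φ) (hF : IsSchwartzHalfPlane F) :
    FreqData (hank a φ) (fun s => hank a (fun x => F x s)) where
  rapid := by
    refine ⟨BesselSchrodinger.continuous_hank ha ((hφ.unifSchwartz.inX ha ()).integrable ha),
      fun n => ?_⟩
    obtain ⟨K, hK, h⟩ := hφ.unifSchwartz.exists_hank_decay ha n
    exact ⟨K, hK, fun ξ => h () ξ⟩
  cont := hF.continuous_hank ha
  decay n := hF.unifSchwartz.exists_hank_decay ha n

/-- The solution of the Cauchy problem. -/
def sol (a : ℝ) (φ : ℝ → ℂ) (F : ℝ → ℝ → ℂ) (x t : ℝ) : ℂ :=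
  hank a (duhamel (hank a φ) (fun s => hank a (fun x => F x s)) t) x

lemma isSolution_sol {a : ℝ} (ha : 0 ≤ a) {φ : ℝ → ℂ} {F : ℝ → ℝ → ℂ}
    (hφ : IsSchwartzHalfLine φ) (hF : IsSchwartzHalfPlane F) : IsSolution a φ F (sol a φ F) := by
  have hd := freqData_hank ha hφ hF
  refine hd.isSolution ha (fun x hx => ?_) fun x t hx => ?_
  · exact hank_hank ha ((hφ.unifSchwartz.inX ha ()).integrable ha) hφ.smooth.continuousOn
      (hd.rapid.integrable ha) hx
  · exact hank_hank ha ((hF.unifSchwartz.inX ha t).integrable ha)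
      (hF.unifSchwartz.smooth t).continuousOn ((hd.rapid_slice t).integrable ha) hx

/-! ### Symmetry of the Bessel operator with the Neumann condition -/

/-- The domain of the Neumann realization of the Bessel operator. -/
structure InDomain (a : ℝ) (f : ℝ → ℂ) : Prop where
  smooth : ContDiffOn ℝ 2 f (Ioi 0)
  memLp : MemLp f 2 (omega a)
  memLp_besselOp : MemLp (besselOp a f) 2 (omega a)
  neumann : Tendsto (fun x : ℝ => ((x ^ a : ℝ) : ℂ) * deriv f x) (𝓝[>] 0) (𝓝 0)

lemma contDiffOn_deriv_of_two {f : ℝ → ℂ} (hf : ContDiffOn ℝ 2 f (Ioi 0)) :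
    ContDiffOn ℝ 1 (deriv f) (Ioi 0) := hf.deriv_of_isOpen isOpen_Ioi (by norm_num)

lemma hasDerivAt_of_two {f : ℝ → ℂ} (hf : ContDiffOn ℝ 2 f (Ioi 0)) {x : ℝ} (hx : 0 < x) :
    HasDerivAt f (deriv f x) x :=
  ((hf.contDiffAt (Ioi_mem_nhds hx)).differentiableAt (by norm_num)).hasDerivAt

lemma hasDerivAt_deriv_of_two {f : ℝ → ℂ} (hf : ContDiffOn ℝ 2 f (Ioi 0)) {x : ℝ} (hx : 0 < x) :
    HasDerivAt (deriv f) (deriv (deriv f) x) x :=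
  (((contDiffOn_deriv_of_two hf).contDiffAt (Ioi_mem_nhds hx)).differentiableAt
    (by norm_num)).hasDerivAt

lemma continuousOn_rpow_Ioi (a : ℝ) : ContinuousOn (fun x : ℝ => x ^ a) (Ioi 0) := fun x hx =>
  (Real.continuousAt_rpow_const x a (Or.inl (ne_of_gt hx))).continuousWithinAt

lemma continuousOn_besselOp (a : ℝ) {f : ℝ → ℂ} (hf : ContDiffOn ℝ 2 f (Ioi 0)) :
    ContinuousOn (besselOp a f) (Ioi 0) := by
  have h1 := contDiffOn_deriv_of_two hf
  refine (h1.continuousOn_deriv_of_isOpen isOpen_Ioi (by norm_num)).add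
    (ContinuousOn.mul ?_ h1.continuousOn)
  exact Complex.continuous_ofReal.comp_continuousOn
    (continuousOn_const.div continuousOn_id fun x hx => ne_of_gt hx)

lemma hasDerivAt_flux (a : ℝ) {f : ℝ → ℂ} (hf : ContDiffOn ℝ 2 f (Ioi 0)) {x : ℝ} (hx : 0 < x) :
    HasDerivAt (fun x : ℝ => ((x ^ a : ℝ) : ℂ) * deriv f x) ((x ^ a : ℝ) • besselOp a f x) x := by
  have h1 : HasDerivAt (fun x : ℝ => ((x ^ a : ℝ) : ℂ)) ((a * x ^ (a - 1) : ℝ) : ℂ) x :=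
    (Real.hasDerivAt_rpow_const (Or.inl hx.ne')).ofReal_comp
  convert! h1.mul (hasDerivAt_deriv_of_two hf hx) using 1
  have hx' : (x : ℂ) ≠ 0 := by exact_mod_cast hx.ne'
  rw [Real.rpow_sub_one hx.ne']
  simp only [besselOp, Complex.real_smul]
  push_cast
  field_simp
  ring

lemma MemLp.integrable_norm_sq {a : ℝ} {f : ℝ → ℂ} (hf : MemLp f 2 (omega a)) :
    IntegrableOn (fun x => x ^ a * ‖f x‖ ^ 2) (Ioi 0) := by
  have := (memLp_two_iff_integrable_sq_norm hf.1).1 hf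
  simpa using integrable_omega_iff.1 this

/-- By the Neumann condition the flux at `x` is the integral of `y ^ a` times the Bessel image over
`(0, x)`. The image is in `L²` and the measure of `(0, x)` is at most `x ^ (a + 1)`, so
Cauchy–Schwarz gives the rate. -/
lemma InDomain.norm_flux_le {a : ℝ} (ha : 0 ≤ a) {f : ℝ → ℂ} (hf : InDomain a f) :
    ∃ K : ℝ, ∀ x : ℝ, 0 < x →
      ‖((x ^ a : ℝ) : ℂ) * deriv f x‖ ≤ K * x ^ ((a + 1) / 2) := by
  set C := ∫ x in Ioi (0 : ℝ), x ^ a * ‖besselOp a f x‖ ^ 2 with hC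
  have hsqi := MemLp.integrable_norm_sq hf.memLp_besselOp
  -- Cauchy–Schwarz is replaced by the pointwise inequality `r ≤ s r² / 2 + 1 / (2 s)` with `s = x ^
  -- ((a + 1) / 2)`; the two terms integrate to at most `s C / 2` and `s / 2`.
  refine ⟨(C + 1) / 2, fun x hx => ?_⟩
  set s := x ^ ((a + 1) / 2) with hs
  have hs0 : 0 < s := by positivity
  have hss : s * s = x ^ a * x := by
    rw [hs, ← Real.rpow_add hx, ← Real.rpow_add_one hx.ne']
    congr 1
    ring
  have hpt : ∀ ε ∈ Ioo 0 x, ‖((x ^ a : ℝ) : ℂ) * deriv f x - ((ε ^ a : ℝ) : ℂ) * deriv f ε‖ ≤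
      (C + 1) / 2 * s := by
    rintro ε ⟨hε, hεx⟩
    have hsub : uIcc ε x ⊆ Ioi 0 := by
      rw [uIcc_of_le hεx.le]
      exact fun y hy => lt_of_lt_of_le hε hy.1
    have hsub' : Ioc ε x ⊆ Ioi 0 := fun y hy => hε.trans hy.1
    have hc : ContinuousOn (fun y : ℝ => (y ^ a : ℝ) • besselOp a f y) (uIcc ε x) :=
      ((continuousOn_rpow_Ioi a).smul (continuousOn_besselOp a hf.smooth)).mono hsub
    have hi1 : IntervalIntegrable (fun y => s / 2 * (y ^ a * ‖besselOp a f y‖ ^ 2)) volume ε x :=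
      (intervalIntegrable_iff_integrableOn_Ioc_of_le hεx.le).2
        ((hsqi.mono_set hsub').const_mul _)
    have hi2 : IntervalIntegrable (fun _ : ℝ => x ^ a / (2 * s)) volume ε x :=
      intervalIntegrable_const
    rw [← intervalIntegral.integral_eq_sub_of_hasDerivAt
      (fun y hy => hasDerivAt_flux a hf.smooth (hsub hy)) hc.intervalIntegrable]
    refine (intervalIntegral.norm_integral_le_of_norm_le hεx.le
      (Eventually.of_forall fun y hy => ?_) (hi1.add hi2)).trans ?_
    · have hy0 : 0 < y := hε.trans hy.1
      rw [norm_smul, Real.norm_of_nonneg (by positivity)]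
      have h1 : y ^ a ≤ x ^ a := Real.rpow_le_rpow hy0.le hy.2 ha
      have h2 : ‖besselOp a f y‖ ≤ s / 2 * ‖besselOp a f y‖ ^ 2 + 1 / (2 * s) := by
        have : 0 ≤ (s * ‖besselOp a f y‖ - 1) ^ 2 / (2 * s) := by positivity
        have e : (s * ‖besselOp a f y‖ - 1) ^ 2 / (2 * s) =
            s / 2 * ‖besselOp a f y‖ ^ 2 + 1 / (2 * s) - ‖besselOp a f y‖ := by
          field_simp
          ring
        linarith
      calc y ^ a * ‖besselOp a f y‖ ≤
            y ^ a * (s / 2 * ‖besselOp a f y‖ ^ 2 + 1 / (2 * s)) := by gcongr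
        _ = s / 2 * (y ^ a * ‖besselOp a f y‖ ^ 2) + y ^ a / (2 * s) := by ring
        _ ≤ s / 2 * (y ^ a * ‖besselOp a f y‖ ^ 2) + x ^ a / (2 * s) := by gcongr
    · rw [intervalIntegral.integral_add hi1 hi2, intervalIntegral.integral_const_mul,
        intervalIntegral.integral_const, intervalIntegral.integral_of_le hεx.le]
      have h1 : ∫ y in Ioc ε x, y ^ a * ‖besselOp a f y‖ ^ 2 ≤ C := by
        refine setIntegral_mono_set hsqi ?_ (Eventually.of_forall hsub')
        filter_upwards [ae_restrict_mem measurableSet_Ioi] with y hy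
        have : (0 : ℝ) < y := hy
        positivity
      have h2 : (x - ε) • (x ^ a / (2 * s)) ≤ s / 2 := by
        rw [smul_eq_mul]
        calc (x - ε) * (x ^ a / (2 * s)) ≤ x * (x ^ a / (2 * s)) := by
              gcongr
              linarith
          _ = (x ^ a * x) / (2 * s) := by ring
          _ = s / 2 := by rw [← hss]; field_simp
      have h3 : s / 2 * ∫ y in Ioc ε x, y ^ a * ‖besselOp a f y‖ ^ 2 ≤ s / 2 * C := by gcongr
      linarith
  have hlim := ((tendsto_const_nhds (x := ((x ^ a : ℝ) : ℂ) * deriv f x)).sub hf.neumann).norm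
  rw [sub_zero] at hlim
  refine le_of_tendsto hlim ?_
  filter_upwards [Ioo_mem_nhdsGT hx] with ε hε using hpt ε hε

/-- A function dominated by the geometric mean of `x` and an integrable function has no nonzero
limit at the ends of the half-line. -/
lemma eq_zero_of_tendsto_of_sq_le {l : Filter ℝ} [NeBot l] [TendstoIxxClass Icc l l]
    (hl : Ioi (0 : ℝ) ∈ l) (hlog : Tendsto (fun x => ‖Real.log x‖) l atTop) {W g : ℝ → ℝ} {C L : ℝ}
    (hg : IntegrableOn g (Ioi 0)) (hW : ∀ x, 0 < x → W x ^ 2 ≤ C * (x * g x))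
    (hL : Tendsto W l (𝓝 L)) : L = 0 := by
  by_contra hne
  have hL2 : Tendsto (fun x => W x ^ 2) l (𝓝 (L ^ 2)) := hL.pow 2
  have hpos : 0 < L ^ 2 := by positivity
  have hev : ∀ᶠ x in l, L ^ 2 / 2 < W x ^ 2 := hL2.eventually_const_lt (by linarith)
  -- A nonzero limit would force `|g| ≥ c / x` near that end, so the derivative of the logarithm
  -- would be dominated by an integrable function although the logarithm is unbounded there.
  refine not_integrableOn_of_tendsto_norm_atTop_of_deriv_isBigO_filter (f := Real.log) l hl ?_ hlog
    ?_ hg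
  · filter_upwards [hl] with x hx
    exact Real.differentiableAt_log (ne_of_gt hx)
  · refine Asymptotics.IsBigO.of_bound (2 * |C| / L ^ 2) ?_
    filter_upwards [hl, hev] with x hx hx2
    have hx0 : 0 < x := hx
    rw [Real.deriv_log, norm_inv, Real.norm_of_nonneg hx0.le, Real.norm_eq_abs]
    have h1 := hW x hx0
    have h2 : C * (x * g x) ≤ |C| * (x * |g x|) := by
      calc C * (x * g x) ≤ |C * (x * g x)| := le_abs_self _
        _ = _ := by rw [abs_mul, abs_mul, abs_of_pos hx0]
    rw [inv_le_iff_one_le_mul₀ hx0]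
    have h3 : 1 ≤ (2 / L ^ 2) * (|C| * (x * |g x|)) := by
      rw [div_mul_eq_mul_div, le_div_iff₀ hpos]
      linarith
    calc (1 : ℝ) ≤ (2 / L ^ 2) * (|C| * (x * |g x|)) := h3
      _ = _ := by ring

/-- Integrability of `W'` makes `W` converge at both ends, and the geometric-mean bound forces both
limits to be zero. -/
lemma integral_Ioi_eq_zero_of_hasDerivAt {W W' g : ℝ → ℝ} {C : ℝ}
    (hd : ∀ x, 0 < x → HasDerivAt W (W' x) x) (hi : IntegrableOn W' (Ioi 0))
    (hg : IntegrableOn g (Ioi 0)) (hW : ∀ x, 0 < x → W x ^ 2 ≤ C * (x * g x)) :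
    ∫ x in Ioi (0 : ℝ), W' x = 0 := by
  have hTop := tendsto_limUnder_of_hasDerivAt_of_integrableOn_Ioi (fun x hx => hd x hx) hi
  rw [eq_zero_of_tendsto_of_sq_le (Ioi_mem_atTop 0)
    (tendsto_norm_atTop_atTop.comp Real.tendsto_log_atTop) hg hW hTop] at hTop
  have hi01 : IntegrableOn W' (uIcc 0 1) := by
    rw [uIcc_of_le zero_le_one, integrableOn_Icc_iff_integrableOn_Ioc]
    exact hi.mono_set fun x hx => hx.1
  have hz : Tendsto W (𝓝[>] 0) (𝓝 (W 1 - ∫ t in (0 : ℝ)..1, W' t)) := by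
    have h1 := (intervalIntegral.continuousOn_primitive_interval_left hi01) 0 left_mem_uIcc
    have h2 : Tendsto (fun x => ∫ t in x..1, W' t) (𝓝[>] 0) (𝓝 (∫ t in (0 : ℝ)..1, W' t)) := by
      refine h1.tendsto.mono_left ?_
      rw [uIcc_of_le zero_le_one]
      refine nhdsWithin_le_of_mem ?_
      filter_upwards [Ioo_mem_nhdsGT one_pos] with x hx using ⟨hx.1.le, hx.2.le⟩
    refine (h2.const_sub (W 1)).congr' ?_
    filter_upwards [Ioo_mem_nhdsGT one_pos] with x hx
    have hsub : uIcc x 1 ⊆ Ioi 0 := by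
      rw [uIcc_of_le hx.2.le]
      exact fun y hy => lt_of_lt_of_le hx.1 hy.1
    rw [intervalIntegral.integral_eq_sub_of_hasDerivAt (fun y hy => hd y (hsub hy))]
    · ring
    · exact (intervalIntegrable_iff_integrableOn_Ioc_of_le hx.2.le).2
        (hi.mono_set fun y hy => hx.1.trans hy.1)
  rw [eq_zero_of_tendsto_of_sq_le self_mem_nhdsWithin
    (tendsto_abs_atBot_atTop.comp Real.tendsto_log_nhdsGT_zero) hg hW hz] at hz
  -- `W` is unconstrained at `0`; redefining it there by its limit gives continuity up to the
  -- endpoint.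
  set V : ℝ → ℝ := Function.update W 0 0 with hV
  have hVW : ∀ x, 0 < x → V =ᶠ[𝓝 x] W := by
    intro x hx
    filter_upwards [Ioi_mem_nhds hx] with y hy
    exact Function.update_of_ne (ne_of_gt hy) _ _
  have hV0 : V 0 = 0 := by simp [hV]
  have hcont : ContinuousWithinAt V (Ici 0) 0 := by
    rw [← continuousWithinAt_Ioi_iff_Ici, ContinuousWithinAt, hV0]
    refine hz.congr' ?_
    filter_upwards [self_mem_nhdsWithin] with y hy
    exact (Function.update_of_ne (ne_of_gt hy) _ _).symm
  have hVtop : Tendsto V atTop (𝓝 0) := by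
    refine hTop.congr' ?_
    filter_upwards [eventually_gt_atTop 0] with y hy
    exact (Function.update_of_ne (ne_of_gt hy) _ _).symm
  rw [integral_Ioi_of_hasDerivAt_of_tendsto hcont
    (fun x hx => (hd x hx).congr_of_eventuallyEq (hVW x hx)) hi hVtop, hV0, sub_zero]

/-- Differentiate the imaginary part of `x ^ a f' f̄`: the term `x ^ a |f'|²` is real and drops out,
so its integrability is never needed. The flux bound gives the square at most `K² x` times the
integrable function `x ^ a |f|²`. -/
lemma InDomain.integral_im_eq_zero {a : ℝ} (ha : 0 ≤ a) {f : ℝ → ℂ} (hf : InDomain a f) :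
    ∫ x, (besselOp a f x * (starRingEnd ℂ) (f x)).im ∂(omega a) = 0 := by
  obtain ⟨K, hK⟩ := hf.norm_flux_le ha
  have hi : Integrable (fun x => besselOp a f x * (starRingEnd ℂ) (f x)) (omega a) :=
    hf.memLp_besselOp.integrable_mul hf.memLp.star
  rw [integral_omega]
  refine integral_Ioi_eq_zero_of_hasDerivAt (C := K ^ 2)
    (W := fun x => (((x ^ a : ℝ) : ℂ) * deriv f x * (starRingEnd ℂ) (f x)).im)
    (g := fun x => x ^ a * ‖f x‖ ^ 2) (fun x hx => ?_) (integrable_omega_iff.1 hi.im)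
    (MemLp.integrable_norm_sq hf.memLp) fun x hx => ?_
  · have h1 := (hasDerivAt_flux a hf.smooth hx).mul (hasDerivAt_of_two hf.smooth hx).star
    have h2 := (Complex.imCLM.hasFDerivAt.comp_hasDerivAt x h1)
    convert! h2 using 1
    simp only [Complex.imCLM_apply, Complex.real_smul, smul_eq_mul]
    have e : ((x ^ a : ℝ) : ℂ) * deriv f x * star (deriv f x) =
        ((x ^ a * Complex.normSq (deriv f x) : ℝ) : ℂ) := by
      rw [mul_assoc, Complex.star_def, Complex.mul_conj]
      push_cast
      ring
    rw [e, Complex.add_im, Complex.ofReal_im, add_zero, mul_assoc, Complex.im_ofReal_mul]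
    rfl
  · have h1 : |(((x ^ a : ℝ) : ℂ) * deriv f x * (starRingEnd ℂ) (f x)).im| ≤
        K * x ^ ((a + 1) / 2) * ‖f x‖ := by
      refine (Complex.abs_im_le_norm _).trans ?_
      rw [norm_mul, RCLike.norm_conj]
      gcongr
      exact hK x hx
    have hxx : (x ^ ((a + 1) / 2)) ^ 2 = x ^ a * x := by
      rw [sq, ← Real.rpow_add hx, ← Real.rpow_add_one hx.ne']
      congr 1
      ring
    calc _ = |(((x ^ a : ℝ) : ℂ) * deriv f x * (starRingEnd ℂ) (f x)).im| ^ 2 := (sq_abs _).symm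
      _ ≤ (K * x ^ ((a + 1) / 2) * ‖f x‖) ^ 2 := by gcongr
      _ = K ^ 2 * (x ^ ((a + 1) / 2)) ^ 2 * ‖f x‖ ^ 2 := by ring
      _ = _ := by rw [hxx]; ring

/-! ### Uniqueness -/

/-- A pointwise limit of measurable difference quotients. Measurability has to be obtained
separately because an `eLpNorm` limit alone does not provide it. -/
lemma IsSolution.aestronglyMeasurable_deriv {a : ℝ} {φ : ℝ → ℂ} {F u : ℝ → ℝ → ℂ}
    (hu : IsSolution a φ F u) (t : ℝ) :
    AEStronglyMeasurable (fun x => deriv (fun s => u x s) t) (omega a) := by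
  obtain ⟨h, hh⟩ := exists_seq_tendsto (𝓝[≠] (0 : ℝ))
  refine aestronglyMeasurable_of_tendsto_ae atTop
    (f := fun (n : ℕ) x => (((h n)⁻¹ : ℝ) : ℂ) * (u x (t + h n) - u x t))
    (fun n => ((hu.memLp _).1.sub (hu.memLp t).1).const_mul _) ?_
  filter_upwards [ae_omega_pos a] with x hx
  have h1 := hasDerivAt_iff_tendsto_slope_zero.1 (hu.differentiable_time x hx t).hasDerivAt
  refine (h1.comp hh).congr fun n => ?_
  simp only [Function.comp_apply, Complex.real_smul]

/-- One increment with error norm below `1` suffices: the derivative is the quotient minus the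
error, both in `L²`. -/
lemma IsSolution.memLp_deriv {a : ℝ} {φ : ℝ → ℂ} {F u : ℝ → ℝ → ℂ}
    (hu : IsSolution a φ F u) (t : ℝ) :
    MemLp (fun x => deriv (fun s => u x s) t) 2 (omega a) := by
  obtain ⟨h, hh⟩ := ((hu.deriv_memLp t).eventually_lt_const (u := 1) one_pos).exists
  have h1 : MemLp (fun x => ((h⁻¹ : ℝ) : ℂ) * (u x (t + h) - u x t)) 2 (omega a) :=
    ((hu.memLp (t + h)).sub (hu.memLp t)).const_mul _
  have h2 : MemLp (fun x => ((h⁻¹ : ℝ) : ℂ) * (u x (t + h) - u x t) -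
      deriv (fun s => u x s) t) 2 (omega a) :=
    ⟨h1.1.sub (hu.aestronglyMeasurable_deriv t), hh.trans ENNReal.one_lt_top⟩
  refine (h1.sub h2).ae_eq (Eventually.of_forall fun x => ?_)
  simp

lemma besselOp_sub (a : ℝ) {f g : ℝ → ℂ} (hf : ContDiffOn ℝ 2 f (Ioi 0))
    (hg : ContDiffOn ℝ 2 g (Ioi 0)) {x : ℝ} (hx : 0 < x) :
    besselOp a (fun x => f x - g x) x = besselOp a f x - besselOp a g x := by
  have e : deriv (fun x => f x - g x) =ᶠ[𝓝 x] fun x => deriv f x - deriv g x := by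
    filter_upwards [Ioi_mem_nhds hx] with y hy
    exact ((hasDerivAt_of_two hf hy).sub (hasDerivAt_of_two hg hy)).deriv
  unfold besselOp
  rw [e.deriv_eq, e.self_of_nhds,
    ((hasDerivAt_deriv_of_two hf hx).fun_sub (hasDerivAt_deriv_of_two hg hx)).deriv]
  ring

lemma IsSolution.sub {a : ℝ} {φ ψ : ℝ → ℂ} {F G u v : ℝ → ℝ → ℂ} (hu : IsSolution a φ F u)
    (hv : IsSolution a ψ G v) :
    IsSolution a (fun x => φ x - ψ x) (fun x t => F x t - G x t) (fun x t => u x t - v x t) := by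
  have hd : ∀ x t, 0 < x → deriv (fun s => u x s - v x s) t =
      deriv (fun s => u x s) t - deriv (fun s => v x s) t := fun x t hx =>
    deriv_fun_sub (hu.differentiable_time x hx t) (hv.differentiable_time x hx t)
  refine ⟨fun t => (hu.contDiff_space t).sub (hv.contDiff_space t),
    fun x hx => (hu.differentiable_time x hx).sub (hv.differentiable_time x hx),
    fun x t hx => ?_, fun t => ?_, fun x hx => ?_, fun t => (hu.memLp t).sub (hv.memLp t),
    fun t => ?_⟩
  · rw [hd x t hx, besselOp_sub a (hu.contDiff_space t) (hv.contDiff_space t) hx,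
      ← hu.equation x t hx, ← hv.equation x t hx]
    ring
  · have := (hu.neumann t).sub (hv.neumann t)
    rw [sub_zero] at this
    refine this.congr' ?_
    filter_upwards [self_mem_nhdsWithin] with x hx
    rw [((hasDerivAt_of_two (hu.contDiff_space t) hx).fun_sub
      (hasDerivAt_of_two (hv.contDiff_space t) hx)).deriv]
    ring
  · rw [hu.initial x hx, hv.initial x hx]
  · have h0 := (hu.deriv_memLp t).add (hv.deriv_memLp t)
    rw [add_zero] at h0
    refine tendsto_of_tendsto_of_tendsto_of_le_of_le tendsto_const_nhds h0
      (fun _ => zero_le) fun h => ?_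
    have hm : ∀ {φ F u}, IsSolution a φ F u → AEStronglyMeasurable (fun x => ((h⁻¹ : ℝ) : ℂ) *
        (u x (t + h) - u x t) - deriv (fun s => u x s) t) (omega a) := fun hu =>
      (((hu.memLp (t + h)).1.sub (hu.memLp t).1).const_mul _).sub (hu.aestronglyMeasurable_deriv t)
    refine le_trans (le_of_eq ?_) (eLpNorm_sub_le (hm hu) (hm hv) one_le_two)
    refine eLpNorm_congr_ae ?_
    filter_upwards [ae_omega_pos a] with x hx
    simp only [Pi.sub_apply]
    rw [hd x t hx]
    ring

/-- The homogeneous equation identifies the Bessel image with `-i ∂_t u`, which is already known to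
be in `L²`. -/
lemma IsSolution.inDomain {a : ℝ} {φ : ℝ → ℂ} {u : ℝ → ℝ → ℂ}
    (hu : IsSolution a φ (fun _ _ => 0) u) (t : ℝ) : InDomain a (fun x => u x t) := by
  refine ⟨hu.contDiff_space t, hu.memLp t, ?_, hu.neumann t⟩
  refine ((hu.memLp_deriv t).const_mul (-Complex.I)).ae_eq ?_
  filter_upwards [ae_omega_pos a] with x hx
  have h := hu.equation x t hx
  have hI := Complex.I_mul_I
  linear_combination (-Complex.I) * h - (besselOp a (fun y => u y t) x) * hI

/-- The curve `t ↦ u(·, t)` in `L²`. -/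
def IsSolution.curve {a : ℝ} {φ : ℝ → ℂ} {F u : ℝ → ℝ → ℂ} (hu : IsSolution a φ F u) (t : ℝ) :
    Lp ℂ 2 (omega a) := (hu.memLp t).toLp _

lemma IsSolution.hasDerivAt_curve {a : ℝ} {φ : ℝ → ℂ} {F u : ℝ → ℝ → ℂ} (hu : IsSolution a φ F u)
    (t : ℝ) : HasDerivAt hu.curve ((hu.memLp_deriv t).toLp _) t := by
  rw [hasDerivAt_iff_tendsto_slope_zero, tendsto_iff_edist_tendsto_0]
  refine (hu.deriv_memLp t).congr fun h => ?_
  have e : h⁻¹ • (hu.curve (t + h) - hu.curve t) =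
      (((hu.memLp (t + h)).sub (hu.memLp t)).const_smul h⁻¹).toLp _ := rfl
  rw [e, Lp.edist_toLp_toLp]
  congr 1

/-- Conservation of energy: the derivative of `‖u(t)‖²` is twice the real part of the inner product
of `u` with `i` times its Bessel image, hence `-2` times the integral shown to vanish by
`InDomain.integral_im_eq_zero`. Continuity in `x` upgrades almost everywhere to everywhere. -/
lemma IsSolution.eq_zero {a : ℝ} (ha : 0 ≤ a) {u : ℝ → ℝ → ℂ}
    (hu : IsSolution a (fun _ => 0) (fun _ _ => 0) u) {x t : ℝ} (hx : 0 < x) : u x t = 0 := by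
  have hder : ∀ t, HasDerivAt (fun t => (inner ℂ (hu.curve t) (hu.curve t)).re) 0 t := by
    intro t
    have h1 := (hu.hasDerivAt_curve t).inner ℂ (hu.hasDerivAt_curve t)
    have h2 := Complex.reCLM.hasFDerivAt.comp_hasDerivAt t h1
    convert! h2 using 1
    simp only [Complex.reCLM_apply, Complex.add_re]
    have hre : (inner ℂ (hu.curve t) ((hu.memLp_deriv t).toLp _)).re = 0 := by
      rw [L2.inner_def]
      have hi := L2.integrable_inner (𝕜 := ℂ) (hu.curve t) ((hu.memLp_deriv t).toLp _)
      have e1 : (∫ x, inner ℂ (hu.curve t x) ((hu.memLp_deriv t).toLp _ x) ∂(omega a)).re =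
          ∫ x, (inner ℂ (hu.curve t x) ((hu.memLp_deriv t).toLp _ x)).re ∂(omega a) :=
        (integral_re hi).symm
      rw [e1]
      have e2 : ∫ x, (inner ℂ (hu.curve t x) ((hu.memLp_deriv t).toLp _ x)).re ∂(omega a) =
          ∫ x, -(besselOp a (fun x => u x t) x * (starRingEnd ℂ) (u x t)).im ∂(omega a) := by
        refine integral_congr_ae ?_
        filter_upwards [ae_omega_pos a, (hu.memLp t).coeFn_toLp,
          (hu.memLp_deriv t).coeFn_toLp] with y hy h3 h4
        have h5 : hu.curve t y = u y t := h3
        have h6 : deriv (fun s => u y s) t = Complex.I * besselOp a (fun x => u x t) y :=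
          sub_eq_zero.1 (hu.equation y t hy)
        rw [h5, h4, h6, RCLike.inner_apply]
        simp only [Complex.mul_re, Complex.mul_im, Complex.I_re, Complex.I_im]
        ring
      rw [e2, integral_neg, (hu.inDomain t).integral_im_eq_zero ha, neg_zero]
    have hre' : (inner ℂ ((hu.memLp_deriv t).toLp _) (hu.curve t)).re = 0 := by
      rw [← inner_conj_symm, Complex.conj_re, hre]
    rw [hre, hre', add_zero]
  have hconst := is_const_of_deriv_eq_zero (fun t => (hder t).differentiableAt)
    (fun t => (hder t).deriv) t 0
  have h0 : hu.curve 0 = 0 := by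
    rw [Lp.eq_zero_iff_ae_eq_zero]
    filter_upwards [ae_omega_pos a, (hu.memLp 0).coeFn_toLp] with y hy h1
    exact h1.trans (hu.initial y hy)
  rw [h0, inner_zero_left, Complex.zero_re] at hconst
  have hz : hu.curve t = 0 := by
    have h1 : RCLike.re (inner ℂ (hu.curve t) (hu.curve t)) = 0 := hconst
    rw [inner_self_eq_norm_sq] at h1
    exact norm_eq_zero.1 (pow_eq_zero_iff two_ne_zero |>.1 h1)
  have hae : (fun x => u x t) =ᵐ[omega a] fun _ => 0 := by
    rw [Lp.eq_zero_iff_ae_eq_zero] at hz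
    exact (hu.memLp t).coeFn_toLp.symm.trans hz
  exact Measure.eqOn_open_of_ae_eq (ae_omega_iff.1 hae) isOpen_Ioi
    (hu.contDiff_space t).continuousOn continuousOn_const hx

lemma IsSolution.unique {a : ℝ} (ha : 0 ≤ a) {φ : ℝ → ℂ} {F u v : ℝ → ℝ → ℂ}
    (hu : IsSolution a φ F u) (hv : IsSolution a φ F v) {x t : ℝ} (hx : 0 < x) :
    v x t = u x t := by
  have h := hv.sub hu
  simp only [sub_self] at h
  exact sub_eq_zero.1 (h.eq_zero ha hx)

/-! ### Test functions -/

/-- Bounded measurable space-time functions with bounded support. -/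
structure IsTest (G : ℝ → ℝ → ℂ) : Prop where
  meas : Measurable fun q : ℝ × ℝ => G q.1 q.2
  bdd : ∃ (n : ℕ) (M : ℝ), 0 ≤ M ∧ (∀ x t, ‖G x t‖ ≤ M) ∧
    ∀ x t : ℝ, ¬(x ≤ n ∧ |t| ≤ n) → G x t = 0

/-- A bump in time. -/
def tbox (n : ℕ) (K t : ℝ) : ℝ := (Icc (-(n : ℝ)) n).indicator (fun _ => K) t

lemma tbox_nonneg (n : ℕ) {K : ℝ} (hK : 0 ≤ K) (t : ℝ) : 0 ≤ tbox n K t :=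
  indicator_nonneg (fun _ _ => hK) t

lemma integrable_tbox (n : ℕ) (K : ℝ) : Integrable (tbox n K) :=
  (integrable_indicator_iff measurableSet_Icc).2 (integrableOn_const (by simp))

/-- Puts a test function under a product of a compactly supported time factor and an integrable
space weight. No lower bound on `x` in the support is needed, since only `x > 0` carries mass. -/
lemma IsTest.exists_bound {G : ℝ → ℝ → ℂ} (hG : IsTest G) (N : ℕ) :
    ∃ (n : ℕ) (K : ℝ), 0 ≤ K ∧ ∀ x t, 0 < x → ‖G x t‖ ≤ tbox n K t * ((1 + x ^ 2) ^ N)⁻¹ := by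
  obtain ⟨n, M, hM, hb, h0⟩ := hG.bdd
  refine ⟨n, M * (1 + (n : ℝ) ^ 2) ^ N, by positivity, fun x t hx => ?_⟩
  by_cases h : x ≤ n ∧ |t| ≤ n
  · rw [tbox, indicator_of_mem (mem_Icc.2 (abs_le.1 h.2)), mul_assoc]
    refine (hb x t).trans (le_mul_of_one_le_right hM ?_)
    rw [← div_eq_mul_inv, one_le_div (by positivity)]
    gcongr
    exact h.1
  · rw [h0 x t h, norm_zero]
    exact mul_nonneg (tbox_nonneg n (by positivity) t) (by positivity)

lemma measurable_slice {G : ℝ → ℝ → ℂ} (hG : Measurable fun q : ℝ × ℝ => G q.1 q.2) (t : ℝ) :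
    Measurable fun x => G x t := hG.comp (measurable_id.prodMk measurable_const)

lemma IsTest.inX {a : ℝ} (ha : 0 ≤ a) {G : ℝ → ℝ → ℂ} (hG : IsTest G) (t : ℝ) :
    InX a (fun x => G x t) := by
  obtain ⟨n, K, -, h⟩ := hG.exists_bound (2 * wexp a)
  exact InX.of_decay ha (measurable_slice hG.meas t).aestronglyMeasurable fun x hx => h x t hx

lemma IsTest.exists_hank_bound {a : ℝ} (ha : 0 ≤ a) {G : ℝ → ℝ → ℂ} (hG : IsTest G) :
    ∃ (n : ℕ) (K : ℝ), 0 ≤ K ∧ ∀ t ξ, ‖hank a (fun x => G x t) ξ‖ ≤ tbox n K t := by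
  obtain ⟨n, K, hK, h⟩ := hG.exists_bound (2 * wexp a)
  have hi := integrable_inv_one_add_sq_pow ha (two_wexp_ge (a := a))
  set J := ∫ x, ((1 + x ^ 2) ^ (2 * wexp a))⁻¹ ∂(omega a) with hJ
  have hJ0 : 0 ≤ J := integral_nonneg fun x => by positivity
  have hM := gaussMoment_pos ha
  refine ⟨n, K * ((gaussMoment a)⁻¹ * J), by positivity, fun t ξ => ?_⟩
  have e : tbox n (K * ((gaussMoment a)⁻¹ * J)) t = (gaussMoment a)⁻¹ * (tbox n K t * J) := by
    unfold tbox
    by_cases ht : t ∈ Icc (-(n : ℝ)) n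
    · simp only [indicator_of_mem ht]; ring
    · simp only [indicator_of_notMem ht]; ring
  rw [e]
  refine (norm_hank_le ha ((hG.inX ha t).integrable ha) ξ).trans ?_
  gcongr
  rw [hJ, ← integral_const_mul]
  refine integral_mono_ae ((hG.inX ha t).integrable ha).norm (hi.const_mul _) ?_
  filter_upwards [ae_omega_pos a] with x hx using h x t hx

lemma IsTest.exists_eLpNorm_bound {a : ℝ} (ha : 0 ≤ a) {G : ℝ → ℝ → ℂ} (hG : IsTest G) :
    ∃ (n : ℕ) (K : ℝ), 0 ≤ K ∧
      ∀ t, eLpNorm (fun x => G x t) 2 (omega a) ≤ ENNReal.ofReal (tbox n K t) := by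
  obtain ⟨n, K, hK, h⟩ := hG.exists_bound (2 * wexp a)
  have hX : InX a (fun x => ((((1 + x ^ 2) ^ (2 * wexp a))⁻¹ : ℝ) : ℂ)) := by
    refine InX.of_decay ha (K := 1) (Measurable.aestronglyMeasurable (by fun_prop)) fun x _ => ?_
    rw [Complex.norm_real, Real.norm_of_nonneg (by positivity), one_mul]
  set J := eLpNorm (fun x : ℝ => ((((1 + x ^ 2) ^ (2 * wexp a))⁻¹ : ℝ) : ℂ)) 2 (omega a) with hJ
  have hJt : J ≠ ⊤ := hX.memLp_two.2.ne
  refine ⟨n, K * J.toReal, by positivity, fun t => ?_⟩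
  have e : tbox n (K * J.toReal) t = tbox n K t * J.toReal := by
    unfold tbox
    by_cases ht : t ∈ Icc (-(n : ℝ)) n
    · simp only [indicator_of_mem ht]
    · simp only [indicator_of_notMem ht]; ring
  rw [e, ENNReal.ofReal_mul (tbox_nonneg n hK t), ENNReal.ofReal_toReal hJt]
  refine eLpNorm_le_mul_eLpNorm_of_ae_le_mul ?_ 2
  filter_upwards [ae_omega_pos a] with x hx
  rw [Complex.norm_real, Real.norm_of_nonneg (by positivity)]
  exact h x t hx

lemma measurable_hank_slice {a : ℝ} (ha : 0 ≤ a) {G : ℝ → ℝ → ℂ}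
    (hG : Measurable fun q : ℝ × ℝ => G q.1 q.2) :
    Measurable fun p : ℝ × ℝ => hank a (fun x => G x p.1) p.2 := by
  have hb := continuous_bes ha
  have h1 : StronglyMeasurable fun q : (ℝ × ℝ) × ℝ =>
      G q.2 q.1.1 * (bes a (q.1.2 * q.2) : ℂ) := by
    refine Measurable.stronglyMeasurable (Measurable.mul ?_ ?_)
    · exact hG.comp (measurable_snd.prodMk (measurable_fst.comp measurable_fst))
    · exact Continuous.measurable (by fun_prop)
  exact (h1.integral_prod_right' (ν := omega a)).measurable.const_mul _

/-! ### The homogeneous part -/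

/-- The adjoint of the free evolution, on the frequency side. -/
def freqAvg (a : ℝ) (G : ℝ → ℝ → ℂ) (ξ : ℝ) : ℂ := ∫ t, chirp t ξ * hank a (fun x => G x t) ξ

lemma measurable_chirp_mul_hank {a : ℝ} (ha : 0 ≤ a) {G : ℝ → ℝ → ℂ}
    (hG : Measurable fun q : ℝ × ℝ => G q.1 q.2) :
    Measurable fun p : ℝ × ℝ => chirp p.1 p.2 * hank a (fun x => G x p.1) p.2 :=
  continuous_chirp.measurable.mul (measurable_hank_slice ha hG)

lemma measurable_freqAvg {a : ℝ} (ha : 0 ≤ a) {G : ℝ → ℝ → ℂ}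
    (hG : Measurable fun q : ℝ × ℝ => G q.1 q.2) : Measurable (freqAvg a G) :=
  ((measurable_chirp_mul_hank ha hG).stronglyMeasurable.integral_prod_left'
    (μ := volume)).measurable

/-- Justifies Fubini in the `T T*` identity: Cauchy–Schwarz and Plancherel bound the frequency
integral for each pair of times, and those bounds have compact support in time. -/
lemma IsTest.integrable_pair {a : ℝ} (ha : 0 ≤ a) {G : ℝ → ℝ → ℂ} (hG : IsTest G) :
    Integrable (fun z : (ℝ × ℝ) × ℝ => (chirp z.1.1 z.2 * hank a (fun x => G x z.1.1) z.2) *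
      (starRingEnd ℂ) (chirp z.1.2 z.2 * hank a (fun x => G x z.1.2) z.2))
      ((volume.prod volume).prod (omega a)) := by
  obtain ⟨n, K, hK, hb⟩ := hG.exists_eLpNorm_bound ha
  have hm0 := measurable_chirp_mul_hank ha hG.meas
  have hm : Measurable (fun z : (ℝ × ℝ) × ℝ => (chirp z.1.1 z.2 * hank a (fun x => G x z.1.1) z.2) *
      (starRingEnd ℂ) (chirp z.1.2 z.2 * hank a (fun x => G x z.1.2) z.2)) := by
    refine Measurable.mul ?_ ?_
    · exact hm0.comp (f := fun z : (ℝ × ℝ) × ℝ => (z.1.1, z.2)) (by fun_prop)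
    · exact Complex.continuous_conj.measurable.comp
        (hm0.comp (f := fun z : (ℝ × ℝ) × ℝ => (z.1.2, z.2)) (by fun_prop))
  refine ⟨hm.aestronglyMeasurable, ?_⟩
  rw [HasFiniteIntegral, lintegral_prod _ hm.enorm.aemeasurable]
  have hle : ∀ p : ℝ × ℝ, ∫⁻ ξ, ‖(chirp p.1 ξ * hank a (fun x => G x p.1) ξ) *
      (starRingEnd ℂ) (chirp p.2 ξ * hank a (fun x => G x p.2) ξ)‖ₑ ∂(omega a) ≤
      ENNReal.ofReal (tbox n K p.1 * tbox n K p.2) := by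
    intro p
    rw [ENNReal.ofReal_mul (tbox_nonneg n hK _)]
    calc _ = ∫⁻ ξ, ‖hank a (fun x => G x p.1) ξ * hank a (fun x => G x p.2) ξ‖ₑ ∂(omega a) := by
          refine lintegral_congr fun ξ => ?_
          rw [← ofReal_norm, ← ofReal_norm]
          congr 1
          simp only [norm_mul, RCLike.norm_conj, norm_chirp, one_mul]
      _ ≤ _ := lintegral_enorm_hank_mul_le ha (hG.inX ha _) (hG.inX ha _)
      _ ≤ _ := by
          gcongr
          · exact hb p.1
          · exact hb p.2
  refine (lintegral_mono hle).trans_lt ?_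
  have := ((integrable_tbox n K).mul_prod (integrable_tbox n K)).lintegral_lt_top
  exact this

lemma conj_pair_eq (a : ℝ) (G : ℝ → ℝ → ℂ) (t s ξ : ℝ) :
    (chirp t ξ * hank a (fun x => G x t) ξ) *
      (starRingEnd ℂ) (chirp s ξ * hank a (fun x => G x s) ξ) =
    chirp (t - s) ξ *
      (hank a (fun x => G x t) ξ * hank a (fun x => (starRingEnd ℂ) (G x s)) ξ) := by
  rw [map_mul, conj_chirp, hank_conj, sub_eq_add_neg, chirp_add]
  ring

lemma spaceTimeNorm_conj (a p : ℝ) (G : ℝ → ℝ → ℂ) :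
    spaceTimeNorm a p (fun x t => (starRingEnd ℂ) (G x t)) = spaceTimeNorm a p G := by
  unfold spaceTimeNorm
  congr 1
  refine lintegral_congr fun t => lintegral_congr fun x => ?_
  rw [← ofReal_norm, RCLike.norm_conj, ofReal_norm]

/-- The `T T*` argument: the squared `L²` norm of the frequency average expands into the double time
integral of `pairQ a (t - s)` applied to `G(t)` and the conjugate of `G(s)`, which the bilinear
estimate bounds. -/
lemma exists_freqAvg_bound {a : ℝ} (ha : 0 ≤ a) :
    ∃ C : ℝ≥0∞, C ≠ ⊤ ∧ ∀ G, IsTest G →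
      eLpNorm (freqAvg a G) 2 (omega a) ≤ C * spaceTimeNorm a (strP a) G := by
  obtain ⟨C, hC, H⟩ := exists_bilinear_strichartz ha
  refine ⟨C ^ (1 / 2 : ℝ), ENNReal.rpow_ne_top_of_nonneg (by norm_num) hC, fun G hG => ?_⟩
  have hi := hG.integrable_pair ha
  have hsq : ∀ ξ, ∫ z : ℝ × ℝ, (chirp z.1 ξ * hank a (fun x => G x z.1) ξ) *
      (starRingEnd ℂ) (chirp z.2 ξ * hank a (fun x => G x z.2) ξ) =
      ((‖freqAvg a G ξ‖ ^ 2 : ℝ) : ℂ) := by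
    intro ξ
    rw [Measure.volume_eq_prod, integral_prod_mul (fun t => chirp t ξ * hank a (fun x => G x t) ξ)
      (fun t => (starRingEnd ℂ) (chirp t ξ * hank a (fun x => G x t) ξ)), integral_conj]
    change freqAvg a G ξ * (starRingEnd ℂ) (freqAvg a G ξ) = _
    rw [Complex.mul_conj, Complex.normSq_eq_norm_sq]
  have hswap : ∫ ξ, ((‖freqAvg a G ξ‖ ^ 2 : ℝ) : ℂ) ∂(omega a) = ∫ z : ℝ × ℝ,
      pairQ a (z.1 - z.2) (fun x => G x z.1) (fun x => (starRingEnd ℂ) (G x z.2)) := by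
    simp_rw [← hsq]
    rw [Measure.volume_eq_prod, ← integral_integral_swap hi]
    simp_rw [conj_pair_eq]
    rfl
  have hsqi : Integrable (fun ξ => ‖freqAvg a G ξ‖ ^ 2) (omega a) := by
    have h1 := hi.integral_prod_right
    have h2 : Integrable (fun ξ => ((‖freqAvg a G ξ‖ ^ 2 : ℝ) : ℂ)) (omega a) :=
      h1.congr (Eventually.of_forall fun ξ => hsq ξ)
    exact h2.re
  have hl : ∫⁻ ξ, ‖freqAvg a G ξ‖ₑ ^ (2 : ℝ) ∂(omega a) =
      ‖∫ ξ, ((‖freqAvg a G ξ‖ ^ 2 : ℝ) : ℂ) ∂(omega a)‖ₑ := by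
    rw [integral_complex_ofReal, ← ofReal_norm, Complex.norm_real,
      Real.norm_of_nonneg (integral_nonneg fun ξ => by positivity),
      ofReal_integral_eq_lintegral_ofReal hsqi (Eventually.of_forall fun ξ => by positivity)]
    refine lintegral_congr fun ξ => ?_
    rw [ENNReal.ofReal_pow (norm_nonneg _), ofReal_norm]
    exact_mod_cast rfl
  have hbound : ∫⁻ ξ, ‖freqAvg a G ξ‖ₑ ^ (2 : ℝ) ∂(omega a) ≤
      C * (spaceTimeNorm a (strP a) G * spaceTimeNorm a (strP a) G) := by
    rw [hl, hswap]
    refine (enorm_integral_le_lintegral_enorm _).trans ?_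
    rw [Measure.volume_eq_prod]
    refine (lintegral_prod_le _).trans ?_
    have hGm := hG.meas
    have hcm : Measurable fun q : ℝ × ℝ => (starRingEnd ℂ) (G q.1 q.2) :=
      Complex.continuous_conj.measurable.comp hGm
    have hcX : ∀ t, InX a (fun x => (starRingEnd ℂ) (G x t)) := fun t =>
      (hG.inX ha t).mono (measurable_slice (G := fun x t => (starRingEnd ℂ) (G x t)) hcm
        t).aestronglyMeasurable
        (Eventually.of_forall fun x => by rw [RCLike.norm_conj])
    have := H (fun x t => (starRingEnd ℂ) (G x t)) G hcm hGm hcX (hG.inX ha)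
    rwa [spaceTimeNorm_conj] at this
  rw [eLpNorm_two_eq_lintegral]
  calc _ ≤ (C * (spaceTimeNorm a (strP a) G * spaceTimeNorm a (strP a) G)) ^ (1 / 2 : ℝ) := by
        gcongr
    _ = _ := by
        rw [ENNReal.mul_rpow_of_nonneg _ _ (by norm_num), ← sq, ← ENNReal.rpow_natCast,
          ← ENNReal.rpow_mul]
        norm_num

/-! ### Duality -/

lemma IsTest.integrable_hom {a : ℝ} (ha : 0 ≤ a) {f : ℝ → ℂ} (hf : Rapid f) {G : ℝ → ℝ → ℂ}
    (hG : IsTest G) :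
    Integrable (fun z : ℝ × ℝ => f z.2 * (chirp z.1 z.2 * hank a (fun x => G x z.1) z.2))
      (volume.prod (omega a)) := by
  obtain ⟨n, K, hK, hb⟩ := hG.exists_hank_bound ha
  have hm : Measurable fun z : ℝ × ℝ =>
      f z.2 * (chirp z.1 z.2 * hank a (fun x => G x z.1) z.2) :=
    (hf.cont.measurable.comp measurable_snd).mul (measurable_chirp_mul_hank ha hG.meas)
  refine ((integrable_tbox n K).mul_prod (hf.integrable ha).norm).mono' hm.aestronglyMeasurable
    (Eventually.of_forall fun z => ?_)
  rw [norm_mul, norm_mul, norm_chirp, one_mul, mul_comm]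
  gcongr
  exact hb z.1 z.2

lemma IsTest.integral_hom {a : ℝ} (ha : 0 ≤ a) {f : ℝ → ℂ} (hf : Rapid f) {G : ℝ → ℝ → ℂ}
    (hG : IsTest G) :
    ∫ t, ∫ ξ, f ξ * (chirp t ξ * hank a (fun x => G x t) ξ) ∂(omega a) =
      ∫ ξ, f ξ * freqAvg a G ξ ∂(omega a) := by
  rw [integral_integral_swap (hG.integrable_hom ha hf)]
  refine integral_congr_ae (Eventually.of_forall fun ξ => ?_)
  simp only [freqAvg]
  rw [integral_const_mul]

lemma enorm_integral_mul_le {a : ℝ} {f g : ℝ → ℂ} (hf : AEStronglyMeasurable f (omega a))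
    (hg : AEStronglyMeasurable g (omega a)) :
    ‖∫ ξ, f ξ * g ξ ∂(omega a)‖ₑ ≤ eLpNorm f 2 (omega a) * eLpNorm g 2 (omega a) := by
  refine (enorm_integral_le_lintegral_enorm _).trans ?_
  have h := eLpNorm_smul_le_mul_eLpNorm (p := 2) (q := 2) (r := 1) hg hf
  rw [eLpNorm_one_eq_lintegral_enorm] at h
  exact h

/-- The Duhamel term tested against a slice. -/
lemma enorm_integral_inhom_le {a : ℝ} (ha : 0 ≤ a) {f : ℝ → ℂ} {F G : ℝ → ℝ → ℂ}
    (hd : FreqData f (fun s => hank a (fun x => F x s))) (hG : IsTest G) (t : ℝ) :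
    ‖∫ ξ, (chirp t ξ * ∫ s in (0 : ℝ)..t, chirp (-s) ξ * hank a (fun x => F x s) ξ) *
      hank a (fun x => G x t) ξ ∂(omega a)‖ₑ ≤
      ∫⁻ s, ‖pairQ a (t - s) (fun x => G x t) (fun x => F x s)‖ₑ := by
  obtain ⟨n, K, hK, hb⟩ := hG.exists_hank_bound ha
  obtain ⟨K1, hK1, hb1⟩ := hd.decay (2 * wexp a)
  set Φ : ℝ → ℝ → ℂ := fun ξ s => chirp (t - s) ξ *
    (hank a (fun x => G x t) ξ * hank a (fun x => F x s) ξ) with hΦ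
  have hmG : Measurable fun ξ => hank a (fun x => G x t) ξ :=
    (continuous_hank ha ((hG.inX ha t).integrable ha)).measurable
  have hmΦ : Measurable (Function.uncurry Φ) := by
    refine Measurable.mul ?_ (Measurable.mul ?_ ?_)
    · exact continuous_chirp.measurable.comp (f := fun z : ℝ × ℝ => (t - z.2, z.1)) (by fun_prop)
    · exact hmG.comp measurable_fst
    · exact hd.cont.measurable.comp (f := fun z : ℝ × ℝ => (z.2, z.1)) (by fun_prop)
  have hi : Integrable (Function.uncurry Φ) ((omega a).prod (volume.restrict (uIoc 0 t))) := by
    have h1 : Integrable (fun ξ => tbox n K t * (K1 * ((1 + ξ ^ 2) ^ (2 * wexp a))⁻¹)) (omega a) :=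
      ((integrable_inv_one_add_sq_pow ha two_wexp_ge).const_mul _).const_mul _
    have h2 : Integrable (fun _ : ℝ => (1 : ℝ)) (volume.restrict (uIoc 0 t)) :=
      integrableOn_const (by simp [uIoc])
    refine (h1.mul_prod h2).mono' hmΦ.aestronglyMeasurable (Eventually.of_forall fun z => ?_)
    simp only [Function.uncurry, hΦ]
    rw [norm_mul, norm_mul, norm_chirp, one_mul, mul_one]
    exact mul_le_mul (hb t z.1) (hb1 z.2 z.1) (norm_nonneg _) (tbox_nonneg n hK t)
  -- The chirps combine to `chirp (t - s)`. For negative `t` the oriented integral contributes only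
  -- a sign, which disappears in the norm.
  have e : ∀ ξ, (chirp t ξ * ∫ s in (0 : ℝ)..t, chirp (-s) ξ * hank a (fun x => F x s) ξ) *
      hank a (fun x => G x t) ξ = (if (0 : ℝ) ≤ t then (1 : ℝ) else -1) •
        ∫ s in uIoc 0 t, Φ ξ s := by
    intro ξ
    rw [intervalIntegral.intervalIntegral_eq_integral_uIoc, mul_smul_comm, smul_mul_assoc,
      ← integral_const_mul, ← integral_mul_const]
    congr 1
    refine integral_congr_ae (Eventually.of_forall fun s => ?_)
    simp only [hΦ, sub_eq_add_neg, chirp_add]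
    ring
  simp_rw [e]
  rw [integral_smul, integral_integral_swap hi, enorm_smul]
  have h1 : ‖(if (0 : ℝ) ≤ t then (1 : ℝ) else -1)‖ₑ = 1 := by split_ifs <;> simp
  rw [h1, one_mul]
  refine (enorm_integral_le_lintegral_enorm _).trans ?_
  -- With the modulus inside, the causal restriction on `s` is simply dropped.
  exact setLIntegral_le_lintegral _ _

/-- The forcing term is controlled only for `x > 0`. Cutting it off there gives joint measurability
on the plane and changes nothing almost everywhere for `omega a`. -/
lemma measurable_indicator_Ioi {F : ℝ → ℝ → ℂ} (hF : IsSchwartzHalfPlane F) :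
    Measurable fun q : ℝ × ℝ => (Ioi (0 : ℝ)).indicator (fun x => F x q.2) q.1 := by
  have hS : MeasurableSet (Ioi (0 : ℝ) ×ˢ (univ : Set ℝ)) := measurableSet_Ioi.prod .univ
  have h1 : Measurable ((Ioi (0 : ℝ) ×ˢ (univ : Set ℝ)).indicator fun q : ℝ × ℝ => F q.1 q.2) := by
    classical
    rw [← piecewise_eq_indicator]
    exact hF.smooth.continuousOn.measurable_piecewise continuousOn_const hS
  convert! h1 using 1
  ext q
  by_cases hq : 0 < q.1
  · rw [indicator_of_mem (show q.1 ∈ Ioi (0 : ℝ) from hq),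
      indicator_of_mem (show q ∈ Ioi (0 : ℝ) ×ˢ (univ : Set ℝ) from ⟨hq, mem_univ _⟩)]
  · rw [indicator_of_notMem (show q.1 ∉ Ioi (0 : ℝ) from hq),
      indicator_of_notMem (show q ∉ Ioi (0 : ℝ) ×ˢ (univ : Set ℝ) from fun h => hq h.1)]

lemma indicator_Ioi_ae_eq (a : ℝ) (f : ℝ → ℂ) : (Ioi (0 : ℝ)).indicator f =ᵐ[omega a] f := by
  filter_upwards [ae_omega_pos a] with x hx using indicator_of_mem hx f

lemma pairQ_congr_right {a : ℝ} (τ : ℝ) (f : ℝ → ℂ) {g h : ℝ → ℂ} (hgh : g =ᵐ[omega a] h) :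
    pairQ a τ f g = pairQ a τ f h := by
  unfold pairQ
  simp_rw [hank_congr hgh]

lemma exists_inhom_bound {a : ℝ} (ha : 0 ≤ a) :
    ∃ C : ℝ≥0∞, C ≠ ⊤ ∧ ∀ F G, IsSchwartzHalfPlane F → IsTest G →
      ∫⁻ t, ∫⁻ s, ‖pairQ a (t - s) (fun x => G x t) (fun x => F x s)‖ₑ ≤
        C * (spaceTimeNorm a (strP a) G * spaceTimeNorm a (strP a) F) := by
  obtain ⟨C, hC, H⟩ := exists_bilinear_strichartz ha
  refine ⟨C, hC, fun F G hF hG => ?_⟩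
  have hX : ∀ t, InX a ((Ioi (0 : ℝ)).indicator fun x => F x t) := fun t =>
    (hF.unifSchwartz.inX ha t).mono
      (((hF.unifSchwartz.inX ha t).aestronglyMeasurable).congr (indicator_Ioi_ae_eq a _).symm)
      (by filter_upwards [indicator_Ioi_ae_eq a fun x => F x t] with x hx; rw [hx])
  have h := H (fun x t => (Ioi (0 : ℝ)).indicator (fun x => F x t) x) G
    (measurable_indicator_Ioi hF) hG.meas hX (hG.inX ha)
  have e1 : ∀ t s, pairQ a (t - s) (fun x => G x t)
      (fun x => (Ioi (0 : ℝ)).indicator (fun x => F x s) x) =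
      pairQ a (t - s) (fun x => G x t) (fun x => F x s) := fun t s =>
    pairQ_congr_right _ _ (indicator_Ioi_ae_eq a _)
  have e2 : spaceTimeNorm a (strP a) (fun x t => (Ioi (0 : ℝ)).indicator (fun x => F x t) x) =
      spaceTimeNorm a (strP a) F := by
    unfold spaceTimeNorm
    congr 1
    refine lintegral_congr fun t => lintegral_congr_ae ?_
    filter_upwards [indicator_Ioi_ae_eq a fun x => F x t] with x hx
    rw [hx]
  simp_rw [e1] at h
  rwa [e2] at h

/-- Moving the transform onto the test function splits the pairing by Duhamel's formula. The initial
datum is paired with `freqAvg` through Cauchy–Schwarz, and the forcing term is bounded by the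
bilinear estimate. -/
lemma exists_dual_bound {a : ℝ} (ha : 0 ≤ a) :
    ∃ C : ℝ≥0∞, C ≠ ⊤ ∧ ∀ φ F G, IsSchwartzHalfLine φ → IsSchwartzHalfPlane F → IsTest G →
      ‖∫ t, ∫ x, sol a φ F x t * G x t ∂(omega a)‖ₑ ≤
        C * (eLpNorm φ 2 (omega a) + spaceTimeNorm a (strP a) F) *
          spaceTimeNorm a (strP a) G := by
  obtain ⟨C1, hC1, H1⟩ := exists_freqAvg_bound ha
  obtain ⟨C2, hC2, H2⟩ := exists_inhom_bound ha
  refine ⟨C1 + C2, ENNReal.add_ne_top.2 ⟨hC1, hC2⟩, fun φ F G hφ hF hG => ?_⟩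
  have hd := freqData_hank ha hφ hF
  set f := hank a φ with hf
  set H : ℝ → ℂ := fun t => ∫ ξ, f ξ * (chirp t ξ * hank a (fun x => G x t) ξ) ∂(omega a) with hH
  set S : ℝ → ℂ := fun t =>
    ∫ ξ, (chirp t ξ * ∫ s in (0 : ℝ)..t, chirp (-s) ξ * hank a (fun x => F x s) ξ) *
      hank a (fun x => G x t) ξ ∂(omega a) with hS
  obtain ⟨n, K, hK, hb⟩ := hG.exists_hank_bound ha
  have hmG : ∀ t, AEStronglyMeasurable (fun ξ => hank a (fun x => G x t) ξ) (omega a) := fun t =>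
    (continuous_hank ha ((hG.inX ha t).integrable ha)).aestronglyMeasurable
  have hdec : ∀ t, ∫ x, sol a φ F x t * G x t ∂(omega a) = H t + S t := by
    intro t
    have hr := hd.rapid_duhamel t
    unfold sol
    rw [integral_hank_mul ha (hr.integrable ha) ((hG.inX ha t).integrable ha)]
    have hi1 : Integrable (fun ξ => f ξ * (chirp t ξ * hank a (fun x => G x t) ξ)) (omega a) := by
      refine (hd.rapid.integrable ha).mul_bdd (c := tbox n K t) ?_
        (Eventually.of_forall fun ξ => ?_)
      · exact ((continuous_chirp.comp
          (continuous_const.prodMk continuous_id)).aestronglyMeasurable).mul (hmG t)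
      · rw [norm_mul, norm_chirp, one_mul]
        exact hb t ξ
    have hi0 : Integrable (fun ξ => duhamel f (fun s => hank a (fun x => F x s)) t ξ *
        hank a (fun x => G x t) ξ) (omega a) :=
      (hr.integrable ha).mul_bdd (c := tbox n K t) (hmG t) (Eventually.of_forall fun ξ => hb t ξ)
    have hi2 : Integrable (fun ξ => (chirp t ξ * ∫ s in (0 : ℝ)..t, chirp (-s) ξ *
        hank a (fun x => F x s) ξ) * hank a (fun x => G x t) ξ) (omega a) := by
      refine (hi0.sub hi1).congr (Eventually.of_forall fun ξ => ?_)
      simp only [Pi.sub_apply, duhamel]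
      ring
    rw [hH, hS, ← integral_add hi1 hi2]
    refine integral_congr_ae (Eventually.of_forall fun ξ => ?_)
    simp only [duhamel]
    ring
  have hHi : Integrable H := (hG.integrable_hom ha hd.rapid).integral_prod_left
  have hHb : ‖∫ t, H t‖ₑ ≤ C1 * eLpNorm φ 2 (omega a) * spaceTimeNorm a (strP a) G := by
    rw [hH, hG.integral_hom ha hd.rapid]
    refine (enorm_integral_mul_le hd.rapid.cont.aestronglyMeasurable
      (measurable_freqAvg ha hG.meas).aestronglyMeasurable).trans ?_
    calc _ ≤ eLpNorm φ 2 (omega a) * (C1 * spaceTimeNorm a (strP a) G) := by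
          gcongr
          · exact eLpNorm_hank_le ha (hφ.unifSchwartz.inX ha ())
          · exact H1 G hG
      _ = _ := by ring
  have hSb : ‖∫ t, S t‖ₑ ≤ C2 * spaceTimeNorm a (strP a) F * spaceTimeNorm a (strP a) G := by
    refine (enorm_integral_le_lintegral_enorm _).trans
      ((lintegral_mono fun t => enorm_integral_inhom_le ha hd hG t).trans
        ((H2 F G hF hG).trans (le_of_eq ?_)))
    ring
  simp_rw [hdec]
  by_cases hSi : Integrable S
  · rw [integral_add hHi hSi]
    refine (enorm_add_le _ _).trans ((add_le_add hHb hSb).trans ?_)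
    rw [← add_mul]
    gcongr
    rw [mul_add]
    gcongr
    · exact le_self_add
    · exact le_add_self
  -- If the Duhamel part is not integrable in time, neither is the total, because the homogeneous
  -- part is. The integral is then zero by convention and the bound is trivial, so integrability of
  -- `S` never has to be proved.
  · rw [integral_undef]
    · simp
    · intro h
      refine hSi ((h.sub hHi).congr (Eventually.of_forall fun t => ?_))
      simp

/-! ### The space-time estimate -/

/-- The exponent conjugate to `strP a`. -/
def strQ (a : ℝ) : ℝ := 2 * (a + 3) / (a + 1)

lemma two_lt_strQ {a : ℝ} (ha : 0 ≤ a) : 2 < strQ a := by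
  unfold strQ
  rw [lt_div_iff₀ (by linarith)]
  linarith

lemma strQ_sub_one_mul {a : ℝ} (ha : 0 ≤ a) : (strQ a - 1) * strP a = strQ a := by
  have h1 : a + 1 ≠ 0 := by linarith
  have h5 : a + 5 ≠ 0 := by linarith
  unfold strQ strP
  field_simp
  ring

lemma inv_strQ_add_inv_strP {a : ℝ} (ha : 0 ≤ a) : 1 / strQ a + 1 / strP a = 1 := by
  have h1 : a + 1 ≠ 0 := by linarith
  have h3 : a + 3 ≠ 0 := by linarith
  have h5 : a + 5 ≠ 0 := by linarith
  unfold strQ strP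
  field_simp
  ring

/-- The truncated dual function `ū |u|^{q-2}`. -/
def dualFun (q : ℝ) (n : ℕ) (u : ℝ → ℝ → ℂ) (x t : ℝ) : ℂ :=
  (Ioc (0 : ℝ) n ×ˢ Icc (-(n : ℝ)) n).indicator
    (fun z => (starRingEnd ℂ) (u z.1 z.2) * ((‖u z.1 z.2‖ ^ (q - 2) : ℝ) : ℂ)) (x, t)

lemma measurableSet_box (n : ℕ) : MeasurableSet (Ioc (0 : ℝ) n ×ˢ Icc (-(n : ℝ)) n) :=
  measurableSet_Ioc.prod measurableSet_Icc

lemma isTest_dualFun {q : ℝ} (hq : 2 < q) (n : ℕ) {u : ℝ → ℝ → ℂ}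
    (hu : Measurable fun z : ℝ × ℝ => u z.1 z.2) {K : ℝ} (hb : ∀ x t, ‖u x t‖ ≤ K * (1 + |t|)) :
    IsTest (dualFun q n u) := by
  refine ⟨?_, n, (|K| * (1 + n)) * (|K| * (1 + n)) ^ (q - 2), by positivity, fun x t => ?_,
    fun x t h => ?_⟩
  · refine Measurable.indicator (Measurable.mul ?_ ?_) (measurableSet_box n)
    · exact Complex.continuous_conj.measurable.comp hu
    · exact Complex.measurable_ofReal.comp (hu.norm.pow_const _)
  · by_cases hz : (x, t) ∈ Ioc (0 : ℝ) n ×ˢ Icc (-(n : ℝ)) n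
    · have ht : |t| ≤ n := abs_le.2 ⟨hz.2.1, hz.2.2⟩
      have h1 : ‖u x t‖ ≤ |K| * (1 + n) := by
        refine (hb x t).trans ?_
        gcongr
        exact le_abs_self K
      rw [dualFun, indicator_of_mem hz, norm_mul, RCLike.norm_conj, Complex.norm_real,
        Real.norm_of_nonneg (by positivity)]
      gcongr
    · rw [dualFun, indicator_of_notMem hz, norm_zero]
      positivity
  · refine indicator_of_notMem (fun hz => h ?_) _
    exact ⟨hz.1.2, abs_le.2 ⟨hz.2.1, hz.2.2⟩⟩

lemma mul_dualFun {q : ℝ} (hq : 2 < q) (n : ℕ) (u : ℝ → ℝ → ℂ) (x t : ℝ) :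
    u x t * dualFun q n u x t = (((Ioc (0 : ℝ) n ×ˢ Icc (-(n : ℝ)) n).indicator
      (fun z => ‖u z.1 z.2‖ ^ q) (x, t) : ℝ) : ℂ) := by
  by_cases hz : (x, t) ∈ Ioc (0 : ℝ) n ×ˢ Icc (-(n : ℝ)) n
  · rw [dualFun, indicator_of_mem hz, indicator_of_mem hz, ← mul_assoc, Complex.mul_conj,
      ← Complex.ofReal_mul, Complex.normSq_eq_norm_sq]
    congr 1
    simp only
    rcases (norm_nonneg (u x t)).eq_or_lt with h0 | h0
    · rw [← h0, Real.zero_rpow (show q ≠ 0 by linarith)]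
      ring
    · rw [← Real.rpow_natCast, ← Real.rpow_add h0]
      congr 1
      push_cast
      ring
  · rw [dualFun, indicator_of_notMem hz, indicator_of_notMem hz]
    simp

lemma enorm_dualFun_rpow {q p : ℝ} (hq : 2 < q) (hp : 0 < p) (hqp : (q - 1) * p = q) (n : ℕ)
    (u : ℝ → ℝ → ℂ) (x t : ℝ) :
    ‖dualFun q n u x t‖ₑ ^ p =
      (Ioc (0 : ℝ) n ×ˢ Icc (-(n : ℝ)) n).indicator (fun z => ‖u z.1 z.2‖ₑ ^ q) (x, t) := by
  by_cases hz : (x, t) ∈ Ioc (0 : ℝ) n ×ˢ Icc (-(n : ℝ)) n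
  · rw [dualFun, indicator_of_mem hz, indicator_of_mem hz]
    simp only
    have h1 : ‖(starRingEnd ℂ) (u x t) * ((‖u x t‖ ^ (q - 2) : ℝ) : ℂ)‖ = ‖u x t‖ ^ (q - 1) := by
      rw [norm_mul, RCLike.norm_conj, Complex.norm_real, Real.norm_of_nonneg (by positivity)]
      rcases (norm_nonneg (u x t)).eq_or_lt with h0 | h0
      · rw [← h0, Real.zero_rpow (by linarith : q - 1 ≠ 0)]
        ring
      · rw [mul_comm, ← Real.rpow_add_one h0.ne']
        congr 1
        ring
    rw [← ofReal_norm, h1, ← ENNReal.ofReal_rpow_of_nonneg (norm_nonneg _) (by linarith),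
      ofReal_norm, ← ENNReal.rpow_mul, hqp]
  · rw [dualFun, indicator_of_notMem hz, indicator_of_notMem hz, enorm_zero,
      ENNReal.zero_rpow_of_pos hp]

lemma measurable_sol {a : ℝ} (ha : 0 ≤ a) {φ : ℝ → ℂ} {F : ℝ → ℝ → ℂ}
    (hφ : IsSchwartzHalfLine φ) (hF : IsSchwartzHalfPlane F) :
    Measurable fun z : ℝ × ℝ => sol a φ F z.1 z.2 := by
  have hd := freqData_hank ha hφ hF
  obtain ⟨v, hv⟩ : ∃ v : ℝ → ℝ → ℂ, v = fun ξ t =>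
      duhamel (hank a φ) (fun s => hank a (fun x => F x s)) t ξ := ⟨_, rfl⟩
  have h : Measurable fun q : ℝ × ℝ => v q.1 q.2 := by
    simpa only [hv, Function.comp_def, Prod.fst_swap, Prod.snd_swap] using
      (hd.continuous_duhamel.comp continuous_swap).measurable
  have h2 := (measurable_hank_slice ha h).comp measurable_swap
  simpa only [sol, hv, Function.comp_def, Prod.fst_swap, Prod.snd_swap] using h2

/-- A crude bound whose only purpose is to make the dual functions admissible tests and the
truncated integrals finite. -/
lemma exists_sol_bound {a : ℝ} (ha : 0 ≤ a) {φ : ℝ → ℂ} {F : ℝ → ℝ → ℂ}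
    (hφ : IsSchwartzHalfLine φ) (hF : IsSchwartzHalfPlane F) :
    ∃ K : ℝ, ∀ x t, ‖sol a φ F x t‖ ≤ K * (1 + |t|) := by
  have hd := freqData_hank ha hφ hF
  obtain ⟨K, hK, hb⟩ := hd.exists_duhamel_decay (2 * wexp a)
  have hM := gaussMoment_pos ha
  refine ⟨(gaussMoment a)⁻¹ * (K * ∫ ξ, ((1 + ξ ^ 2) ^ (2 * wexp a))⁻¹ ∂(omega a)), fun x t => ?_⟩
  refine (norm_hank_le ha ((hd.rapid_duhamel t).integrable ha) x).trans ?_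
  calc _ ≤ (gaussMoment a)⁻¹ *
        ∫ ξ, K * (1 + |t|) * ((1 + ξ ^ 2) ^ (2 * wexp a))⁻¹ ∂(omega a) := by
        refine mul_le_mul_of_nonneg_left ?_ (by positivity)
        exact integral_mono ((hd.rapid_duhamel t).integrable ha).norm
          ((integrable_inv_one_add_sq_pow ha two_wexp_ge).const_mul _) fun ξ => hb t ξ
    _ = _ := by
        rw [integral_const_mul]
        ring

lemma omega_Ioc_lt_top {a : ℝ} (ha : 0 ≤ a) (n : ℕ) : omega a (Ioc (0 : ℝ) n) < ⊤ := by
  have h1 : ∀ x ∈ Ioc (0 : ℝ) n, (1 : ℝ≥0∞) ≤ ENNReal.ofReal ((1 + (n : ℝ) ^ 2) ^ (2 * wexp a)) *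
      ‖((1 + x ^ 2) ^ (2 * wexp a))⁻¹‖ₑ := by
    intro x hx
    rw [← ofReal_norm, ← ENNReal.ofReal_mul (by positivity), Real.norm_of_nonneg (by positivity),
      ← ENNReal.ofReal_one, ← div_eq_mul_inv]
    refine ENNReal.ofReal_le_ofReal ((one_le_div (by positivity)).2 ?_)
    have := hx.1.le
    gcongr
    exact hx.2
  have hi := (integrable_inv_one_add_sq_pow ha (two_wexp_ge (a := a))).2
  calc omega a (Ioc (0 : ℝ) n) = ∫⁻ _ in Ioc (0 : ℝ) n, 1 ∂(omega a) := by simp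
    _ ≤ ∫⁻ x in Ioc (0 : ℝ) n, ENNReal.ofReal ((1 + (n : ℝ) ^ 2) ^ (2 * wexp a)) *
      ‖((1 + x ^ 2) ^ (2 * wexp a))⁻¹‖ₑ ∂(omega a) :=
        setLIntegral_mono' measurableSet_Ioc h1
    _ ≤ ∫⁻ x, ENNReal.ofReal ((1 + (n : ℝ) ^ 2) ^ (2 * wexp a)) *
      ‖((1 + x ^ 2) ^ (2 * wexp a))⁻¹‖ₑ ∂(omega a) := setLIntegral_le_lintegral _ _
    _ < ⊤ := by
        rw [lintegral_const_mul' _ _ ENNReal.ofReal_ne_top]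
        exact ENNReal.mul_lt_top ENNReal.ofReal_lt_top hi

lemma integrable_box {a : ℝ} (ha : 0 ≤ a) {q : ℝ} (hq : 2 < q) (n : ℕ) {u : ℝ → ℝ → ℂ}
    (hu : Measurable fun z : ℝ × ℝ => u z.1 z.2) {K : ℝ} (hb : ∀ x t, ‖u x t‖ ≤ K * (1 + |t|)) :
    Integrable (fun z : ℝ × ℝ => (Ioc (0 : ℝ) n ×ˢ Icc (-(n : ℝ)) n).indicator
      (fun z => ‖u z.1 z.2‖ ^ q) (z.2, z.1)) (volume.prod (omega a)) := by
  have hm : Measurable fun z : ℝ × ℝ => (Ioc (0 : ℝ) n ×ˢ Icc (-(n : ℝ)) n).indicator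
      (fun z => ‖u z.1 z.2‖ ^ q) (z.2, z.1) :=
    ((hu.norm.pow_const q).indicator (measurableSet_box n)).comp measurable_swap
  have h1 : Integrable (fun x : ℝ => (Ioc (0 : ℝ) n).indicator (fun _ => (1 : ℝ)) x) (omega a) :=
    (integrable_indicator_iff measurableSet_Ioc).2
      (integrableOn_const (omega_Ioc_lt_top ha n).ne)
  refine ((integrable_tbox n ((|K| * (1 + n)) ^ q)).mul_prod h1).mono' hm.aestronglyMeasurable
    (Eventually.of_forall fun z => ?_)
  by_cases hz : (z.2, z.1) ∈ Ioc (0 : ℝ) n ×ˢ Icc (-(n : ℝ)) n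
  · have ht : |z.1| ≤ n := abs_le.2 ⟨hz.2.1, hz.2.2⟩
    have h1 : ‖u z.2 z.1‖ ≤ |K| * (1 + n) := by
      refine (hb _ _).trans ?_
      gcongr
      exact le_abs_self K
    rw [indicator_of_mem hz, tbox, indicator_of_mem (show z.1 ∈ Icc (-(n : ℝ)) n from hz.2),
      indicator_of_mem (show z.2 ∈ Ioc (0 : ℝ) n from hz.1), mul_one,
      Real.norm_of_nonneg (by positivity)]
    gcongr
  · rw [indicator_of_notMem hz, norm_zero]
    exact mul_nonneg (tbox_nonneg n (by positivity) _) (indicator_nonneg (by simp) _)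

/-- Division by `I ^ (1 / p)` requires `I` to be finite; this is the reason for truncating to boxes.
-/
lemma le_of_le_mul_rpow {I A : ℝ≥0∞} (hI : I ≠ ⊤) {p q : ℝ} (hp : 0 < p) (hq : 0 < q)
    (hpq : 1 / q + 1 / p = 1) (h : I ≤ A * I ^ (1 / p)) : I ^ (1 / q) ≤ A := by
  by_cases h0 : I = 0
  · rw [h0, ENNReal.zero_rpow_of_pos (by positivity)]
    exact zero_le
  have h1 : I = I ^ (1 / q) * I ^ (1 / p) := by
    rw [← ENNReal.rpow_add _ _ h0 hI, hpq, ENNReal.rpow_one]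
  have hne : I ^ (1 / p) ≠ 0 := by simp [h0, hI]
  have hnt : I ^ (1 / p) ≠ ⊤ := ENNReal.rpow_ne_top_of_nonneg (by positivity) hI
  have h2 : I ^ (1 / q) * I ^ (1 / p) ≤ A * I ^ (1 / p) := h1 ▸ h
  exact (ENNReal.mul_le_mul_iff_left hne hnt).1 h2

/-- Monotone convergence: the boxes increase to the half-plane `x > 0`, which carries the whole
measure. -/
lemma lintegral_le_of_box_le {a : ℝ} {w : ℝ × ℝ → ℝ≥0∞} (hw : Measurable w) {B : ℝ≥0∞}
    (h : ∀ n : ℕ, ∫⁻ z : ℝ × ℝ, (Ioc (0 : ℝ) n ×ˢ Icc (-(n : ℝ)) n).indicator w (z.2, z.1)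
      ∂(volume.prod (omega a)) ≤ B) :
    ∫⁻ z : ℝ × ℝ, w (z.2, z.1) ∂(volume.prod (omega a)) ≤ B := by
  have hae : ∀ᵐ z : ℝ × ℝ ∂(volume.prod (omega a)), 0 < z.2 :=
    Measure.quasiMeasurePreserving_snd.ae (ae_omega_pos a)
  have hle : ∫⁻ z : ℝ × ℝ, w (z.2, z.1) ∂(volume.prod (omega a)) ≤
      ∫⁻ z : ℝ × ℝ, ⨆ n : ℕ, (Ioc (0 : ℝ) n ×ˢ Icc (-(n : ℝ)) n).indicator w (z.2, z.1)
        ∂(volume.prod (omega a)) := by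
    refine lintegral_mono_ae ?_
    filter_upwards [hae] with z hz
    obtain ⟨n, hn⟩ := exists_nat_ge (max z.2 |z.1|)
    refine le_trans (le_of_eq ?_) (le_iSup _ n)
    refine (indicator_of_mem ?_ w).symm
    exact ⟨⟨hz, (le_max_left _ _).trans hn⟩, abs_le.1 ((le_max_right _ _).trans hn)⟩
  refine hle.trans ?_
  rw [lintegral_iSup]
  · exact iSup_le h
  · exact fun n => (hw.indicator (measurableSet_box n)).comp measurable_swap
  · intro m n hmn z
    have hmn' : (m : ℝ) ≤ n := by exact_mod_cast hmn
    exact indicator_le_indicator_of_subset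
      (prod_mono (Ioc_subset_Ioc_right hmn') (Icc_subset_Icc (neg_le_neg hmn') hmn'))
      (fun _ => zero_le) _

lemma lintegral_swap_eq {a : ℝ} {w : ℝ × ℝ → ℝ≥0∞} (hw : Measurable w) :
    ∫⁻ z : ℝ × ℝ, w (z.2, z.1) ∂(volume.prod (omega a)) =
      ∫⁻ t, ∫⁻ x, w (x, t) ∂(omega a) := by
  have : Measurable fun z : ℝ × ℝ => w (z.2, z.1) := hw.comp measurable_swap
  rw [lintegral_prod _ this.aemeasurable]

/-- The Strichartz estimate for the solution. -/
lemma exists_strichartz {a : ℝ} (ha : 0 ≤ a) :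
    ∃ C : ℝ≥0∞, C ≠ ⊤ ∧ ∀ φ F, IsSchwartzHalfLine φ → IsSchwartzHalfPlane F →
      spaceTimeNorm a (strQ a) (sol a φ F) ≤
        C * (eLpNorm φ 2 (omega a) + spaceTimeNorm a (strP a) F) := by
  obtain ⟨C, hC, H⟩ := exists_dual_bound ha
  refine ⟨C, hC, fun φ F hφ hF => ?_⟩
  have hq2 := two_lt_strQ ha
  have hq0 : 0 < strQ a := by linarith
  have hp0 : 0 < strP a := by linarith [one_lt_strP ha]
  set A := C * (eLpNorm φ 2 (omega a) + spaceTimeNorm a (strP a) F) with hA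
  set u := sol a φ F with hu
  have hm : Measurable fun z : ℝ × ℝ => u z.1 z.2 := measurable_sol ha hφ hF
  obtain ⟨K, hK⟩ := exists_sol_bound ha hφ hF
  have hmw : Measurable fun z : ℝ × ℝ => ‖u z.1 z.2‖ₑ ^ strQ a := hm.enorm.pow_const _
  have key : ∀ n : ℕ, ∫⁻ z : ℝ × ℝ, (Ioc (0 : ℝ) n ×ˢ Icc (-(n : ℝ)) n).indicator
      (fun z => ‖u z.1 z.2‖ₑ ^ strQ a) (z.2, z.1) ∂(volume.prod (omega a)) ≤ A ^ strQ a := by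
    intro n
    set I := ∫⁻ z : ℝ × ℝ, (Ioc (0 : ℝ) n ×ˢ Icc (-(n : ℝ)) n).indicator
      (fun z => ‖u z.1 z.2‖ₑ ^ strQ a) (z.2, z.1) ∂(volume.prod (omega a)) with hI
    have hib := integrable_box ha hq2 n hm hK
    have e0 : ∀ z : ℝ × ℝ, ENNReal.ofReal ((Ioc (0 : ℝ) n ×ˢ Icc (-(n : ℝ)) n).indicator
        (fun z => ‖u z.1 z.2‖ ^ strQ a) (z.2, z.1)) =
        (Ioc (0 : ℝ) n ×ˢ Icc (-(n : ℝ)) n).indicator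
          (fun z => ‖u z.1 z.2‖ₑ ^ strQ a) (z.2, z.1) := by
      intro z
      by_cases hz : (z.2, z.1) ∈ Ioc (0 : ℝ) n ×ˢ Icc (-(n : ℝ)) n
      · rw [indicator_of_mem hz, indicator_of_mem hz,
          ← ENNReal.ofReal_rpow_of_nonneg (norm_nonneg _) hq0.le, ofReal_norm]
      · rw [indicator_of_notMem hz, indicator_of_notMem hz, ENNReal.ofReal_zero]
    have hnn : ∀ z : ℝ × ℝ, 0 ≤ (Ioc (0 : ℝ) n ×ˢ Icc (-(n : ℝ)) n).indicator
        (fun z => ‖u z.1 z.2‖ ^ strQ a) (z.2, z.1) := fun z =>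
      indicator_nonneg (fun _ _ => by positivity) _
    -- The product with the dual function is `|u| ^ q` on the box, so the pairing is nonnegative and
    -- its modulus is the box integral itself.
    have hIeq : I = ‖∫ t, ∫ x, u x t * dualFun (strQ a) n u x t ∂(omega a)‖ₑ := by
      simp_rw [mul_dualFun hq2]
      have hibc : Integrable (fun z : ℝ × ℝ => (((Ioc (0 : ℝ) n ×ˢ Icc (-(n : ℝ)) n).indicator
          (fun z => ‖u z.1 z.2‖ ^ strQ a) (z.2, z.1) : ℝ) : ℂ)) (volume.prod (omega a)) :=
        hib.ofReal
      have e1 := integral_prod _ hibc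
      rw [← e1, integral_complex_ofReal, ← ofReal_norm, Complex.norm_real,
        Real.norm_of_nonneg (integral_nonneg hnn),
        ofReal_integral_eq_lintegral_ofReal hib (Eventually.of_forall hnn)]
      simp_rw [e0]
      rfl
    have hIt : I ≠ ⊤ := by rw [hIeq]; exact enorm_ne_top
    have hIp : spaceTimeNorm a (strP a) (dualFun (strQ a) n u) = I ^ (1 / strP a) := by
      unfold spaceTimeNorm
      simp_rw [enorm_dualFun_rpow hq2 hp0 (strQ_sub_one_mul ha)]
      rw [hI, lintegral_swap_eq (hmw.indicator (measurableSet_box n))]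
    -- The dual function has `L^p` norm `I ^ (1 / p)` because `(q - 1) p = q`, so duality returns a
    -- self-improving inequality for `I`.
    have h1 : I ≤ A * I ^ (1 / strP a) := by
      have := H φ F _ hφ hF (isTest_dualFun hq2 n hm hK)
      rwa [← hIeq, hIp] at this
    have h2 := le_of_le_mul_rpow hIt hp0 hq0 (inv_strQ_add_inv_strP ha) h1
    calc I = (I ^ (1 / strQ a)) ^ strQ a := by
          rw [← ENNReal.rpow_mul, one_div_mul_cancel hq0.ne', ENNReal.rpow_one]
      _ ≤ A ^ strQ a := by gcongr
  have h3 := lintegral_le_of_box_le hmw key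
  rw [lintegral_swap_eq hmw] at h3
  unfold spaceTimeNorm
  calc _ ≤ (A ^ strQ a) ^ (1 / strQ a) := by gcongr
    _ = A := by rw [← ENNReal.rpow_mul, mul_one_div_cancel hq0.ne', ENNReal.rpow_one]

end BesselSchrodinger

end

theorem corollary1p5 (a : ℝ) (ha : 0 ≤ a) :
    ∃ C : ℝ, 0 < C ∧
      ∀ (φ : ℝ → ℂ) (F : ℝ → ℝ → ℂ),
        BesselSchrodinger.IsSchwartzHalfLine φ → BesselSchrodinger.IsSchwartzHalfPlane F →
        ∃ u : ℝ → ℝ → ℂ,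
          BesselSchrodinger.IsSolution a φ F u ∧
          (∀ v : ℝ → ℝ → ℂ, BesselSchrodinger.IsSolution a φ F v →
            ∀ x t : ℝ, 0 < x → v x t = u x t) ∧
          BesselSchrodinger.spaceTimeNorm a (2 * (a + 3) / (a + 1)) u ≤
            ENNReal.ofReal C *
              (eLpNorm φ 2 (BesselSchrodinger.omega a) +
                BesselSchrodinger.spaceTimeNorm a (2 * (a + 3) / (a + 5)) F) := by
  obtain ⟨C, hC, H⟩ := BesselSchrodinger.exists_strichartz ha
  -- Adding `1` makes the real constant strictly positive even if `C` is zero.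
  refine ⟨C.toReal + 1, by positivity, fun φ F hφ hF => ?_⟩
  have hs := BesselSchrodinger.isSolution_sol ha hφ hF
  refine ⟨BesselSchrodinger.sol a φ F, hs, fun v hv x t hx => hs.unique ha hv hx, ?_⟩
  refine (H φ F hφ hF).trans ?_
  change _ ≤ _ * (_ + BesselSchrodinger.spaceTimeNorm a (BesselSchrodinger.strP a) F)
  gcongr
  rw [ENNReal.le_ofReal_iff_toReal_le hC (by positivity)]
  linarith
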